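/- Let $k$ be a field and let $S$ be an irreducible quasi-projective variety over $k$ (varieties are reduced separated schemes of finite type over $k$), given with an immersion $S\hookrightarrow\mathbb{P}^n_k$. Let $\overline{S}$ be its projective closure, i.e. the scheme-theoretic image of $S$ in $\mathbb{P}^n_k$, and let $\mathcal{M}$ be a line bundle on $S$. Then there are a projective irreducible variety $S'$ over $k$, a birational morphism $\gamma\colon S'\to\overline{S}$ over $k$ whose restriction $\gamma^{-1}(S)\to S$ is an isomorphism, and a line bundle $\mathcal{M}'$ on $S'$ such that $\mathcal{M}'|_S\cong\mathcal{M}$, where $S$ is identified with the open subscheme $\gamma^{-1}(S)$ of $S'$. Moreover, these can be chosen so that $\gamma$ is a composition $S'\xrightarrow{\,b_2\,}S_1\xrightarrow{\,b_1\,}\overline{S}$ of two blow-ups of the following kind. There are effective Cartier divisors $C$ and $E$ on $S$, with ideal sheaves $\mathcal{O}(-C)$ and $\mathcal{O}(-E)$, such that $\mathcal{M}\cong\mathcal{O}(C-E)$, i.e. $\mathcal{M}\otimes\mathcal{O}(-C)\cong\mathcal{O}(-E)$. The morphism $b_1$ is the blow-up of $\overline{S}$ in a coherent ideal sheaf $\mathcal{C}$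 on $\overline{S}$ with $\mathcal{C}|_S=\mathcal{O}(-C)$, and it is an isomorphism over $S$. The morphism $b_2$ is the blow-up of $S_1$ in a coherent ideal sheaf $\mathcal{E}$ on $S_1$ with $\mathcal{E}|_S=\mathcal{O}(-E)$, where $S$ is identified with $b_1^{-1}(S)\subseteq S_1$, and it is an isomorphism over $S$. -/

import Mathlib

open CategoryTheory CategoryTheory.Limits AlgebraicGeometry

universe u

namespace BlowUpExt

noncomputable section

attribute [local instance] MvPolynomial.gradedAlgebra

/-- Projective space `ℙⁿ` over a field `k`: the `Proj` of `k[x₀, …, xₙ]` with its standard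
grading. -/
def PSpace (n : ℕ) (k : Type u) [Field k] : Scheme.{u} :=
  Proj (MvPolynomial.homogeneousSubmodule (Fin (n + 1)) k)

/-- The structure morphism `ℙⁿ ⟶ Spec k`. -/
def PSpace.toSpec (n : ℕ) (k : Type u) [Field k] : PSpace n k ⟶ Spec (.of k) :=
  Proj.toSpecZero (MvPolynomial.homogeneousSubmodule (Fin (n + 1)) k) ≫
    Spec.map (CommRingCat.ofHom
      (algebraMap k (MvPolynomial.homogeneousSubmodule (Fin (n + 1)) k 0)))

/-- A variety over `k`: a reduced separated scheme of finite type over `k`. -/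
structure IsVariety {k : Type u} [Field k] {X : Scheme.{u}} (f : X ⟶ Spec (.of k)) : Prop where
  isReduced : IsReduced X
  isSeparated : IsSeparated f
  locallyOfFiniteType : LocallyOfFiniteType f
  quasiCompact : QuasiCompact f

/-- A `k`-scheme is projective if it admits a closed immersion over `k` into some `ℙᵐ`. -/
def IsProjective {k : Type u} [Field k] {X : Scheme.{u}} (f : X ⟶ Spec (.of k)) : Prop :=
  ∃ (m : ℕ) (i : X ⟶ PSpace m k), IsClosedImmersion i ∧ i ≫ PSpace.toSpec m k = f

/-- A birational morphism: it restricts to an isomorphism between dense open subschemes of the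
source and of the target. -/
def IsBirationalMorphism {X Y : Scheme.{u}} (f : X ⟶ Y) : Prop :=
  ∃ e : X.PartialIso Y, e.iso.hom ≫ e.target.ι = e.source.ι ≫ f

/-- Let `j : S ⟶ Y` be an open immersion. The morphism `f : X ⟶ Y` is an isomorphism over `S`,
and `j' : S ⟶ X` is the resulting open immersion, which identifies `S` with `f⁻¹(S)`: the square
with sides `j'`, `𝟙 S`, `f`, `j` is cartesian. -/
def IsIsoOver {X Y S : Scheme.{u}} (f : X ⟶ Y) (j : S ⟶ Y) (j' : S ⟶ X) : Prop :=
  IsOpenImmersion j' ∧ IsPullback j' (𝟙 S) f j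

/-- An effective Cartier divisor, given by its ideal sheaf `I = O(-D)`: locally, `I` is generated
by one non-zero-divisor. -/
def IsEffectiveCartier {X : Scheme.{u}} (I : X.IdealSheafData) : Prop :=
  ∀ x : X, ∃ U : X.affineOpens, x ∈ U.1 ∧
    ∃ f ∈ nonZeroDivisors Γ(X, U.1), I.ideal U = Ideal.span {f}

/-- `b : X' ⟶ X` is the blow-up of `X` in the ideal sheaf `I`: the inverse image ideal sheaf
`I · O_{X'}` is an effective Cartier divisor, and `b` is universal with this property. -/
structure IsBlowUp {X X' : Scheme.{u}} (b : X' ⟶ X) (I : X.IdealSheafData) : Prop where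
  isEffectiveCartier : IsEffectiveCartier (I.comap b)
  existsUnique_lift : ∀ (T : Scheme.{u}) (f : T ⟶ X), IsEffectiveCartier (I.comap f) →
    ∃! g : T ⟶ X', g ≫ b = f

/-- The structure sheaf as a sheaf of modules. -/
def structureModule (X : Scheme.{u}) : X.Modules :=
  SheafOfModules.unit X.ringCatSheaf

/-- A line bundle: a sheaf of modules that is locally isomorphic to the structure sheaf. -/
def IsLineBundle {X : Scheme.{u}} (M : X.Modules) : Prop :=
  ∀ x : X, ∃ U : X.Opens, x ∈ U ∧
    Nonempty ((Scheme.Modules.pullback U.ι).obj M ≅ structureModule U.toScheme)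

/-- The tensor product of sheaves of modules: the sheaf associated with `U ↦ M(U) ⊗ N(U)`. -/
def tensor {X : Scheme.{u}} (M N : X.Modules) : X.Modules :=
  (PresheafOfModules.sheafification (𝟙 X.ringCatSheaf.obj)).obj
    (PresheafOfModules.Monoidal.tensorObj (R := X.presheaf) M.val N.val)

/-- The ideal sheaf `I` as a sheaf of modules: the kernel of `O_X ⟶ ι_* O_Z`, where
`ι : Z ⟶ X` is the closed subscheme of `I`. -/
def idealModule {X : Scheme.{u}} (I : X.IdealSheafData) : X.Modules :=
  kernel (C := X.Modules)
    (SheafOfModules.unitToPushforwardObjUnit I.subschemeι.toRingCatSheafHom :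
      structureModule X ⟶
        (Scheme.Modules.pushforward I.subschemeι).obj (structureModule I.subscheme))

/-- `M ≅ O(C - E)` for effective Cartier divisors `C`, `E` with ideal sheaves `O(-C)`, `O(-E)`;
it is expressed as `M ⊗ O(-C) ≅ O(-E)`. -/
def IsODifference {X : Scheme.{u}} (M : X.Modules) (C E : X.IdealSheafData) : Prop :=
  Nonempty (tensor M (idealModule C) ≅ idealModule E)

end

end BlowUpExt

/-! The argument takes place inside the function field `K` of the projective closure. A dominant
`K`-point `η` of a reduced scheme embeds the sections over every nonempty open in `K`. The local
ring at `x` becomes the subring `regularAt η x`, and a line bundle becomes a family of nonzero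
elements of `K`, one generator `m x` per point, locally constant up to units
(`IsLineBundle.exists_presents`). Isomorphisms, tensor products and restrictions of sheaves reduce
to comparing such families (`Valued.Presents.nonempty_iso`, `Valued.Presents.nonempty_tensor_iso`).

To obtain `C` and `E`, let `ξ` be homogeneous coordinates of `η`. Each local generator of `M` is a
quotient `P / Q` of two elements of `K` that behave like forms of one degree. As `S` is
quasi-compact, a product `γ` of finitely many denominators, of some degree `d`, clears all of them.
The family `l = γ / ξ i ^ d`, with `i` a chart around the point, is regular, and so is `m * l`;
these are the local equations of `C` and `E` (`Charts.exists_isCartierDatum`,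
`IsLineBundle.exists_isODifference`).

The ideal sheaf of `C` extends to the closure by direct image, in general not as an invertible
ideal; blowing up makes it invertible. The blow-up is built inside projective space. If `φ l` are
homogeneous generators of the ideal, all of one degree, it is the closure of the `K`-point with
coordinates `ξ i * φ l`. Its chart `(i, l)` is the affine blow-up algebra generated over the
sections on chart `i` by the quotients `φ m / φ l`, and the universal property follows chart by
chart (`BlowUpAtlas.isBlowUp`). The universal property alone shows that nothing changes over `S`,
where the ideal is already invertible (`IsBlowUp.exists_isIsoOver`).

The same construction on `S₁` treats `E`. On `S'` both inverse image ideals are invertible, with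
local equations `c` and `e`, and the family `e / c` defines `M'`; on `S` it agrees with `m` up to
units (`exists_isLineBundle_nonempty_iso`). -/

namespace BlowUpExt

noncomputable section

attribute [local instance] MvPolynomial.gradedAlgebra

/-! ### Sections and local rings as subrings of the field of a dominant point -/

section KPoint

variable {K : Type u} [Field K] {X Y : Scheme.{u}}

/-- The value at a `K`-point `η` of a section on an open containing the image of `η`. -/
def ev (η : Spec (.of K) ⟶ X) (U : X.Opens) (h : ⊤ ≤ η ⁻¹ᵁ U) : Γ(X, U) →+* K :=
  (η.appLE U ⊤ h ≫ (Scheme.ΓSpecIso (.of K)).hom).hom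

lemma ev_map (η : Spec (.of K) ⟶ X) {U V : X.Opens} (i : V ⟶ U) (hV : ⊤ ≤ η ⁻¹ᵁ V)
    (hU : ⊤ ≤ η ⁻¹ᵁ U) (a : Γ(X, U)) :
    ev η V hV (X.presheaf.map i.op a) = ev η U hU a := by
  simp only [ev]
  rw [← Scheme.Hom.map_appLE η hV i.op]
  rfl

lemma ev_appLE (η : Spec (.of K) ⟶ X) (f : X ⟶ Y) {U : Y.Opens} {V : X.Opens}
    (e : V ≤ f ⁻¹ᵁ U) (hV : ⊤ ≤ η ⁻¹ᵁ V) (hU : ⊤ ≤ (η ≫ f) ⁻¹ᵁ U) (a : Γ(Y, U)) :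
    ev η V hV (f.appLE U V e a) = ev (η ≫ f) U hU a := by
  simp only [ev]
  rw [← Scheme.Hom.appLE_comp_appLE η f U V ⊤ e hV]
  rfl

/-- The dense image meets the open, and `Spec K` has only one point. Hence every nonempty open can
be evaluated at `η`. -/
lemma top_le_preimage_of_mem (η : Spec (.of K) ⟶ X) [IsDominant η] {U : X.Opens} {x : X}
    (hx : x ∈ U) : ⊤ ≤ η ⁻¹ᵁ U := by
  obtain ⟨p, hp⟩ := η.denseRange.exists_mem_open U.isOpen ⟨x, hx⟩
  intro q _
  obtain rfl : p = q := Subsingleton.elim (α := PrimeSpectrum K) p q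
  exact hp

lemma exists_mem_of_top_le (η : Spec (.of K) ⟶ X) {U : X.Opens} (h : ⊤ ≤ η ⁻¹ᵁ U) :
    ∃ x, x ∈ U := by
  let p : Spec (.of K) := (⊥ : PrimeSpectrum K)
  exact ⟨η p, h (by trivial : p ∈ ⊤)⟩

/-- A dominant morphism to a reduced scheme is scheme-theoretically dominant. This is what allows
identities between sections to be checked in `K`. -/
lemma ev_injective (η : Spec (.of K) ⟶ X) [IsDominant η] [IsReduced X] {U : X.Opens}
    (h : ⊤ ≤ η ⁻¹ᵁ U) : Function.Injective (ev η U h) := by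
  have := IsSchemeTheoreticallyDominant.of_isDominant η
  have h1 := η.app_injective U
  have h2 : η ⁻¹ᵁ U = ⊤ := top_le_iff.mp h
  simp only [ev, CommRingCat.hom_comp, RingHom.coe_comp]
  refine ((ConcreteCategory.bijective_of_isIso
    (Scheme.ΓSpecIso (.of K)).hom).injective).comp ?_
  have : η.appLE U ⊤ h = η.app U ≫ (Spec (.of K)).presheaf.map (eqToHom h2.symm).op := by
    simp [Scheme.Hom.app_eq_appLE]
  rw [this]
  simp only [CommRingCat.hom_comp, RingHom.coe_comp]
  exact ((ConcreteCategory.bijective_of_isIso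
    ((Spec (.of K)).presheaf.map (eqToHom h2.symm).op)).injective).comp h1

/-- The subring of `K` of values of germs at `x` of sections defined at the `K`-point `η`. -/
def regularAt (η : Spec (.of K) ⟶ X) (x : X) : Subring K where
  carrier := {s | ∃ (U : X.Opens) (_ : x ∈ U) (h : ⊤ ≤ η ⁻¹ᵁ U) (a : Γ(X, U)), ev η U h a = s}
  zero_mem' := ⟨⊤, trivial, le_rfl, 0, map_zero _⟩
  one_mem' := ⟨⊤, trivial, le_rfl, 1, map_one _⟩
  add_mem' := by
    rintro _ _ ⟨U, hU, h, a, rfl⟩ ⟨V, hV, h', b, rfl⟩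
    have h3 : ⊤ ≤ η ⁻¹ᵁ (U ⊓ V) := fun q hq ↦ ⟨h hq, h' hq⟩
    refine ⟨U ⊓ V, ⟨hU, hV⟩, h3, X.presheaf.map (homOfLE inf_le_left).op a +
      X.presheaf.map (homOfLE inf_le_right).op b, ?_⟩
    rw [map_add, ev_map η _ h3 h, ev_map η _ h3 h']
  mul_mem' := by
    rintro _ _ ⟨U, hU, h, a, rfl⟩ ⟨V, hV, h', b, rfl⟩
    have h3 : ⊤ ≤ η ⁻¹ᵁ (U ⊓ V) := fun q hq ↦ ⟨h hq, h' hq⟩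
    refine ⟨U ⊓ V, ⟨hU, hV⟩, h3, X.presheaf.map (homOfLE inf_le_left).op a *
      X.presheaf.map (homOfLE inf_le_right).op b, ?_⟩
    rw [map_mul, ev_map η _ h3 h, ev_map η _ h3 h']
  neg_mem' := by
    rintro _ ⟨U, hU, h, a, rfl⟩
    exact ⟨U, hU, h, -a, map_neg _ _⟩

lemma ev_mem_regularAt (η : Spec (.of K) ⟶ X) {U : X.Opens} (h : ⊤ ≤ η ⁻¹ᵁ U) {x : X}
    (hx : x ∈ U) (a : Γ(X, U)) : ev η U h a ∈ regularAt η x := ⟨U, hx, h, a, rfl⟩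

lemma regularAt_comp_le (η : Spec (.of K) ⟶ X) (f : X ⟶ Y) (x : X) :
    regularAt (η ≫ f) (f x) ≤ regularAt η x := by
  rintro _ ⟨U, hU, h, a, rfl⟩
  exact ⟨f ⁻¹ᵁ U, hU, h, f.appLE U _ le_rfl a, ev_appLE η f le_rfl h h a⟩

/-- The local ring at a point depends only on a neighbourhood, so regularity on an open subscheme
may be tested in the ambient scheme. -/
lemma regularAt_comp (η : Spec (.of K) ⟶ X) (f : X ⟶ Y) [IsOpenImmersion f] (x : X) :
    regularAt (η ≫ f) (f x) = regularAt η x := by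
  refine le_antisymm (regularAt_comp_le η f x) ?_
  rintro _ ⟨U, hU, h, a, rfl⟩
  have h1 : U ≤ f ⁻¹ᵁ (f ''ᵁ U) := (f.preimage_image_eq U).ge
  have h2 : ⊤ ≤ (η ≫ f) ⁻¹ᵁ (f ''ᵁ U) := h.trans fun q hq ↦ h1 hq
  refine ⟨f ''ᵁ U, ⟨x, hU, rfl⟩, h2, (f.appIso U).inv a, ?_⟩
  rw [← ev_appLE η f h1 h h2]
  congr 1
  have := f.appIso_inv_appLE (U := U) (V := U) h1
  rw [← CommRingCat.comp_apply, this]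
  simp

variable (η : Spec (.of K) ⟶ X) [IsDominant η]

/-- A value which is regular at every point of an open comes from a section. -/
lemma exists_ev_eq [IsReduced X] {U : X.Opens} (h : ⊤ ≤ η ⁻¹ᵁ U) (s : K)
    (hs : ∀ x ∈ U, s ∈ regularAt η x) : ∃ a : Γ(X, U), ev η U h a = s := by
  have H : ∀ x : U, ∃ (V : X.Opens) (_ : x.1 ∈ V) (_ : V ≤ U) (h : ⊤ ≤ η ⁻¹ᵁ V) (a : Γ(X, V)),
      ev η V h a = s := by
    rintro ⟨x, hx⟩
    obtain ⟨V, hV, hV', a, rfl⟩ := hs x hx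
    have h3 : ⊤ ≤ η ⁻¹ᵁ (U ⊓ V) := fun q hq ↦ ⟨h hq, hV' hq⟩
    exact ⟨U ⊓ V, ⟨hx, hV⟩, inf_le_left, h3, X.presheaf.map (homOfLE inf_le_right).op a,
      ev_map η _ h3 hV' a⟩
  choose V hxV hVU hV a ha using H
  obtain ⟨b, hb, -⟩ := X.sheaf.existsUnique_gluing' V U (fun x ↦ homOfLE (hVU x))
    (fun x hx ↦ TopologicalSpace.Opens.mem_iSup.mpr ⟨⟨x, hx⟩, hxV ⟨x, hx⟩⟩) a (by
      intro x y
      have h3 : ⊤ ≤ η ⁻¹ᵁ (V x ⊓ V y) := fun q hq ↦ ⟨hV x hq, hV y hq⟩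
      apply ev_injective η h3
      exact (ev_map η _ h3 (hV x) (a x)).trans
        (((ha x).trans (ha y).symm).trans (ev_map η _ h3 (hV y) (a y)).symm))
  obtain ⟨x, hx⟩ := exists_mem_of_top_le η h
  refine ⟨b, ?_⟩
  rw [← ha ⟨x, hx⟩, ← hb ⟨x, hx⟩]
  exact (ev_map η _ (hV _) h b).symm

/-- Nonvanishing at `x` means invertibility of the germ, and by injectivity of evaluation an inverse
in `K` that is regular at `x` is an inverse of the germ. -/
lemma mem_basicOpen_iff [IsReduced X] {U : X.Opens} (h : ⊤ ≤ η ⁻¹ᵁ U) (a : Γ(X, U)) {x : X}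
    (hx : x ∈ U) : x ∈ X.basicOpen a ↔ ev η U h a ≠ 0 ∧ (ev η U h a)⁻¹ ∈ regularAt η x := by
  constructor
  · intro hxa
    have h1 := top_le_preimage_of_mem η hxa
    have h2 : IsUnit (X.presheaf.map (homOfLE (X.basicOpen_le a)).op a) :=
      RingedSpace.isUnit_res_basicOpen _ a
    obtain ⟨b, hb⟩ := h2.exists_right_inv
    have := congr(ev η _ h1 $hb)
    rw [map_mul, map_one, ev_map η _ h1 h] at this
    exact ⟨left_ne_zero_of_mul_eq_one this, X.basicOpen a, hxa, h1, b,
      eq_inv_of_mul_eq_one_right this⟩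
  · rintro ⟨h0, V, hV, hV', b, hb⟩
    rw [Scheme.mem_basicOpen _ _ _ hx]
    have h3 : ⊤ ≤ η ⁻¹ᵁ (U ⊓ V) := fun q hq ↦ ⟨h hq, hV' hq⟩
    have : X.presheaf.map (homOfLE inf_le_left : U ⊓ V ⟶ U).op a *
        X.presheaf.map (homOfLE inf_le_right : U ⊓ V ⟶ V).op b = 1 := by
      apply ev_injective η h3
      rw [map_mul, ev_map η _ h3 h, ev_map η _ h3 hV', hb, map_one, mul_inv_cancel₀ h0]
    have := (IsUnit.of_mul_eq_one _ this).map (X.presheaf.germ (U ⊓ V) x ⟨hx, hV⟩).hom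
    erw [X.presheaf.germ_res_apply] at this
    exact this

/-- The values on a basic open of an affine open form the localization at `f`, so a power of `f`
clears the denominator. -/
lemma exists_pow_mul_ev [IsReduced X] {U : X.Opens} (hU : IsAffineOpen U) (h : ⊤ ≤ η ⁻¹ᵁ U)
    (f : Γ(X, U)) (s : K) (hs : ∀ x ∈ X.basicOpen f, s ∈ regularAt η x) :
    ∃ (n : ℕ) (a : Γ(X, U)), ev η U h a = ev η U h f ^ n * s := by
  -- When `f` has value zero, exponent one makes both sides vanish; exponent zero would not.
  by_cases hf : ev η U h f = 0
  · exact ⟨1, 0, by simp [hf]⟩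
  obtain ⟨p, hp⟩ : ∃ p, p ∈ X.basicOpen f := by
    by_contra! H
    have : X.basicOpen f = ⊥ := by ext x; simpa using H x
    rw [basicOpen_eq_bot_iff] at this
    exact hf (by simp [this])
  have h1 := top_le_preimage_of_mem η hp
  obtain ⟨b, rfl⟩ := exists_ev_eq η h1 s hs
  have := hU.isLocalization_basicOpen f
  obtain ⟨⟨a, ⟨_, n, rfl⟩⟩, e⟩ := IsLocalization.surj (Submonoid.powers f) b
  refine ⟨n, a, ?_⟩
  have := congr(ev η _ h1 $e)
  rw [map_mul] at this
  simp only [RingHom.algebraMap_toAlgebra] at this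
  erw [ev_map η _ h1 h, ev_map η _ h1 h] at this
  rw [← this, map_pow, mul_comm]

end KPoint

/-! ### Gluing in sheaves of modules, and local generators of line bundles -/

section Sections

variable {X : Scheme.{u}}

open AlgebraicGeometry.Scheme

lemma Modules.section_ext (M : X.Modules) {U : X.Opens} {s t : Γ(M, U)}
    (H : ∀ x ∈ U, ∃ (V : X.Opens) (_ : x ∈ V) (i : V ⟶ U),
      M.presheaf.map i.op s = M.presheaf.map i.op t) : s = t := by
  choose V hxV i hV using H
  let F : TopCat.Sheaf Ab X := ⟨M.presheaf, M.isSheaf⟩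
  exact F.eq_of_locally_eq' (fun x : U ↦ V x.1 x.2) U (fun x ↦ i x.1 x.2)
    (fun x hx ↦ TopologicalSpace.Opens.mem_iSup.mpr ⟨⟨x, hx⟩, hxV x hx⟩) s t
    (fun x ↦ hV x.1 x.2)

lemma Modules.subsingleton_of_isEmpty (M : X.Modules) {U : X.Opens} (hU : ∀ x, x ∉ U) :
    Subsingleton Γ(M, U) :=
  ⟨fun _ _ ↦ Modules.section_ext M fun x hx ↦ (hU x hx).elim⟩

lemma Modules.exists_glue (M : X.Modules) {U : X.Opens} {ι : Type u} (V : ι → X.Opens)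
    (i : ∀ x, V x ⟶ U) (hV : U ≤ iSup V) (s : ∀ x, Γ(M, V x))
    (hs : ∀ x y, M.presheaf.map (homOfLE (inf_le_left : V x ⊓ V y ≤ V x)).op (s x) =
      M.presheaf.map (homOfLE (inf_le_right : V x ⊓ V y ≤ V y)).op (s y)) :
    ∃ t : Γ(M, U), ∀ x, M.presheaf.map (i x).op t = s x := by
  let F : TopCat.Sheaf Ab X := ⟨M.presheaf, M.isSheaf⟩
  obtain ⟨t, ht, -⟩ := F.existsUnique_gluing' V U i hV s hs
  exact ⟨t, ht⟩

lemma Modules.isIso_of_bijective {M N : X.Modules} (f : M ⟶ N)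
    (h : ∀ U, Function.Bijective (f.app U)) : IsIso f := by
  rw [Modules.Hom.isIso_iff_isIso_app]
  exact fun U ↦ (ConcreteCategory.isIso_iff_bijective _).mpr (h U)

/-- The section `g` freely generates the sheaf of modules `M` on `U`. -/
def IsGenerator (M : X.Modules) (U : X.Opens) (g : Γ(M, U)) : Prop :=
  ∀ (V : X.Opens) (i : V ⟶ U), Function.Bijective fun a : Γ(X, V) ↦ a • M.presheaf.map i.op g

/-- The generator is the image of `1` under a local trivialization. -/
lemma IsLineBundle.exists_isGenerator {M : X.Modules} (hM : IsLineBundle M) (x : X) :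
    ∃ (U : X.Opens) (_ : x ∈ U) (g : Γ(M, U)), IsGenerator M U g := by
  obtain ⟨U, hxU, ⟨φ⟩⟩ := hM x
  let ψ : structureModule U.toScheme ≅ M.restrict U.ι :=
    φ.symm ≪≫ ((Modules.restrictFunctorIsoPullback U.ι).app M).symm
  have hψ : ∀ W, Function.Bijective (ψ.hom.app W) := fun W ↦ ConcreteCategory.bijective_of_isIso _
  -- The open is written as an image because sections of the restricted sheaf over `⊤` are by
  -- definition sections over this image.
  refine ⟨U.ι ''ᵁ ⊤, ⟨⟨x, hxU⟩, trivial, rfl⟩, ψ.hom.app ⊤ (1 : Γ(U.toScheme, ⊤)), fun V i ↦ ?_⟩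
  obtain ⟨W, rfl⟩ : ∃ W : U.toScheme.Opens, V = U.ι ''ᵁ W := by
    refine ⟨U.ι ⁻¹ᵁ V, ?_⟩
    rw [U.ι.image_preimage_eq_opensRange_inf]
    exact (inf_eq_right.mpr (i.le.trans (U.ι.image_top_eq_opensRange).le)).symm
  have h1 : Function.Bijective (U.ι.appIso W).hom := ConcreteCategory.bijective_of_isIso _
  have h2 : (fun a : Γ(X, U.ι ''ᵁ W) ↦ a • M.presheaf.map i.op
      (show Γ(M, U.ι ''ᵁ ⊤) from ψ.hom.app ⊤ (1 : Γ(U.toScheme, ⊤)))) =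
      fun a ↦ ψ.hom.app W ((U.ι.appIso W).hom a : Γ(U.toScheme, W)) := by
    funext a
    have h3 := ψ.hom.app_smul (U := W) ((U.ι.appIso W).hom a) (1 : Γ(U.toScheme, W))
    have h4 : ψ.hom.app W (1 : Γ(U.toScheme, W)) = M.presheaf.map i.op
        (show Γ(M, U.ι ''ᵁ ⊤) from ψ.hom.app ⊤ (1 : Γ(U.toScheme, ⊤))) := by
      have := congr($(ψ.hom.mapPresheaf.naturality (homOfLE (le_top : W ≤ ⊤)).op)
        (1 : Γ(U.toScheme, ⊤)))
      refine Eq.trans ?_ this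
      change _ = ψ.hom.app W (U.toScheme.presheaf.map (homOfLE (le_top : W ≤ ⊤)).op 1)
      rw [map_one]
    rw [h4] at h3
    have h5 : ((U.ι.appIso W).inv ((U.ι.appIso W).hom a)) = a := by simp; rfl
    conv_lhs => rw [← h5]
    refine (Eq.trans ?_ h3).symm
    exact congr(ψ.hom.app W $((mul_one (M := Γ(U.toScheme, W)) _).symm))
  rw [h2]
  exact (hψ W).comp h1

/-- Multiplication by the generator is a trivialization. -/
lemma IsLineBundle.of_isGenerator {M : X.Modules}
    (H : ∀ x, ∃ (U : X.Opens) (_ : x ∈ U) (g : Γ(M, U)), IsGenerator M U g) :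
    IsLineBundle M := by
  intro x
  obtain ⟨U, hxU, g, hg⟩ := H x
  refine ⟨U, hxU, ?_⟩
  have hle (W : U.toScheme.Opens) : U.ι ''ᵁ W ≤ U := by
    rintro _ ⟨y, -, rfl⟩; exact y.2
  let α (W : U.toScheme.Opens) : Γ(U.toScheme, W) →+ Γ(M, U.ι ''ᵁ W) :=
    { toFun := fun a ↦ (U.ι.appIso W).inv a • M.presheaf.map (homOfLE (hle W)).op g
      map_zero' := by rw [map_zero, zero_smul]
      map_add' := fun a b ↦ by rw [map_add, add_smul] }
  let φ : structureModule U.toScheme ⟶ M.restrict U.ι :=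
    ⟨PresheafOfModules.homMk
      { app := fun W ↦ AddCommGrpCat.ofHom (α W.unop)
        naturality := fun W W' i ↦ by
          ext a
          have h1 := M.map_smul (U.ι.opensFunctor.map i.unop) ((U.ι.appIso W.unop).inv a)
            (M.presheaf.map (homOfLE (hle W.unop)).op g)
          have h2 := congr($((U.ι).appIso_inv_naturality i) a)
          refine Eq.trans ?_ h1.symm
          change (U.ι.appIso W'.unop).inv (U.toScheme.presheaf.map i a) •
            M.presheaf.map (homOfLE (hle W'.unop)).op g = _
          refine congr_arg₂ (· • ·) h2 ?_
          rw [← CategoryTheory.comp_apply, ← Functor.map_comp]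
          rfl } (fun W r a ↦ by
            refine Eq.trans ?_ (mul_smul ((U.ι.appIso W.unop).inv r) ((U.ι.appIso W.unop).inv a)
              (M.presheaf.map (homOfLE (hle W.unop)).op g))
            exact congr_arg (· • M.presheaf.map (homOfLE (hle W.unop)).op g)
              (map_mul (U.ι.appIso W.unop).inv.hom r a))⟩
  have : IsIso φ := by
    refine Modules.isIso_of_bijective φ fun W ↦ ?_
    exact (hg _ (homOfLE (hle W))).comp (ConcreteCategory.bijective_of_isIso (U.ι.appIso W).inv)
  exact ⟨((Modules.restrictFunctorIsoPullback U.ι).app M).symm ≪≫ (asIso φ).symm⟩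

end Sections

/-! ### Sheaves of modules with values in `K` -/

section Valued

open AlgebraicGeometry.Scheme

variable {K : Type u} [Field K] {X : Scheme.{u}}

/-- A compatible family of semilinear maps to `K` from the sections of a presheaf of modules on
the neighbourhoods of the `K`-point `η`. -/
structure Valued (η : Spec (.of K) ⟶ X) (P : X.PresheafOfModules) where
  /-- the value of a section -/
  val (U : X.Opens) (h : ⊤ ≤ η ⁻¹ᵁ U) : P.obj (.op U) →+ K
  val_map {U V : X.Opens} (i : V ⟶ U) (hV : ⊤ ≤ η ⁻¹ᵁ V) (hU : ⊤ ≤ η ⁻¹ᵁ U)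
    (s : P.obj (.op U)) : val V hV (P.map i.op s) = val U hU s
  val_smul (U : X.Opens) (h : ⊤ ≤ η ⁻¹ᵁ U) (r : X.ringCatSheaf.obj.obj (.op U))
    (s : P.obj (.op U)) : val U h (r • s) = ev η U h r * val U h s

/-- The value of a section of a sheaf of modules. -/
def Valued.sec {η : Spec (.of K) ⟶ X} {M : X.Modules} (v : Valued η M.val) {U : X.Opens}
    (h : ⊤ ≤ η ⁻¹ᵁ U) : Γ(M, U) →+ K := v.val U h

lemma Valued.sec_map {η : Spec (.of K) ⟶ X} {M : X.Modules} (v : Valued η M.val) {U V : X.Opens}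
    (i : V ⟶ U) (hV : ⊤ ≤ η ⁻¹ᵁ V) (hU : ⊤ ≤ η ⁻¹ᵁ U) (s : Γ(M, U)) :
    v.sec hV (M.presheaf.map i.op s) = v.sec hU s := v.val_map i hV hU s

lemma Valued.sec_smul {η : Spec (.of K) ⟶ X} {M : X.Modules} (v : Valued η M.val) {U : X.Opens}
    (h : ⊤ ≤ η ⁻¹ᵁ U) (r : Γ(X, U)) (s : Γ(M, U)) :
    v.sec h (r • s) = ev η U h r * v.sec h s := v.val_smul U h r s

/-- Two families of values differ by a unit at every point. -/
def UnitEquiv (η : Spec (.of K) ⟶ X) (m m' : X → K) : Prop :=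
  ∀ x, m x ≠ 0 ∧ m' x ≠ 0 ∧ m x / m' x ∈ regularAt η x ∧ m' x / m x ∈ regularAt η x

/-- A family of nonzero values which locally is constant up to units. -/
def IsCartierDatum (η : Spec (.of K) ⟶ X) (m : X → K) : Prop :=
  ∀ x, ∃ (U : X.Opens) (_ : x ∈ U) (g : K), ∀ y ∈ U, g ≠ 0 ∧ m y ≠ 0 ∧
    g / m y ∈ regularAt η y ∧ m y / g ∈ regularAt η y

/-- The sections of `P` are, via their values, the `s` in `K` with `s / m x` regular at `x`. -/
structure Valued.Presents {η : Spec (.of K) ⟶ X} {P : X.PresheafOfModules} (v : Valued η P)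
    (m : X → K) : Prop where
  injective (U : X.Opens) (h : ⊤ ≤ η ⁻¹ᵁ U) : Function.Injective (v.val U h)
  exists_iff (U : X.Opens) (h : ⊤ ≤ η ⁻¹ᵁ U) (s : K) :
    (∃ t, v.val U h t = s) ↔ ∀ x ∈ U, s / m x ∈ regularAt η x

lemma Valued.Presents.congr {η : Spec (.of K) ⟶ X} {P : X.PresheafOfModules} {v : Valued η P}
    {m m' : X → K} (hv : v.Presents m) (h : UnitEquiv η m m') : v.Presents m' where
  injective := hv.injective
  exists_iff U hU s := by
    rw [hv.exists_iff]
    refine forall₂_congr fun x hx ↦ ?_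
    obtain ⟨h1, h2, h3, h4⟩ := h x
    constructor <;> intro h5
    · have := mul_mem h5 h3
      rwa [div_mul_div_cancel₀ h1] at this
    · have := mul_mem h5 h4
      rwa [div_mul_div_cancel₀ h2] at this

variable {η : Spec (.of K) ⟶ X}

/-- A morphism between valued modules is constructed from an inclusion of values. -/
lemma Valued.exists_hom [IsDominant η] {P : X.PresheafOfModules} (v : Valued η P) {N : X.Modules}
    (w : Valued η N.val) (hw : ∀ U h, Function.Injective (w.val U h))
    (H : ∀ U h s, ∃ t, w.val U h t = v.val U h s) :
    ∃ f : P ⟶ N.val, ∀ U h s, w.val U h (f.app (.op U) s) = v.val U h s := by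
  choose t ht using H
  classical
  -- An open that misses `η` is empty, so the sheaf `N` has only the zero section there and the
  -- default `0` is forced.
  let α (U : X.Opens) : P.obj (.op U) →+ N.val.obj (.op U) :=
    if h : ⊤ ≤ η ⁻¹ᵁ U then
      { toFun := t U h
        map_zero' := hw U h (by rw [ht, map_zero, map_zero])
        map_add' := fun a b ↦ hw U h (by rw [ht, map_add, map_add, ht, ht]) }
    else 0
  have hα (U h s) : w.val U h (α U s) = v.val U h s := by
    simp only [α, dif_pos h]
    exact ht U h s
  have hs (U : X.Opens) (h : ¬ ⊤ ≤ η ⁻¹ᵁ U) : Subsingleton (N.val.obj (.op U)) :=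
    Modules.subsingleton_of_isEmpty N fun x hx ↦ h (top_le_preimage_of_mem η hx)
  refine ⟨PresheafOfModules.homMk
      { app := fun U ↦ AddCommGrpCat.ofHom (α U.unop)
        naturality := fun U V i ↦ ?_ } (fun U r s ↦ ?_), fun U h s ↦ hα U h s⟩
  · ext s
    change α V.unop (P.map i s) = N.val.map i (α U.unop s)
    by_cases h : ⊤ ≤ η ⁻¹ᵁ V.unop
    · have hU : ⊤ ≤ η ⁻¹ᵁ U.unop := h.trans fun q hq ↦ i.unop.le hq
      apply hw _ h
      exact (hα _ h _).trans ((v.val_map i.unop h hU s).trans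
        ((hα _ hU s).symm.trans (w.val_map i.unop h hU _).symm))
    · exact (hs _ h).elim _ _
  · change α U.unop (r • s) = r • α U.unop s
    by_cases h : ⊤ ≤ η ⁻¹ᵁ U.unop
    · apply hw _ h
      rw [hα]
      exact (v.val_smul _ h r s).trans (((congr_arg _ (hα _ h s)).symm).trans
        (w.val_smul _ h r _).symm)
    · exact (hs _ h).elim _ _

/-- Both sheaves have the same image in the constant sheaf `K`, and a section is determined by its
value. -/
lemma Valued.Presents.nonempty_iso [IsDominant η] {M N : X.Modules} {v : Valued η M.val}
    {w : Valued η N.val} {m : X → K} (hv : v.Presents m) (hw : w.Presents m) :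
    Nonempty (M ≅ N) := by
  obtain ⟨f, hf⟩ := v.exists_hom w hw.injective fun U h s ↦
    (hw.exists_iff U h _).mpr ((hv.exists_iff U h _).mp ⟨s, rfl⟩)
  let φ : M ⟶ N := ⟨f⟩
  have : IsIso φ := by
    refine Modules.isIso_of_bijective φ fun U ↦ ?_
    by_cases h : ⊤ ≤ η ⁻¹ᵁ U
    · constructor
      · intro s t hst
        apply hv.injective U h
        exact (hf U h s).symm.trans ((congr_arg (w.val U h) hst).trans (hf U h t))
      · intro t
        obtain ⟨s, hs⟩ := (hv.exists_iff U h _).mpr ((hw.exists_iff U h _).mp ⟨t, rfl⟩)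
        exact ⟨s, hw.injective U h ((hf U h s).trans hs)⟩
    · have h1 := fun x hx ↦ h (top_le_preimage_of_mem η (U := U) (x := x) hx)
      have := Modules.subsingleton_of_isEmpty M h1
      have := Modules.subsingleton_of_isEmpty N h1
      exact ⟨fun _ _ _ ↦ Subsingleton.elim _ _, fun t ↦ ⟨0, Subsingleton.elim _ _⟩⟩
  exact ⟨asIso φ⟩

/-- Local generators determine which values a valued sheaf of modules takes. -/
lemma Valued.presents_of_isGenerator [IsDominant η] [IsReduced X] {M : X.Modules}
    (v : Valued η M.val) (m : X → K)
    (H : ∀ x, ∃ (U : X.Opens) (_ : x ∈ U) (h : ⊤ ≤ η ⁻¹ᵁ U) (g : Γ(M, U)), IsGenerator M U g ∧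
      v.sec h g ≠ 0 ∧ m x ≠ 0 ∧ v.sec h g / m x ∈ regularAt η x ∧
      m x / v.sec h g ∈ regularAt η x) :
    v.Presents m := by
  -- Near each point a section is `a • g` with `g` of nonzero value, so a zero value forces `a = 0`.
  have inj (U : X.Opens) (h : ⊤ ≤ η ⁻¹ᵁ U) : Function.Injective (v.sec (U := U) h) := by
    rw [injective_iff_map_eq_zero]
    intro s hs
    refine Modules.section_ext M fun x hx ↦ ?_
    obtain ⟨V, hxV, hV, g, hg, hg0, -⟩ := H x
    refine ⟨U ⊓ V, ⟨hx, hxV⟩, homOfLE inf_le_left, ?_⟩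
    have h3 : ⊤ ≤ η ⁻¹ᵁ (U ⊓ V) := top_le_preimage_of_mem η ⟨hx, hxV⟩
    obtain ⟨a, ha⟩ := (hg (U ⊓ V) (homOfLE inf_le_right)).surjective
      (M.presheaf.map (homOfLE inf_le_left).op s)
    dsimp only at ha
    have h4 := congr(v.sec h3 $ha)
    rw [v.sec_smul, v.sec_map _ h3 h, v.sec_map _ h3 hV, hs] at h4
    have h5 : a = 0 := ev_injective η h3 (by
      rw [map_zero]; exact (mul_eq_zero.mp h4).resolve_right hg0)
    rw [map_zero, ← ha, h5, zero_smul]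
  refine ⟨inj, fun U h s ↦ ⟨?_, fun hs ↦ ?_⟩⟩
  · intro hs x hx
    obtain ⟨t, rfl⟩ : ∃ t : Γ(M, U), v.sec h t = s := hs
    obtain ⟨V, hxV, hV, g, hg, hg0, hm0, h1, h2⟩ := H x
    have h3 : ⊤ ≤ η ⁻¹ᵁ (U ⊓ V) := top_le_preimage_of_mem η ⟨hx, hxV⟩
    obtain ⟨a, ha⟩ := (hg (U ⊓ V) (homOfLE inf_le_right)).surjective
      (M.presheaf.map (homOfLE inf_le_left).op t)
    dsimp only at ha
    have h4 := congr(v.sec h3 $ha)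
    rw [v.sec_smul, v.sec_map _ h3 h, v.sec_map _ h3 hV] at h4
    rw [← h4, mul_div_assoc]
    exact mul_mem (ev_mem_regularAt η h3 ⟨hx, hxV⟩ a) h1
  · have H' : ∀ x : U, ∃ (V : X.Opens) (_ : x.1 ∈ V) (_ : V ≤ U) (h : ⊤ ≤ η ⁻¹ᵁ V)
        (t : Γ(M, V)), v.sec h t = s := by
      rintro ⟨x, hx⟩
      obtain ⟨V, hxV, hV, g, hg, hg0, hm0, h1, h2⟩ := H x
      -- The product is `s` divided by the value of `g`; it is the value of a function `b`, and `b •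
      -- g` is then a local section with value `s`.
      obtain ⟨W, hxW, hW, b, hb⟩ := mul_mem (hs x hx) h2
      have h3 : ⊤ ≤ η ⁻¹ᵁ (U ⊓ V ⊓ W) := top_le_preimage_of_mem η ⟨⟨hx, hxV⟩, hxW⟩
      refine ⟨U ⊓ V ⊓ W, ⟨⟨hx, hxV⟩, hxW⟩, inf_le_left.trans inf_le_left, h3,
        X.presheaf.map (homOfLE (inf_le_right : U ⊓ V ⊓ W ≤ W)).op b •
          M.presheaf.map (homOfLE (inf_le_left.trans inf_le_right : U ⊓ V ⊓ W ≤ V)).op g, ?_⟩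
      rw [v.sec_smul, v.sec_map _ h3 hV, ev_map η _ h3 hW, hb, div_mul_div_cancel₀ hm0,
        div_mul_cancel₀ _ hg0]
    choose V hxV hVU hV t ht using H'
    obtain ⟨r, hr⟩ := Modules.exists_glue M V (fun x ↦ homOfLE (hVU x))
      (fun x hx ↦ TopologicalSpace.Opens.mem_iSup.mpr ⟨⟨x, hx⟩, hxV ⟨x, hx⟩⟩) t (by
        intro x y
        have h3 : ⊤ ≤ η ⁻¹ᵁ (V x ⊓ V y) := fun q hq ↦ ⟨hV x hq, hV y hq⟩
        apply inj _ h3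
        rw [v.sec_map _ h3 (hV x), v.sec_map _ h3 (hV y), ht, ht])
    obtain ⟨x, hx⟩ := exists_mem_of_top_le η h
    refine ⟨r, ?_⟩
    rw [← ht ⟨x, hx⟩, ← hr ⟨x, hx⟩]
    exact (v.sec_map _ (hV _) h r).symm

/-- Any section over a smaller open has value `t` with `t / g` regular there, because `g` and `m`
differ by units; this quotient is the coefficient. -/
lemma Valued.Presents.exists_isGenerator [IsDominant η] [IsReduced X] {M : X.Modules}
    {v : Valued η M.val} {m : X → K} (hv : v.Presents m) {U : X.Opens} (h : ⊤ ≤ η ⁻¹ᵁ U) {g : K}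
    (hg : ∀ y ∈ U, g ≠ 0 ∧ m y ≠ 0 ∧ g / m y ∈ regularAt η y ∧ m y / g ∈ regularAt η y) :
    ∃ s : Γ(M, U), v.sec h s = g ∧ IsGenerator M U s := by
  obtain ⟨x, hx⟩ := exists_mem_of_top_le η h
  have hg0 : g ≠ 0 := (hg x hx).1
  obtain ⟨s, hs⟩ := (hv.exists_iff U h g).mpr fun y hy ↦ (hg y hy).2.2.1
  refine ⟨s, hs, fun V i ↦ ?_⟩
  by_cases hV : ⊤ ≤ η ⁻¹ᵁ V
  · have key (a : Γ(X, V)) : v.sec hV (a • M.presheaf.map i.op (show Γ(M, U) from s)) =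
        ev η V hV a * g := by
      rw [v.sec_smul, v.sec_map _ hV h]
      exact congr_arg _ hs
    constructor
    · intro a b hab
      apply ev_injective η hV
      have := congr(v.sec hV $hab)
      dsimp only at this
      rw [key, key] at this
      exact mul_right_cancel₀ hg0 this
    · intro t
      obtain ⟨a, ha⟩ := exists_ev_eq η hV (v.sec hV t / g) fun y hy ↦ by
        obtain ⟨-, h1, -, h2⟩ := hg y (i.le hy)
        have := mul_mem ((hv.exists_iff V hV _).mp ⟨t, rfl⟩ y hy) h2
        rwa [div_mul_div_cancel₀ h1] at this
      refine ⟨a, hv.injective V hV ?_⟩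
      exact (key a).trans (by rw [ha, div_mul_cancel₀ _ hg0]; rfl)
  · have h1 := fun x hx ↦ hV (top_le_preimage_of_mem η (U := V) (x := x) hx)
    have := Modules.subsingleton_of_isEmpty M h1
    have : Subsingleton Γ(X, V) := by
      have := Modules.subsingleton_of_isEmpty (structureModule X) h1
      exact this
    exact ⟨fun _ _ _ ↦ Subsingleton.elim _ _, fun t ↦ ⟨0, Subsingleton.elim _ _⟩⟩

lemma Valued.Presents.isLineBundle [IsDominant η] [IsReduced X] {M : X.Modules}
    {v : Valued η M.val} {m : X → K} (hv : v.Presents m) (hm : IsCartierDatum η m) :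
    IsLineBundle M := by
  refine IsLineBundle.of_isGenerator fun x ↦ ?_
  obtain ⟨U, hxU, g, hg⟩ := hm x
  obtain ⟨s, -, hs⟩ := hv.exists_isGenerator (top_le_preimage_of_mem η hxU) hg
  exact ⟨U, hxU, s, hs⟩

end Valued

/-! ### Families of values for line bundles, restrictions and ideal sheaves -/

section Constructions

open AlgebraicGeometry.Scheme

variable {K : Type u} [Field K] {X : Scheme.{u}} {η : Spec (.of K) ⟶ X}

/-- A generator over some neighbourhood of the `K`-point turns sections into values. -/
lemma exists_valued_of_isGenerator [IsDominant η] [IsReduced X] {M : X.Modules} {U₀ : X.Opens}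
    {g₀ : Γ(M, U₀)} (hg₀ : IsGenerator M U₀ g₀) (h₀ : ⊤ ≤ η ⁻¹ᵁ U₀) :
    ∃ v : Valued η M.val, ∀ (U : X.Opens) (h : ⊤ ≤ η ⁻¹ᵁ U) (h' : ⊤ ≤ η ⁻¹ᵁ (U ⊓ U₀))
      (s : Γ(M, U)) (a : Γ(X, U ⊓ U₀)),
      a • M.presheaf.map (homOfLE (inf_le_right : U ⊓ U₀ ≤ U₀)).op g₀ =
        M.presheaf.map (homOfLE (inf_le_left : U ⊓ U₀ ≤ U)).op s → v.sec h s = ev η _ h' a := by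
  have hinf {U : X.Opens} (h : ⊤ ≤ η ⁻¹ᵁ U) : ⊤ ≤ η ⁻¹ᵁ (U ⊓ U₀) := fun q hq ↦ ⟨h hq, h₀ hq⟩
  -- The value of a section is its coefficient with respect to `g₀` on the overlap with `U₀`;
  -- uniqueness of the coefficient gives all the compatibilities.
  choose a ha using fun (U : X.Opens) (s : Γ(M, U)) ↦
    (hg₀ (U ⊓ U₀) (homOfLE inf_le_right)).surjective
      (M.presheaf.map (homOfLE (inf_le_left : U ⊓ U₀ ≤ U)).op s)
  have uniq (U : X.Opens) (s : Γ(M, U)) (b : Γ(X, U ⊓ U₀))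
      (hb : b • M.presheaf.map (homOfLE (inf_le_right : U ⊓ U₀ ≤ U₀)).op g₀ =
        M.presheaf.map (homOfLE (inf_le_left : U ⊓ U₀ ≤ U)).op s) : a U s = b :=
    (hg₀ (U ⊓ U₀) (homOfLE inf_le_right)).injective ((ha U s).trans hb.symm)
  have ha0 (U : X.Opens) : a U 0 = 0 := uniq U 0 0 (by simp)
  have haadd (U : X.Opens) (s t : Γ(M, U)) : a U (s + t) = a U s + a U t :=
    uniq U _ _ (by rw [add_smul, map_add, ← ha U s, ← ha U t])
  have hasmul (U : X.Opens) (r : Γ(X, U)) (s : Γ(M, U)) : a U (r • s) =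
      X.presheaf.map (homOfLE (inf_le_left : U ⊓ U₀ ≤ U)).op r * a U s :=
    uniq U _ _ (by rw [mul_smul, Modules.map_smul, ← ha U s])
  have hamap (U V : X.Opens) (i : V ⟶ U) (s : Γ(M, U)) : a V (M.presheaf.map i.op s) =
      X.presheaf.map (homOfLE (inf_le_inf_right U₀ i.le)).op (a U s) := by
    refine uniq V _ _ ?_
    have := congr(M.presheaf.map (homOfLE (inf_le_inf_right U₀ i.le)).op $(ha U s))
    dsimp only at this
    rw [Modules.map_smul, ← CategoryTheory.comp_apply, ← Functor.map_comp,
      ← CategoryTheory.comp_apply, ← Functor.map_comp] at this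
    refine this.trans ?_
    rw [← CategoryTheory.comp_apply, ← Functor.map_comp]
    rfl
  refine ⟨{ val U h := (ev η _ (hinf h)).toAddMonoidHom.comp
              (AddMonoidHom.mk' (fun s : Γ(M, U) ↦ a U s) (haadd U))
            val_map {U V} i hV hU s := ?_
            val_smul U h r s := ?_ }, fun U h h' s b hb ↦ ?_⟩
  · change ev η _ (hinf hV) (a V (M.presheaf.map i.op s)) = ev η _ (hinf hU) (a U s)
    exact (congr_arg _ (hamap U V i s)).trans (ev_map η _ _ (hinf hU) _)
  · change ev η _ (hinf h) (a U ((show Γ(X, U) from r) • (show Γ(M, U) from s))) = _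
    rw [hasmul, map_mul, ev_map η _ (hinf h) h]
    rfl
  · exact congr_arg (ev η _ h') (uniq U s b hb)

/-- A line bundle is presented by a Cartier datum. -/
lemma IsLineBundle.exists_presents [IsDominant η] [IsReduced X] {M : X.Modules}
    (hM : IsLineBundle M) :
    ∃ (v : Valued η M.val) (m : X → K), IsCartierDatum η m ∧ v.Presents m := by
  choose U hxU g hg using hM.exists_isGenerator
  have hU x : ⊤ ≤ η ⁻¹ᵁ (U x) := top_le_preimage_of_mem η (hxU x)
  obtain ⟨x₀, -⟩ := exists_mem_of_top_le η (U := ⊤) le_rfl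
  -- The generator around one arbitrary point serves as a rational trivialization for the whole
  -- bundle.
  obtain ⟨v, hv⟩ := exists_valued_of_isGenerator (hg x₀) (hU x₀)
  have h0 (x) : v.sec (hU x) (g x) ≠ 0 := by
    intro h
    have h3 : ⊤ ≤ η ⁻¹ᵁ (U x ⊓ U x₀) := fun q hq ↦ ⟨hU x hq, hU x₀ hq⟩
    obtain ⟨a, ha⟩ := (hg x₀ (U x ⊓ U x₀) (homOfLE inf_le_right)).surjective
      (M.presheaf.map (homOfLE (inf_le_left : U x ⊓ U x₀ ≤ U x)).op (g x))
    have h1 := hv (U x) (hU x) h3 (g x) a ha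
    rw [h, eq_comm] at h1
    have h2 : a = 0 := ev_injective η h3 (h1.trans (map_zero _).symm)
    dsimp only at ha
    rw [h2, zero_smul] at ha
    -- A zero value makes `g x` vanish on the overlap. As it freely generates there, `1 = 0` on an
    -- open containing `η`, which is absurd.
    have h4 : (1 : Γ(X, U x ⊓ U x₀)) = 0 := by
      apply (hg x (U x ⊓ U x₀) (homOfLE inf_le_left)).injective
      dsimp only
      rw [zero_smul, one_smul, ← ha]
    have := congr(ev η _ h3 $h4)
    rw [map_one, map_zero] at this
    exact one_ne_zero this
  let m : X → K := fun x ↦ v.sec (hU x) (g x)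
  have hm : v.Presents m := v.presents_of_isGenerator m fun x ↦
    ⟨U x, hxU x, hU x, g x, hg x, h0 x, h0 x, by
      simp only [m]; rw [div_self (h0 x)]; exact one_mem _, by
      simp only [m]; rw [div_self (h0 x)]; exact one_mem _⟩
  refine ⟨v, m, fun x ↦ ⟨U x, hxU x, m x, fun y hy ↦ ⟨h0 x, h0 y, ?_, ?_⟩⟩, hm⟩
  · exact (hm.exists_iff (U x) (hU x) _).mp ⟨g x, rfl⟩ y hy
  · have h3 : ⊤ ≤ η ⁻¹ᵁ (U y ⊓ U x) := top_le_preimage_of_mem η ⟨hxU y, hy⟩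
    obtain ⟨a, ha⟩ := (hg x (U y ⊓ U x) (homOfLE inf_le_right)).surjective
      (M.presheaf.map (homOfLE (inf_le_left : U y ⊓ U x ≤ U y)).op (g y))
    have := congr(v.sec h3 $ha)
    dsimp only at this
    rw [v.sec_smul, v.sec_map _ h3 (hU x), v.sec_map _ h3 (hU y)] at this
    change v.sec (hU y) (g y) / v.sec (hU x) (g x) ∈ _
    rw [← this, mul_div_assoc, div_self (h0 x), mul_one]
    exact ev_mem_regularAt η h3 ⟨hxU y, hy⟩ a

/-- The values of the restriction of a sheaf of modules along an open immersion. -/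
def Valued.restrict {Y : Scheme.{u}} (j : X ⟶ Y) [IsOpenImmersion j] {M : Y.Modules}
    (v : Valued (η ≫ j) M.val) : Valued η (M.restrict j).val :=
  have H {U : X.Opens} (h : ⊤ ≤ η ⁻¹ᵁ U) : ⊤ ≤ (η ≫ j) ⁻¹ᵁ (j ''ᵁ U) :=
    fun q hq ↦ ⟨η q, h hq, rfl⟩
  { val U h := v.val (j ''ᵁ U) (H h)
    val_map {U V} i hV hU s := v.val_map (j.opensFunctor.map i) (H hV) (H hU) s
    val_smul U h r s := by
      refine (v.val_smul (j ''ᵁ U) (H h) ((j.appIso U).inv r) s).trans ?_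
      congr 1
      have h1 : U ≤ j ⁻¹ᵁ (j ''ᵁ U) := (j.preimage_image_eq U).ge
      refine (ev_appLE η j h1 h (H h) _).symm.trans ?_
      congr 1
      have := j.appIso_inv_appLE (U := U) (V := U) h1
      refine (congr($this r)).trans ?_
      simp
      rfl }

lemma Valued.Presents.restrict {Y : Scheme.{u}} (j : X ⟶ Y) [IsOpenImmersion j] {M : Y.Modules}
    {v : Valued (η ≫ j) M.val} {m : Y → K} (hv : v.Presents m) :
    (v.restrict j).Presents (m ∘ j) where
  injective U h := hv.injective _ _
  exists_iff U h s := by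
    refine (hv.exists_iff (j ''ᵁ U) _ s).trans ⟨fun H x hx ↦ ?_, ?_⟩
    · rw [← regularAt_comp η j]
      exact H (j x) ⟨x, hx, rfl⟩
    · rintro H _ ⟨x, hx, rfl⟩
      exact (regularAt_comp η j x).symm ▸ H x hx

/-- The constant sheaf `K`, as the direct image of the structure sheaf of a `K`-point. -/
def constModule (η : Spec (.of K) ⟶ X) : X.Modules :=
  (Modules.pushforward η).obj (structureModule (Spec (.of K)))

/-- The tautological values of the sections of `constModule η`. -/
def constValued (η : Spec (.of K) ⟶ X) : Valued η (constModule η).val where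
  val U h := ((Spec (.of K)).presheaf.map (homOfLE h).op ≫
    (Scheme.ΓSpecIso (.of K)).hom).hom.toAddMonoidHom
  val_map {U V} i hV hU s := by
    refine congr_arg (Scheme.ΓSpecIso (.of K)).hom ?_
    refine (CategoryTheory.comp_apply
      ((Spec (.of K)).presheaf.map ((TopologicalSpace.Opens.map η.base).map i).op)
      ((Spec (.of K)).presheaf.map (homOfLE hV).op) s).symm.trans ?_
    rw [← Functor.map_comp]
    rfl
  val_smul U h r s := by
    change ((Spec (.of K)).presheaf.map (homOfLE h).op ≫ (Scheme.ΓSpecIso (.of K)).hom).hom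
      ((η.app U r) * (show Γ(Spec (.of K), η ⁻¹ᵁ U) from s)) = _
    rw [map_mul]
    rfl

lemma constValued_bijective (η : Spec (.of K) ⟶ X) {U : X.Opens} (h : ⊤ ≤ η ⁻¹ᵁ U) :
    Function.Bijective ((constValued η).val U h) := by
  have h2 : η ⁻¹ᵁ U = ⊤ := top_le_iff.mp h
  have : IsIso (homOfLE h) := ⟨homOfLE h2.le, rfl, rfl⟩
  exact ConcreteCategory.bijective_of_isIso
    ((Spec (.of K)).presheaf.map (homOfLE h).op ≫ (Scheme.ΓSpecIso (.of K)).hom)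

/-- The subpresheaf of modules of the constant sheaf `K` given by a family of values. -/
def fracSubmodule (η : Spec (.of K) ⟶ X) (m : X → K) : (constModule η).val.Submodule where
  obj U :=
    { carrier := {t | ∀ x ∈ U.unop, ∀ h, (constValued η).val U.unop h t / m x ∈ regularAt η x}
      zero_mem' := fun x hx h ↦ by rw [map_zero, zero_div]; exact zero_mem _
      add_mem' := fun hs ht x hx h ↦ by
        rw [map_add, add_div]; exact add_mem (hs x hx h) (ht x hx h)
      smul_mem' := fun r t ht x hx h ↦ by
        have := (constValued η).val_smul U.unop h r t
        have h2 := mul_mem (ev_mem_regularAt η h hx r) (ht x hx h)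
        rw [← mul_div_assoc] at h2
        exact this ▸ h2 }
  map {U V} i t ht x hx h := by
    have hU : ⊤ ≤ η ⁻¹ᵁ U.unop := h.trans fun q hq ↦ i.unop.le hq
    have := (constValued η).val_map i.unop h hU t
    have h2 := ht x (i.unop.le hx) hU
    exact this ▸ h2

/-- The condition that cuts out the submodule is tested point by point, so a section glued in the
constant sheaf inherits it. -/
lemma fracSubmodule_isSheaf (η : Spec (.of K) ⟶ X) [IsDominant η] (m : X → K) :
    TopCat.Presheaf.IsSheaf (X := X)
      (fracSubmodule η m).toPresheafOfModules.presheaf := by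
  rw [TopCat.Presheaf.isSheaf_iff_isSheafUniqueGluing]
  intro ι U sf hsf
  let F : TopCat.Sheaf Ab X := ⟨(constModule η).presheaf, (constModule η).isSheaf⟩
  let sf' (i : ι) : F.1.obj (.op (U i)) := (sf i).1
  obtain ⟨t, ht, ht'⟩ := F.existsUnique_gluing U sf' fun i j ↦ congr_arg Subtype.val (hsf i j)
  refine ⟨⟨t, fun x hx h ↦ ?_⟩, fun i ↦ Subtype.ext (ht i), fun s hs ↦ Subtype.ext
    (ht' s.1 fun i ↦ congr_arg Subtype.val (hs i))⟩
  obtain ⟨i, hi⟩ := TopologicalSpace.Opens.mem_iSup.mp hx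
  have hU := top_le_preimage_of_mem η hi
  have h1 := (sf i).2 x hi hU
  have h2 := (constValued η).val_map (TopologicalSpace.Opens.leSupr U i) hU h t
  have h3 := congr_arg ((constValued η).val (U i) hU) (ht i)
  exact (h2.symm.trans h3) ▸ h1

/-- A family of values presents a sheaf of modules. -/
lemma exists_presents (η : Spec (.of K) ⟶ X) [IsDominant η] (m : X → K) :
    ∃ (M : X.Modules) (v : Valued η M.val), v.Presents m := by
  refine ⟨⟨(fracSubmodule η m).toPresheafOfModules, fracSubmodule_isSheaf η m⟩,
    { val U h := ((constValued η).val U h).comp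
        ((fracSubmodule η m).obj (.op U)).subtype.toAddMonoidHom
      val_map i hV hU s := (constValued η).val_map i hV hU s.1
      val_smul U h r s := (constValued η).val_smul U h r s.1 }, fun U h ↦ ?_, fun U h s ↦ ?_⟩
  · exact (constValued_bijective η h).injective.comp Subtype.val_injective
  · constructor
    · rintro ⟨t, rfl⟩ x hx
      exact t.2 x hx h
    · intro H
      obtain ⟨t, rfl⟩ := (constValued_bijective η h).surjective s
      exact ⟨⟨t, fun x hx _ ↦ H x hx⟩, rfl⟩

/-- The family `c` consists of local equations of the ideal sheaf `I`. -/
def IsLocalEquation (η : Spec (.of K) ⟶ X) (I : X.IdealSheafData) (c : X → K) : Prop :=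
  ∀ x, ∃ (U : X.affineOpens) (_ : x ∈ U.1) (h : ⊤ ≤ η ⁻¹ᵁ U.1) (a : Γ(X, U.1)),
    I.ideal U = Ideal.span {a} ∧ ev η U.1 h a ≠ 0 ∧ c x ≠ 0 ∧
    ev η U.1 h a / c x ∈ regularAt η x ∧ c x / ev η U.1 h a ∈ regularAt η x

/-- The inclusion of an ideal sheaf in the structure sheaf. -/
def idealModuleι (I : X.IdealSheafData) : idealModule I ⟶ structureModule X :=
  kernel.ι (C := X.Modules) _

/-- Sections over an open, as a functor. -/
def sectionsFunctor (U : X.Opens) : X.Modules ⥤ Ab :=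
  Modules.toPresheaf X ⋙ (CategoryTheory.evaluation _ _).obj (.op U)

instance (U : X.Opens) : (sectionsFunctor U).Additive where

instance (U : X.Opens) : PreservesLimits (sectionsFunctor U) :=
  have : PreservesLimits ((CategoryTheory.evaluation (TopologicalSpace.Opens X)ᵒᵖ Ab.{u}).obj
      (.op U)) := ⟨evaluation_preservesLimitsOfShape _⟩
  comp_preservesLimits (Modules.toPresheaf X)
    ((CategoryTheory.evaluation (TopologicalSpace.Opens X)ᵒᵖ Ab.{u}).obj (.op U))

lemma idealModuleι_app_injective (I : X.IdealSheafData) (U : X.Opens) :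
    Function.Injective ((idealModuleι I).app U) := by
  have : Mono (idealModuleι I) := equalizer.ι_mono (C := X.Modules)
  have : Mono ((sectionsFunctor U).map (idealModuleι I)) := inferInstance
  exact (AddCommGrpCat.mono_iff_injective _).mp this

/-- Taking sections over an open is left exact, so it commutes with the kernel that defines the
ideal module. -/
lemma mem_range_idealModuleι_app_iff (I : X.IdealSheafData) (U : X.Opens) (f : Γ(X, U)) :
    (∃ s, (idealModuleι I).app U s = f) ↔ I.subschemeι.app U f = 0 := by
  let φ : structureModule X ⟶
      (Scheme.Modules.pushforward I.subschemeι).obj (structureModule I.subscheme) :=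
    SheafOfModules.unitToPushforwardObjUnit I.subschemeι.toRingCatSheafHom
  let S : ShortComplex X.Modules := ShortComplex.mk (kernel.ι φ) φ (kernel.condition φ)
  have hS : S.Exact := ShortComplex.exact_kernel φ
  have hS' := hS.map_of_mono_of_preservesKernel (sectionsFunctor U)
    (inferInstanceAs (Mono (kernel.ι φ))) inferInstance
  rw [ShortComplex.ab_exact_iff] at hS'
  constructor
  · rintro ⟨s, rfl⟩
    exact congr($((S.map (sectionsFunctor U)).zero) s)
  · exact fun h ↦ hS' (show Γ(structureModule X, U) from f) h

/-- The values of the sections of an ideal sheaf. -/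
def idealValued (η : Spec (.of K) ⟶ X) (I : X.IdealSheafData) : Valued η (idealModule I).val where
  val U h := (ev η U h).toAddMonoidHom.comp ((idealModuleι I).app U).hom
  val_map {U V} i hV hU s := by
    refine Eq.trans ?_ (ev_map η i hV hU ((idealModuleι I).app U s))
    exact congr_arg (ev η V hV) (congr($((idealModuleι I).mapPresheaf.naturality i.op) s))
  val_smul U h r s := by
    refine Eq.trans ?_ (map_mul (ev η U h) r ((idealModuleι I).app U s))
    exact congr_arg (ev η U h) ((idealModuleι I).app_smul (show Γ(X, U) from r) s)

/-- A generator of the ideal on an affine open remains a free generator of the ideal module over all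
smaller opens, affine or not. -/
lemma idealValued_presents [IsDominant η] [IsReduced X] (I : X.IdealSheafData) (c : X → K)
    (hc : IsLocalEquation η I c) : (idealValued η I).Presents c := by
  refine Valued.presents_of_isGenerator _ c fun x ↦ ?_
  obtain ⟨U, hxU, h, a, ha, ha0, hc0, h1, h2⟩ := hc x
  obtain ⟨s, hs⟩ := (mem_range_idealModuleι_app_iff I U.1 a).mpr (by
    have : a ∈ I.ideal U := ha ▸ Ideal.mem_span_singleton_self a
    rwa [← I.ker_subschemeι_app U] at this)
  have hsa : (idealValued η I).sec h s = ev η U.1 h a := congr_arg (ev η U.1 h) hs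
  refine ⟨U.1, hxU, h, s, fun V i ↦ ?_, by rwa [hsa], hc0, by rwa [hsa], by rwa [hsa]⟩
  by_cases hV : ⊤ ≤ η ⁻¹ᵁ V
  · have inj : Function.Injective ((idealValued η I).sec (U := V) hV) :=
      (ev_injective η hV).comp (idealModuleι_app_injective I V)
    have key (r : Γ(X, V)) : (idealValued η I).sec hV
        (r • (idealModule I).presheaf.map i.op s) = ev η V hV r * ev η U.1 h a := by
      rw [Valued.sec_smul, Valued.sec_map _ _ hV h, hsa]
    constructor
    · intro r r' hr
      apply ev_injective η hV
      have := congr((idealValued η I).sec hV $hr)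
      dsimp only at this
      rw [key, key] at this
      exact mul_right_cancel₀ ha0 this
    · intro t
      let f : Γ(X, V) := (idealModuleι I).app V t
      have hf : I.subschemeι.app V f = 0 := (mem_range_idealModuleι_app_iff I V f).mp ⟨t, rfl⟩
      -- The coefficient is found first as an element of `K`. Its regularity is checked on affine
      -- opens inside `V`, where the ideal is generated by the restriction of `a`.
      obtain ⟨r, hr⟩ := exists_ev_eq η hV (ev η V hV f / ev η U.1 h a) fun y hy ↦ by
        obtain ⟨_, ⟨W', hW', rfl⟩, hyW, hWV⟩ :=
          X.isBasis_affineOpens.exists_subset_of_mem_open hy V.isOpen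
        let W : X.affineOpens := ⟨W', hW'⟩
        have hW : ⊤ ≤ η ⁻¹ᵁ W.1 := top_le_preimage_of_mem η hyW
        have hWV' : W.1 ≤ V := hWV
        have h3 : X.presheaf.map (homOfLE hWV').op f ∈ I.ideal W := by
          rw [← I.ker_subschemeι_app W, RingHom.mem_ker]
          have h5 : I.subschemeι.app W.1 (X.presheaf.map (homOfLE hWV').op f) =
              I.subscheme.presheaf.map ((TopologicalSpace.Opens.map I.subschemeι.base).map
                (homOfLE hWV')).op (I.subschemeι.app V f) :=
            congr($(I.subschemeι.naturality (homOfLE hWV').op) f)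
          rwa [hf, map_zero] at h5
        rw [← I.map_ideal (U := W) (V := U) (hWV'.trans i.le), ha, Ideal.map_span,
          Set.image_singleton, Ideal.mem_span_singleton'] at h3
        obtain ⟨b, hb⟩ := h3
        have := congr(ev η W.1 hW $hb)
        rw [map_mul, ev_map η _ hW hV] at this
        erw [ev_map η _ hW h] at this
        rw [← this, mul_div_cancel_right₀ _ ha0]
        exact ev_mem_regularAt η hW hyW b
      refine ⟨r, inj ?_⟩
      dsimp only
      rw [key, hr, div_mul_cancel₀ _ ha0]
      rfl
  · have h1 := fun x hx ↦ hV (top_le_preimage_of_mem η (U := V) (x := x) hx)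
    have := Modules.subsingleton_of_isEmpty (idealModule I) h1
    have : Subsingleton Γ(X, V) := by
      have := Modules.subsingleton_of_isEmpty (structureModule X) h1
      exact this
    exact ⟨fun _ _ _ ↦ Subsingleton.elim _ _, fun t ↦ ⟨0, Subsingleton.elim _ _⟩⟩

end Constructions

/-! ### Tensor products through multiplication of values -/

section Tensor

open AlgebraicGeometry.Scheme

variable {K : Type u} [Field K] {X : Scheme.{u}} {η : Spec (.of K) ⟶ X}

/-- The presheaf tensor product of sheaves of modules. -/
abbrev presheafTensor (M N : X.Modules) : X.PresheafOfModules :=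
  PresheafOfModules.Monoidal.tensorObj (R := X.presheaf) M.val N.val

/-- A pure tensor of sections. -/
def tmulSection (M N : X.Modules) (U : X.Opens) (s : Γ(M, U)) (t : Γ(N, U)) :
    (presheafTensor M N).obj (.op U) :=
  TensorProduct.tmul Γ(X, U) (M := Γ(M, U)) (N := Γ(N, U)) s t

lemma presheafTensor_induction {M N : X.Modules} {U : X.Opens}
    {p : (presheafTensor M N).obj (.op U) → Prop} (z : (presheafTensor M N).obj (.op U))
    (h0 : p 0) (ht : ∀ s t, p (tmulSection M N U s t)) (ha : ∀ x y, p x → p y → p (x + y)) :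
    p z := by
  let q : TensorProduct Γ(X, U) Γ(M, U) Γ(N, U) → Prop := p
  exact TensorProduct.induction_on (motive := q) z h0 ht ha

lemma map_tmulSection (M N : X.Modules) {U V : X.Opens} (i : V ⟶ U) (s : Γ(M, U)) (t : Γ(N, U)) :
    (presheafTensor M N).map i.op (tmulSection M N U s t) =
      tmulSection M N V (M.presheaf.map i.op s) (N.presheaf.map i.op t) :=
  PresheafOfModules.Monoidal.tensorObj_map_tmul (R := X.presheaf) i.op s t

lemma tmulSection_smul_smul (M N : X.Modules) (U : X.Opens) (a b : Γ(X, U)) (s : Γ(M, U))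
    (t : Γ(N, U)) : tmulSection M N U (a • s) (b • t) =
      (show X.ringCatSheaf.obj.obj (.op U) from a * b) • tmulSection M N U s t :=
  TensorProduct.smul_tmul_smul (R := Γ(X, U)) (M := Γ(M, U))
    (N := Γ(N, U)) a b s t

/-- The product of values on a tensor product. -/
def Valued.tensorVal {M N : X.Modules} (v : Valued η M.val) (w : Valued η N.val) (U : X.Opens)
    (h : ⊤ ≤ η ⁻¹ᵁ U) : (presheafTensor M N).obj (.op U) →+ K :=
  TensorProduct.liftAddHom (R := Γ(X, U)) (M := Γ(M, U))
    (N := Γ(N, U)) ((AddMonoidHom.mul.comp (v.sec h)).compl₂ (w.sec h))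
    (fun r s t ↦ by
      change v.sec h (r • s) * w.sec h t = v.sec h s * w.sec h (r • t)
      rw [v.sec_smul, w.sec_smul]
      ring)

/-- The values of the sections of the presheaf tensor product. -/
def Valued.tensor {M N : X.Modules} (v : Valued η M.val) (w : Valued η N.val) :
    Valued η (presheafTensor M N) where
  val U h := v.tensorVal w U h
  val_map {U V} i hV hU z := by
    induction z using presheafTensor_induction with
    | h0 => rw [map_zero, map_zero]; exact map_zero _
    | ha x y hx hy => rw [map_add, map_add, ← hx, ← hy]; exact map_add _ _ _
    | ht s t =>
      rw [map_tmulSection]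
      exact (congr_arg₂ (· * ·) (v.sec_map i hV hU s) (w.sec_map i hV hU t))
  val_smul U h r z := by
    induction z using presheafTensor_induction with
    | h0 => rw [smul_zero, map_zero, mul_zero]
    | ha x y hx hy => rw [smul_add, map_add, map_add, hx, hy, mul_add]
    | ht s t =>
      have h1 := tmulSection_smul_smul M N U r 1 s t
      rw [one_smul] at h1
      have h2 : (show Γ(X, U) from r) * 1 = r := mul_one _
      refine (congr_arg (v.tensorVal w U h) (Eq.trans h1 (by rw [h2])).symm).trans ?_
      exact (congr_arg (· * w.sec h t) (v.sec_smul h r s)).trans (mul_assoc _ _ _)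

/-- Locally, each section of the tensor product is a multiple of the tensor of the generators. -/
lemma exists_eq_smul_tmulSection {M N : X.Modules} {U : X.Opens} {s : Γ(M, U)} {t : Γ(N, U)}
    (hs : IsGenerator M U s) (ht : IsGenerator N U t) {V : X.Opens} (i : V ⟶ U)
    (z : (presheafTensor M N).obj (.op V)) :
    ∃ a : Γ(X, V), z = (show X.ringCatSheaf.obj.obj (.op V) from a) •
      tmulSection M N V (M.presheaf.map i.op s) (N.presheaf.map i.op t) := by
  induction z using presheafTensor_induction with
  | h0 => exact ⟨0, (zero_smul (X.ringCatSheaf.obj.obj (.op V)) _).symm⟩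
  | ha x y hx hy =>
    obtain ⟨a, rfl⟩ := hx
    obtain ⟨b, rfl⟩ := hy
    exact ⟨a + b, (add_smul _ _ _).symm⟩
  | ht s' t' =>
    obtain ⟨a, rfl⟩ := (hs V i).surjective s'
    obtain ⟨b, rfl⟩ := (ht V i).surjective t'
    exact ⟨a * b, tmulSection_smul_smul M N V a b _ _⟩

/-- A locally bijective morphism from a presheaf of modules to a sheaf of modules identifies the
target with the associated sheaf. -/
lemma nonempty_sheafification_iso {P : X.PresheafOfModules} {N : X.Modules} (f : P ⟶ N.val)
    (hinj : ∀ (U : X.Opens) (p q : P.obj (.op U)), f.app (.op U) p = f.app (.op U) q → ∀ x ∈ U,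
      ∃ (V : X.Opens) (i : V ⟶ U), P.map i.op p = P.map i.op q ∧ x ∈ V)
    (hsurj : ∀ (U : X.Opens) (t : N.val.obj (.op U)), ∀ x ∈ U,
      ∃ (V : X.Opens) (i : V ⟶ U), (∃ p, f.app (.op V) p = N.val.map i.op t) ∧ x ∈ V) :
    Nonempty ((PresheafOfModules.sheafification (𝟙 X.ringCatSheaf.obj)).obj P ≅ N) := by
  let F : P.presheaf ⟶ N.presheaf := (PresheafOfModules.toPresheaf _).map f
  have h1 : Presheaf.IsLocallyInjective (Opens.grothendieckTopology X) F :=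
    ⟨fun {U} p q h x hx ↦ by
      obtain ⟨V, i, h2, hV⟩ := hinj U.unop p q h x hx
      exact ⟨V, i, h2, hV⟩⟩
  have h2 : Presheaf.IsLocallySurjective (Opens.grothendieckTopology X) F :=
    ⟨fun {U} t x hx ↦ by
      obtain ⟨V, i, h2, hV⟩ := hsurj U t x hx
      exact ⟨V, i, h2, hV⟩⟩
  have h3 := (Opens.grothendieckTopology X).W_of_isLocallyBijective F
  rw [GrothendieckTopology.W_iff] at h3
  let g : P ⟶ (PresheafOfModules.restrictScalars (𝟙 X.ringCatSheaf.obj)).obj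
      ((SheafOfModules.forget _).obj N) :=
    PresheafOfModules.homMk F fun U r m ↦ (f.app U).hom.map_smul r m
  let φ := (PresheafOfModules.sheafificationHomEquiv (𝟙 X.ringCatSheaf.obj)).symm g
  have h4 := PresheafOfModules.toSheaf_map_sheafificationHomEquiv_symm
    (𝟙 X.ringCatSheaf.obj) g
  have h5 : IsIso ((SheafOfModules.toSheaf _).map φ) := by
    -- The underlying map of `φ` is the sheafification of `F` followed by the counit at a sheaf, and
    -- both are isomorphisms.
    have h6 := (sheafificationAdjunction (Opens.grothendieckTopology X)
      AddCommGrpCat.{u}).homEquiv_counit (X := P.presheaf)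
      (Y := (SheafOfModules.toSheaf X.ringCatSheaf).obj N) (g := F)
    have h7 := h4.trans h6
    have h8 : IsIso ((presheafToSheaf (Opens.grothendieckTopology X) AddCommGrpCat).map F) := h3
    have h9 : IsIso ((sheafificationAdjunction (Opens.grothendieckTopology X)
      AddCommGrpCat.{u}).counit.app ((SheafOfModules.toSheaf X.ringCatSheaf).obj N)) :=
      inferInstance
    exact h7 ▸ IsIso.comp_isIso' h8 h9
  have : IsIso φ := isIso_of_reflects_iso φ (SheafOfModules.toSheaf _)
  exact ⟨asIso φ⟩

/-- The tensor product of sheaves of modules presented by Cartier data. -/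
lemma Valued.Presents.nonempty_tensor_iso [IsDominant η] [IsReduced X] {L M N : X.Modules}
    {u : Valued η L.val} {v : Valued η M.val} {w : Valued η N.val} {l m n : X → K}
    (hu : u.Presents l) (hv : v.Presents m) (hw : w.Presents n) (hl : IsCartierDatum η l)
    (hm : IsCartierDatum η m) (hlm : UnitEquiv η (l * m) n) :
    Nonempty (BlowUpExt.tensor L M ≅ N) := by
  have hw' := hw.congr (m' := l * m) fun x ↦
    ⟨(hlm x).2.1, (hlm x).1, (hlm x).2.2.2, (hlm x).2.2.1⟩
  have hreg (U : X.Opens) (h : ⊤ ≤ η ⁻¹ᵁ U) (z) : ∀ x ∈ U,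
      (u.tensor v).val U h z / (l * m) x ∈ regularAt η x := by
    intro x hx
    induction z using presheafTensor_induction with
    | h0 => rw [map_zero, zero_div]; exact zero_mem _
    | ha x y hx hy => rw [map_add, add_div]; exact add_mem hx hy
    | ht s t =>
      have h1 := (hu.exists_iff U h _).mp ⟨s, rfl⟩ x hx
      have h2 := (hv.exists_iff U h _).mp ⟨t, rfl⟩ x hx
      have := mul_mem h1 h2
      rw [div_mul_div_comm] at this
      exact this
  obtain ⟨f, hf⟩ := (u.tensor v).exists_hom w hw.injective fun U h s ↦
    (hw'.exists_iff U h _).mpr (hreg U h s)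
  have hgen (x : X) : ∃ (U : X.Opens) (_ : x ∈ U) (h : ⊤ ≤ η ⁻¹ᵁ U) (s : Γ(L, U)) (t : Γ(M, U)),
      IsGenerator L U s ∧ IsGenerator M U t ∧ u.sec h s * v.sec h t ≠ 0 ∧
      (l * m) x / (u.sec h s * v.sec h t) ∈ regularAt η x := by
    obtain ⟨U₁, h1, a, ha⟩ := hl x
    obtain ⟨U₂, h2, b, hb⟩ := hm x
    have h : ⊤ ≤ η ⁻¹ᵁ (U₁ ⊓ U₂) := top_le_preimage_of_mem η ⟨h1, h2⟩
    obtain ⟨s, hs, hs'⟩ := hu.exists_isGenerator h fun y hy ↦ ha y hy.1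
    obtain ⟨t, ht, ht'⟩ := hv.exists_isGenerator h fun y hy ↦ hb y hy.2
    refine ⟨U₁ ⊓ U₂, ⟨h1, h2⟩, h, s, t, hs', ht', ?_, ?_⟩
    · rw [hs, ht]; exact mul_ne_zero (ha x h1).1 (hb x h2).1
    · rw [hs, ht, Pi.mul_apply, ← div_mul_div_comm]
      exact mul_mem (ha x h1).2.2.2 (hb x h2).2.2.2
  have key {U V : X.Opens} (i : V ⟶ U) (h : ⊤ ≤ η ⁻¹ᵁ U) (hV : ⊤ ≤ η ⁻¹ᵁ V) (s : Γ(L, U))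
      (t : Γ(M, U)) (a : Γ(X, V)) :
      (u.tensor v).val V hV ((show X.ringCatSheaf.obj.obj (.op V) from a) •
        tmulSection L M V (L.presheaf.map i.op s) (M.presheaf.map i.op t)) =
      ev η V hV a * (u.sec h s * v.sec h t) := by
    rw [Valued.val_smul]
    exact congr_arg _ (congr_arg₂ (· * ·) (u.sec_map i hV h s) (v.sec_map i hV h t))
  refine nonempty_sheafification_iso f (fun U p q hpq x hx ↦ ?_) (fun U z x hx ↦ ?_)
  · obtain ⟨V, hxV, hV, s, t, hs, ht, hst, -⟩ := hgen x
    have hU := top_le_preimage_of_mem η hx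
    have h3 : ⊤ ≤ η ⁻¹ᵁ (U ⊓ V) := top_le_preimage_of_mem η ⟨hx, hxV⟩
    refine ⟨U ⊓ V, homOfLE inf_le_left, ?_, ⟨hx, hxV⟩⟩
    -- Values are compared only after shrinking to an open where both factors have generators: there
    -- sections are multiples of one pure tensor with nonzero value.
    obtain ⟨a, ha⟩ := exists_eq_smul_tmulSection hs ht (homOfLE (inf_le_right : U ⊓ V ≤ V))
      ((presheafTensor L M).map (homOfLE inf_le_left).op p)
    obtain ⟨b, hb⟩ := exists_eq_smul_tmulSection hs ht (homOfLE (inf_le_right : U ⊓ V ≤ V))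
      ((presheafTensor L M).map (homOfLE inf_le_left).op q)
    have h4 : (u.tensor v).val U hU p = (u.tensor v).val U hU q := by
      rw [← hf, ← hf, hpq]
    have h5 := (u.tensor v).val_map (homOfLE (inf_le_left : U ⊓ V ≤ U)) h3 hU p
    have h6 := (u.tensor v).val_map (homOfLE (inf_le_left : U ⊓ V ≤ U)) h3 hU q
    have h7 := h5.trans (h4.trans h6.symm)
    have h8 := (congr_arg ((u.tensor v).val _ h3) ha).symm.trans
      (h7.trans (congr_arg ((u.tensor v).val _ h3) hb))
    rw [key _ hV, key _ hV] at h8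
    have h9 := ev_injective η h3 (mul_right_cancel₀ hst h8)
    exact ha.trans (h9 ▸ hb.symm)
  · obtain ⟨V, hxV, hV, s, t, hs, ht, hst, hreg'⟩ := hgen x
    have hU := top_le_preimage_of_mem η hx
    have h1 := mul_mem ((hw'.exists_iff U hU _).mp ⟨z, rfl⟩ x hx) hreg'
    have h0 : (l * m) x ≠ 0 := (hlm x).1
    rw [div_mul_div_cancel₀ h0] at h1
    obtain ⟨W, hxW, hW, a, ha⟩ := h1
    have h3 : ⊤ ≤ η ⁻¹ᵁ (U ⊓ V ⊓ W) := top_le_preimage_of_mem η ⟨⟨hx, hxV⟩, hxW⟩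
    let r : X.ringCatSheaf.obj.obj (.op (U ⊓ V ⊓ W)) :=
      (X.presheaf.map (homOfLE (inf_le_right : U ⊓ V ⊓ W ≤ W)).op a : Γ(X, U ⊓ V ⊓ W))
    let i : U ⊓ V ⊓ W ⟶ V := homOfLE (inf_le_left.trans inf_le_right)
    refine ⟨U ⊓ V ⊓ W, homOfLE (inf_le_left.trans inf_le_left), ⟨r •
      tmulSection L M _ (L.presheaf.map i.op s) (M.presheaf.map i.op t), ?_⟩, ⟨⟨hx, hxV⟩, hxW⟩⟩
    apply hw.injective _ h3
    refine (hf _ h3 _).trans (Eq.trans ?_ (w.val_map _ h3 hU z).symm)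
    refine (key i hV h3 s t _).trans ?_
    rw [ev_map η _ h3 hW, ha, div_mul_cancel₀ _ hst]

end Tensor

/-! ### Inverse images of ideal sheaves on affine opens -/

section Comap

variable {X Y : Scheme.{u}}

lemma isIso_appLE_top (j : X ⟶ Y) [IsOpenImmersion j] {V : Y.Opens} (h : V ≤ j.opensRange)
    (e : ⊤ ≤ j ⁻¹ᵁ V) : IsIso (j.appLE V ⊤ e) := by
  have := j.isIso_app V h
  have h2 : j ⁻¹ᵁ V = ⊤ := top_le_iff.mp e
  have : j.appLE V ⊤ e = j.app V ≫ X.presheaf.map (eqToHom h2.symm).op := by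
    simp [Scheme.Hom.app_eq_appLE]
  rw [this]
  infer_instance

lemma comap_ideal_of_isOpenImmersion (I : Y.IdealSheafData) (j : X ⟶ Y) [IsOpenImmersion j]
    (U : Y.affineOpens) (V : X.affineOpens) (e : V.1 ≤ j ⁻¹ᵁ U.1) :
    (I.comap j).ideal V = (I.ideal U).map (j.appLE U.1 V.1 e).hom := by
  let W : Y.affineOpens := ⟨j ''ᵁ V.1, V.2.image_of_isOpenImmersion j⟩
  have hW : W ≤ U := by
    rintro _ ⟨y, hy, rfl⟩
    exact e hy
  have h1 : j.appLE U.1 V.1 e = Y.presheaf.map (homOfLE hW).op ≫ (j.appIso V.1).hom := by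
    rw [Scheme.Hom.appIso_hom', Scheme.Hom.map_appLE]
  rw [Scheme.IdealSheafData.ideal_comap_of_isOpenImmersion, h1, CommRingCat.hom_comp,
    ← Ideal.map_map, I.map_ideal hW]
  exact (Ideal.map_comap_of_equiv (j.appIso V.1).commRingCatIsoToRingEquiv).symm

/-- Inverse image is left adjoint to direct image, so it is contained in the ideal sheaf of the
extended ideal; the unit of the adjunction gives the other inclusion. -/
lemma comap_ideal_of_isAffine [IsAffine X] [IsAffine Y] (I : Y.IdealSheafData) (f : X ⟶ Y) :
    (I.comap f).ideal ⟨⊤, isAffineOpen_top X⟩ =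
      (I.ideal ⟨⊤, isAffineOpen_top Y⟩).map f.appTop.hom := by
  apply le_antisymm
  · let J : X.IdealSheafData := Scheme.IdealSheafData.equivOfIsAffine.symm
      ((I.ideal ⟨⊤, isAffineOpen_top Y⟩).map f.appTop.hom)
    have hJ : J.ideal ⟨⊤, isAffineOpen_top X⟩ =
        (I.ideal ⟨⊤, isAffineOpen_top Y⟩).map f.appTop.hom := by
      rw [← Scheme.IdealSheafData.equivOfIsAffine_apply]
      exact Scheme.IdealSheafData.equivOfIsAffine.apply_symm_apply _
    rw [← hJ]
    refine Scheme.IdealSheafData.le_map_iff_comap_le.mp ?_ _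
    refine Scheme.IdealSheafData.le_of_isAffine ?_
    rw [Scheme.IdealSheafData.ideal_map_of_isAffineHom]
    refine Ideal.le_comap_of_map_le ?_
    exact hJ.ge
  · rw [Ideal.map_le_iff_le_comap]
    have := Scheme.IdealSheafData.le_map_comap I f ⟨⊤, isAffineOpen_top Y⟩
    rwa [Scheme.IdealSheafData.ideal_map_of_isAffineHom] at this

/-- The morphism restricts to one between the two affine opens, which reduces the claim to affine
schemes and open immersions. -/
lemma comap_ideal (I : Y.IdealSheafData) (f : X ⟶ Y) (U : Y.affineOpens) (V : X.affineOpens)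
    (e : V.1 ≤ f ⁻¹ᵁ U.1) :
    (I.comap f).ideal V = (I.ideal U).map (f.appLE U.1 V.1 e).hom := by
  have : IsAffine V.1 := V.2
  have : IsAffine U.1 := U.2
  have hV : (⊤ : V.1.toScheme.Opens) ≤ V.1.ι ⁻¹ᵁ V.1 := by simp
  have hU : (⊤ : U.1.toScheme.Opens) ≤ U.1.ι ⁻¹ᵁ U.1 := by simp
  have h1 := isIso_appLE_top V.1.ι (V := V.1) (by simp) hV
  let g := f.resLE U.1 V.1 e
  have hg : g ≫ U.1.ι = V.1.ι ≫ f := by simp [g]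
  have h2 := comap_ideal_of_isOpenImmersion (I.comap f) V.1.ι V ⟨⊤, isAffineOpen_top _⟩ hV
  have h3 := comap_ideal_of_isOpenImmersion I U.1.ι U ⟨⊤, isAffineOpen_top _⟩ hU
  rw [← Scheme.IdealSheafData.comap_comp, ← hg, Scheme.IdealSheafData.comap_comp,
    comap_ideal_of_isAffine, h3, Ideal.map_map, ← CommRingCat.hom_comp] at h2
  have h4 : U.1.ι.appLE U.1 ⊤ hU ≫ g.appTop = f.appLE U.1 V.1 e ≫ V.1.ι.appLE V.1 ⊤ hV := by
    have h5 : g.appTop = g.appLE ⊤ ⊤ le_rfl := (Scheme.Hom.appLE_eq_app g).symm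
    rw [Scheme.Hom.appLE_comp_appLE, h5]
    refine (Scheme.Hom.appLE_comp_appLE g U.1.ι U.1 ⊤ ⊤ hU le_rfl).trans ?_
    simp only [hg]
  rw [h4, CommRingCat.hom_comp, ← Ideal.map_map] at h2
  have h5 := congr(Ideal.comap (V.1.ι.appLE V.1 ⊤ hV).hom $h2)
  have h6 : Function.Bijective (V.1.ι.appLE V.1 ⊤ hV).hom := ConcreteCategory.bijective_of_isIso _
  rw [Ideal.comap_map_of_bijective _ h6, Ideal.comap_map_of_bijective _ h6] at h5
  exact h5.symm

/-- An affine open of `X` is the preimage of its own image, where the direct image ideal has the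
same sections. Thus the extended ideals `C.map` and `E.map` restrict to the original ones. -/
lemma comap_map_of_isOpenImmersion (I : X.IdealSheafData) (j : X ⟶ Y) [IsOpenImmersion j]
    [QuasiCompact j] : (I.map j).comap j = I := by
  refine le_antisymm (Scheme.IdealSheafData.comap_map_le _ _) fun V a ha ↦ ?_
  let W : Y.affineOpens := ⟨j ''ᵁ V.1, V.2.image_of_isOpenImmersion j⟩
  have hW : j ⁻¹ᵁ W.1 = V.1 := j.preimage_image_eq V.1
  rw [Scheme.IdealSheafData.ideal_comap_of_isOpenImmersion, Ideal.mem_comap,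
    Scheme.IdealSheafData.ideal_map I j W (hW ▸ V.2), Ideal.mem_comap]
  have h1 : (j.app W.1).hom ((j.appIso V.1).inv.hom a) = X.presheaf.map (eqToHom hW).op a := by
    rw [← CommRingCat.comp_apply, Scheme.Hom.appIso_inv_app]
  rw [h1, ← I.map_ideal (U := ⟨j ⁻¹ᵁ W.1, hW ▸ V.2⟩) (V := V) hW.le]
  exact Ideal.mem_map_of_mem _ ha

end Comap

/-! ### Effective Cartier divisors and their local equations in `K` -/

section Equations

variable {K : Type u} [Field K] {X Y : Scheme.{u}}

/-- `a` and `b` are nonzero and differ by a unit at `x`. -/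
def UnitAt (η : Spec (.of K) ⟶ X) (x : X) (a b : K) : Prop :=
  a ≠ 0 ∧ b ≠ 0 ∧ a / b ∈ regularAt η x ∧ b / a ∈ regularAt η x

variable {η : Spec (.of K) ⟶ X} {x : X} {a b c d : K}

lemma UnitAt.refl (h : a ≠ 0) : UnitAt η x a a :=
  ⟨h, h, by rw [div_self h]; exact one_mem _, by rw [div_self h]; exact one_mem _⟩

lemma UnitAt.symm (h : UnitAt η x a b) : UnitAt η x b a := ⟨h.2.1, h.1, h.2.2.2, h.2.2.1⟩

lemma UnitAt.trans (h : UnitAt η x a b) (h' : UnitAt η x b c) : UnitAt η x a c := by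
  refine ⟨h.1, h'.2.1, ?_, ?_⟩
  · have := mul_mem h.2.2.1 h'.2.2.1
    rwa [div_mul_div_cancel₀ h.2.1] at this
  · have := mul_mem h'.2.2.2 h.2.2.2
    rwa [div_mul_div_cancel₀ h.2.1] at this

lemma UnitAt.mul (h : UnitAt η x a b) (h' : UnitAt η x c d) : UnitAt η x (a * c) (b * d) := by
  refine ⟨mul_ne_zero h.1 h'.1, mul_ne_zero h.2.1 h'.2.1, ?_, ?_⟩
  · rw [← div_mul_div_comm]; exact mul_mem h.2.2.1 h'.2.2.1
  · rw [← div_mul_div_comm]; exact mul_mem h.2.2.2 h'.2.2.2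

lemma UnitAt.div (h : UnitAt η x a b) (h' : UnitAt η x c d) : UnitAt η x (a / c) (b / d) := by
  refine ⟨div_ne_zero h.1 h'.1, div_ne_zero h.2.1 h'.2.1, ?_, ?_⟩
  · rw [div_div_div_comm, div_eq_mul_inv, inv_div]; exact mul_mem h.2.2.1 h'.2.2.2
  · rw [div_div_div_comm, div_eq_mul_inv, inv_div]; exact mul_mem h.2.2.2 h'.2.2.1

lemma UnitAt.div_mem_iff (h : UnitAt η x a b) (s : K) :
    s / a ∈ regularAt η x ↔ s / b ∈ regularAt η x := by
  constructor <;> intro h'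
  · have := mul_mem h' h.2.2.1
    rwa [div_mul_div_cancel₀ h.1] at this
  · have := mul_mem h' h.2.2.2
    rwa [div_mul_div_cancel₀ h.2.1] at this

/-- Two generators of the same principal ideal divide each other on a common affine neighbourhood,
so the equation does not depend on the chosen affine open. -/
lemma IsLocalEquation.unitAt [IsDominant η] [IsReduced X] {I : X.IdealSheafData} {c : X → K}
    (hc : IsLocalEquation η I c) (U : X.affineOpens) (hx : x ∈ U.1) (h : ⊤ ≤ η ⁻¹ᵁ U.1)
    (a : Γ(X, U.1)) (ha : I.ideal U = Ideal.span {a}) : UnitAt η x (ev η U.1 h a) (c x) := by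
  obtain ⟨V, hxV, hV, b, hb, hb0, hcx, h1, h2⟩ := hc x
  obtain ⟨_, ⟨W', hW', rfl⟩, hxW, hW⟩ := X.isBasis_affineOpens.exists_subset_of_mem_open
    (show x ∈ U.1 ⊓ V.1 from ⟨hx, hxV⟩) (U.1 ⊓ V.1).isOpen
  let W : X.affineOpens := ⟨W', hW'⟩
  have hWU : W.1 ≤ U.1 := fun y hy ↦ (hW hy).1
  have hWV : W.1 ≤ V.1 := fun y hy ↦ (hW hy).2
  have hη : ⊤ ≤ η ⁻¹ᵁ W.1 := top_le_preimage_of_mem η hxW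
  have h3 := (I.map_ideal (U := W) (V := U) hWU).trans (I.map_ideal (U := W) (V := V) hWV).symm
  rw [ha, hb, Ideal.map_span, Ideal.map_span, Set.image_singleton, Set.image_singleton] at h3
  have key : ∀ (s t : Γ(X, W.1)), Ideal.span {s} = Ideal.span {t} → ∃ r,
      ev η W.1 hη r * ev η W.1 hη t = ev η W.1 hη s := by
    intro s t hst
    have : s ∈ Ideal.span {t} := hst ▸ Ideal.mem_span_singleton_self s
    obtain ⟨r, hr⟩ := Ideal.mem_span_singleton'.mp this
    exact ⟨r, by rw [← map_mul, hr]⟩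
  obtain ⟨r, hr⟩ := key _ _ h3
  obtain ⟨r', hr'⟩ := key _ _ h3.symm
  erw [ev_map η _ hη h, ev_map η _ hη hV] at hr hr'
  have ha0 : ev η U.1 h a ≠ 0 := fun h0 ↦ hb0 (by rw [← hr', h0, mul_zero])
  refine UnitAt.trans ⟨ha0, hb0, ?_, ?_⟩ ⟨hb0, hcx, h1, h2⟩
  · rw [← hr, mul_div_cancel_right₀ _ hb0]; exact ev_mem_regularAt η hη hxW r
  · rw [← hr', mul_div_cancel_right₀ _ ha0]; exact ev_mem_regularAt η hη hxW r'

lemma IsLocalEquation.unitEquiv [IsDominant η] [IsReduced X] {I : X.IdealSheafData} {c c' : X → K}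
    (hc : IsLocalEquation η I c) (hc' : IsLocalEquation η I c') : UnitEquiv η c c' := by
  intro x
  obtain ⟨U, hx, h, a, ha, -⟩ := hc x
  exact (hc.unitAt U hx h a ha).symm.trans (hc'.unitAt U hx h a ha)

lemma IsLocalEquation.isCartierDatum [IsDominant η] [IsReduced X] {I : X.IdealSheafData}
    {c : X → K} (hc : IsLocalEquation η I c) : IsCartierDatum η c := by
  intro x
  obtain ⟨U, hx, h, a, ha, -⟩ := hc x
  exact ⟨U.1, hx, ev η U.1 h a, fun y hy ↦ hc.unitAt U hy h a ha⟩

lemma IsLocalEquation.isEffectiveCartier [IsDominant η] [IsReduced X] {I : X.IdealSheafData}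
    {c : X → K} (hc : IsLocalEquation η I c) : IsEffectiveCartier I := by
  intro x
  obtain ⟨U, hx, h, a, ha, ha0, -⟩ := hc x
  refine ⟨U, hx, a, mem_nonZeroDivisors_iff_right.mpr fun z hz ↦ ev_injective η h ?_, ha⟩
  have := congr(ev η U.1 h $hz)
  rw [map_mul, map_zero] at this
  rw [map_zero]
  exact (mul_eq_zero.mp this).resolve_right ha0

lemma exists_isLocalEquation [IsDominant η] [IsIntegral X] {I : X.IdealSheafData}
    (hI : IsEffectiveCartier I) : ∃ c, IsLocalEquation η I c := by
  choose U hx f hf hI using hI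
  have h x : ⊤ ≤ η ⁻¹ᵁ (U x).1 := top_le_preimage_of_mem η (hx x)
  refine ⟨fun x ↦ ev η (U x).1 (h x) (f x), fun x ↦ ⟨U x, hx x, h x, f x, hI x, ?_⟩⟩
  have : Nontrivial Γ(X, (U x).1) := (ev η _ (h x)).domain_nontrivial
  have h0 : ev η (U x).1 (h x) (f x) ≠ 0 := fun h0 ↦
    nonZeroDivisors.ne_zero (hf x) (ev_injective η (h x) (by rw [h0, map_zero]))
  exact ⟨h0, (UnitAt.refl (η := η) (x := x) h0).2⟩

/-- An equation and its pullback have the same value in `K`, hence it stays nonzero. Cartier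
divisors therefore pull back along morphisms compatible with the dominant points. -/
lemma IsLocalEquation.comap [IsDominant η] (f : X ⟶ Y) [IsDominant (η ≫ f)]
    {I : Y.IdealSheafData} {c : Y → K} (hc : IsLocalEquation (η ≫ f) I c) :
    IsLocalEquation η (I.comap f) fun x ↦ c (f x) := by
  intro x
  obtain ⟨U, hx, h, a, ha, ha0, hc0, h1, h2⟩ := hc (f x)
  obtain ⟨_, ⟨V', hV', rfl⟩, hxV, hV⟩ := X.isBasis_affineOpens.exists_subset_of_mem_open
    (show x ∈ f ⁻¹ᵁ U.1 from hx) (f ⁻¹ᵁ U.1).isOpen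
  have hη : ⊤ ≤ η ⁻¹ᵁ V' := top_le_preimage_of_mem η hxV
  refine ⟨⟨V', hV'⟩, hxV, hη, f.appLE U.1 V' hV a, ?_⟩
  rw [comap_ideal I f U ⟨V', hV'⟩ hV, ha, Ideal.map_span, Set.image_singleton,
    ev_appLE η f hV hη h]
  exact ⟨rfl, ha0, hc0, regularAt_comp_le η f x h1, regularAt_comp_le η f x h2⟩

/-- The ideal sheaf of the sections whose quotient by the Cartier datum `c` is regular. -/
lemma exists_isLocalEquation_of_isCartierDatum [IsDominant η] [IsReduced X] {c : X → K}
    (hc : IsCartierDatum η c) (hreg : ∀ x, c x ∈ regularAt η x) :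
    ∃ I : X.IdealSheafData, IsLocalEquation η I c := by
  let J (U : X.affineOpens) : Ideal Γ(X, U.1) :=
    { carrier := {a | ∀ x (hx : x ∈ U.1),
        ev η U.1 (top_le_preimage_of_mem η hx) a / c x ∈ regularAt η x}
      zero_mem' := fun x hx ↦ by rw [map_zero, zero_div]; exact zero_mem _
      add_mem' := fun ha hb x hx ↦ by
        rw [map_add, add_div]; exact add_mem (ha x hx) (hb x hx)
      smul_mem' := fun r a ha x hx ↦ by
        rw [smul_eq_mul, map_mul, mul_div_assoc]
        exact mul_mem (ev_mem_regularAt η _ hx r) (ha x hx) }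
  have hJ (U : X.affineOpens) (h : ⊤ ≤ η ⁻¹ᵁ U.1) (a : Γ(X, U.1)) :
      a ∈ J U ↔ ∀ x ∈ U.1, ev η U.1 h a / c x ∈ regularAt η x := Iff.rfl
  let I : X.IdealSheafData :=
    { ideal := J
      map_ideal_basicOpen := by
        intro U f
        by_cases hη : ⊤ ≤ η ⁻¹ᵁ X.basicOpen f
        swap
        · have h1 := fun x hx ↦ hη (top_le_preimage_of_mem η (U := X.basicOpen f) (x := x) hx)
          have : Subsingleton Γ(X, X.basicOpen f) :=
            Modules.subsingleton_of_isEmpty (structureModule X) h1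
          have : Subsingleton (Ideal Γ(X, X.basicOpen f)) := inferInstance
          exact this.elim _ _
        have hU : ⊤ ≤ η ⁻¹ᵁ U.1 := fun q hq ↦ X.basicOpen_le f (hη hq)
        apply le_antisymm
        · refine Ideal.map_le_iff_le_comap.mpr fun a ha ↦ ?_
          refine (hJ (X.affineBasicOpen f) hη _).mpr fun x hx ↦ ?_
          have := (hJ U hU a).mp ha x (X.basicOpen_le f hx)
          erw [ev_map η _ hη hU]
          exact this
        · intro t ht
          replace ht := (hJ (X.affineBasicOpen f) hη t).mp ht
          -- Quasi-compactness of the affine open yields one exponent for all points; a larger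
          -- exponent does no harm because `f` is regular on `U`.
          have H : ∃ (n : ℕ), ∀ y ∈ U.1, ev η U.1 hU f ^ n * ev η _ hη t / c y ∈ regularAt η y := by
            refine U.2.isCompact.induction_on (p := fun s ↦ ∃ n : ℕ, ∀ y ∈ s, y ∈ U.1 →
              ev η U.1 hU f ^ n * ev η _ hη t / c y ∈ regularAt η y) ?_ ?_ ?_ ?_ |>.imp
              fun n hn y hy ↦ hn y hy hy
            · exact ⟨0, fun y hy ↦ hy.elim⟩
            · exact fun s s' hs ⟨n, hn⟩ ↦ ⟨n, fun y hy ↦ hn y (hs hy)⟩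
            · rintro s s' ⟨n, hn⟩ ⟨m, hm⟩
              refine ⟨n + m, fun y hy hyU ↦ ?_⟩
              have hf := ev_mem_regularAt η hU hyU f
              rcases hy with hy | hy
              · have := mul_mem (pow_mem hf m) (hn y hy hyU)
                convert this using 1; ring
              · have := mul_mem (pow_mem hf n) (hm y hy hyU)
                convert this using 1; ring
            · intro x hx
              obtain ⟨V, hxV, g, hg⟩ := hc x
              obtain ⟨_, ⟨W, hW, rfl⟩, hxW, hWV⟩ := X.isBasis_affineOpens.exists_subset_of_mem_open
                (show x ∈ U.1 ⊓ V from ⟨hx, hxV⟩) (U.1 ⊓ V).isOpen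
              have hWη : ⊤ ≤ η ⁻¹ᵁ W := top_le_preimage_of_mem η hxW
              have hWU : W ≤ U.1 := fun y hy ↦ (hWV hy).1
              let f' : Γ(X, W) := X.presheaf.map (homOfLE hWU).op f
              have hf' : ev η W hWη f' = ev η U.1 hU f := ev_map η _ _ _ _
              -- On `W` the datum may be replaced by the single element `g`, so the localization
              -- argument applies to one element of `K`.
              obtain ⟨n, a, ha⟩ := exists_pow_mul_ev η hW hWη f' (ev η _ hη t / g) fun y hy ↦ by
                have hyW : y ∈ W := X.basicOpen_le _ hy
                have hyf : y ∈ X.basicOpen f := by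
                  rw [mem_basicOpen_iff η hWη _ hyW] at hy
                  rw [mem_basicOpen_iff η hU _ (hWU hyW)]
                  rwa [hf'] at hy
                have h1 : UnitAt η y g (c y) := hg y (hWV hyW).2
                exact (h1.div_mem_iff _).mpr (ht y hyf)
              refine ⟨W, mem_nhdsWithin_of_mem_nhds (W.isOpen.mem_nhds hxW), n, fun y hy _ ↦ ?_⟩
              have h1 : UnitAt η y g (c y) := hg y (hWV hy).2
              rw [← h1.div_mem_iff, mul_div_assoc, ← hf', ← ha]
              exact ev_mem_regularAt η hWη hy a
          obtain ⟨n, hn⟩ := H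
          obtain ⟨a, ha⟩ := exists_ev_eq η hU (ev η U.1 hU f ^ n * ev η _ hη t) fun y hy ↦ by
            have h1 : c y ≠ 0 := by
              obtain ⟨V, hyV, g, hg⟩ := hc y
              exact (hg y hyV).2.1
            have := mul_mem (hn y hy) (hreg y)
            rwa [div_mul_cancel₀ _ h1] at this
          have haJ : a ∈ J U := (hJ U hU a).mpr fun y hy ↦ by rw [ha]; exact hn y hy
          have h2 : IsUnit (X.presheaf.map (homOfLE (X.basicOpen_le f)).op f) :=
            RingedSpace.isUnit_res_basicOpen _ f
          have h3 : X.presheaf.map (homOfLE (X.basicOpen_le f)).op a =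
              X.presheaf.map (homOfLE (X.basicOpen_le f)).op f ^ n * t := by
            apply ev_injective η hη
            rw [map_mul, map_pow, ev_map η _ hη hU, ev_map η _ hη hU, ha]
          have h4 := Ideal.mem_map_of_mem (X.presheaf.map (homOfLE (X.basicOpen_le f)).op).hom haJ
          -- The power of `f` is invertible on the basic open and can be cancelled.
          have h5 := (Ideal.unit_mul_mem_iff_mem _ (h2.pow n)).mp (h3 ▸ h4)
          exact h5 }
  refine ⟨I, fun x ↦ ?_⟩
  obtain ⟨V, hxV, g, hg⟩ := hc x
  obtain ⟨_, ⟨W, hW, rfl⟩, hxW, hWV⟩ := X.isBasis_affineOpens.exists_subset_of_mem_open hxV V.isOpen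
  have hη : ⊤ ≤ η ⁻¹ᵁ W := top_le_preimage_of_mem η hxW
  obtain ⟨a, ha⟩ := exists_ev_eq η hη g fun y hy ↦ by
    have := mul_mem (hg y (hWV hy)).2.2.1 (hreg y)
    rwa [div_mul_cancel₀ _ (hg y (hWV hy)).2.1] at this
  refine ⟨⟨W, hW⟩, hxW, hη, a, ?_, ?_⟩
  · apply le_antisymm
    · intro b hb
      have h1 := (hJ ⟨W, hW⟩ hη b).mp hb
      obtain ⟨r, hr⟩ := exists_ev_eq η hη (ev η W hη b / g) fun y hy ↦
        (UnitAt.div_mem_iff (hg y (hWV hy)) _).mpr (h1 y hy)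
      refine Ideal.mem_span_singleton'.mpr ⟨r, ev_injective η hη ?_⟩
      rw [map_mul, hr, ha, div_mul_cancel₀ _ (hg x hxV).1]
    · rw [Ideal.span_singleton_le_iff_mem]
      refine (hJ ⟨W, hW⟩ hη a).mpr fun y hy ↦ ?_
      rw [ha]
      exact (hg y (hWV hy)).2.2.1
  · rw [ha]
    exact hg x hxV

end Equations

/-! ### Field-valued points of affine opens as ring homomorphisms -/

section PointsOfAffineOpens

variable {K : Type u} [Field K] {X : Scheme.{u}}

/-- The value at a `K`-point, as a morphism in the category of rings. -/
abbrev evHom (η : Spec (.of K) ⟶ X) (U : X.Opens) (h : ⊤ ≤ η ⁻¹ᵁ U) : Γ(X, U) ⟶ .of K :=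
  CommRingCat.ofHom (ev η U h)

lemma SpecMap_ev_fromSpec (η : Spec (.of K) ⟶ X) {U : X.Opens} (hU : IsAffineOpen U)
    (h : ⊤ ≤ η ⁻¹ᵁ U) : Spec.map (evHom η U h) ≫ hU.fromSpec = η := by
  have h1 := hU.SpecMap_appLE_fromSpec η (isAffineOpen_top (Spec (.of K))) h
  have h2 : evHom η U h = η.appLE U ⊤ h ≫ (Scheme.ΓSpecIso (.of K)).hom := rfl
  have h3 : Spec.map (Scheme.ΓSpecIso (.of K)).hom ≫ (Spec (.of K)).isoSpec.inv = 𝟙 _ := by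
    rw [Iso.comp_inv_eq, Category.id_comp]
    simp [Scheme.isoSpec]
  rw [h2, Spec.map_comp, Category.assoc, h1, IsAffineOpen.fromSpec_top, reassoc_of% h3]

lemma top_le_preimage_SpecMap_fromSpec {U : X.Opens} (hU : IsAffineOpen U)
    (φ : Γ(X, U) ⟶ .of K) : ⊤ ≤ (Spec.map φ ≫ hU.fromSpec) ⁻¹ᵁ U := by
  intro q _
  change hU.fromSpec (Spec.map φ q) ∈ U
  have : hU.fromSpec (Spec.map φ q) ∈ Set.range hU.fromSpec := ⟨_, rfl⟩
  rwa [hU.range_fromSpec] at this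

lemma ev_SpecMap_fromSpec {U : X.Opens} (hU : IsAffineOpen U) (φ : Γ(X, U) ⟶ .of K)
    (h : ⊤ ≤ (Spec.map φ ≫ hU.fromSpec) ⁻¹ᵁ U) (a : Γ(X, U)) :
    ev (Spec.map φ ≫ hU.fromSpec) U h a = φ a := by
  have h1 := SpecMap_ev_fromSpec (Spec.map φ ≫ hU.fromSpec) hU h
  rw [cancel_mono] at h1
  exact congr($(Spec.map_injective h1) a)

end PointsOfAffineOpens

/-! ### Homogeneous coordinates of field-valued points of projective space -/

section Coordinates

open MvPolynomial HomogeneousLocalization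

variable {k : Type u} [Field k] {K : Type u} [Field K] [Algebra k K] {n : ℕ}

/-- The standard grading of the polynomial ring. -/
abbrev stdGrading (n : ℕ) (k : Type u) [Field k] :
    ℕ → Submodule k (MvPolynomial (Fin (n + 1)) k) :=
  homogeneousSubmodule (Fin (n + 1)) k

/-- The evaluation of homogeneous fractions at a vector. -/
def coordHom (ξ : Fin (n + 1) → K) (f : MvPolynomial (Fin (n + 1)) k) (hf : aeval ξ f ≠ 0) :
    Away (stdGrading n k) f →+* K :=
  (IsLocalization.Away.lift (S := Localization.Away f) f
    (g := (aeval ξ : MvPolynomial (Fin (n + 1)) k →ₐ[k] K).toRingHom) hf.isUnit).comp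
    (algebraMap (Away (stdGrading n k) f) (Localization.Away f))

lemma coordHom_mk (ξ : Fin (n + 1) → K) {f : MvPolynomial (Fin (n + 1)) k} (hf : aeval ξ f ≠ 0)
    {d : ℕ} (hd : f ∈ stdGrading n k d) (m : ℕ) (F) (hF : F ∈ stdGrading n k (m • d)) :
    coordHom ξ f hf (Away.mk (stdGrading n k) hd m F hF) = aeval ξ F / aeval ξ f ^ m := by
  rw [eq_div_iff (pow_ne_zero _ hf)]
  have h1 : algebraMap (Away (stdGrading n k) f) (Localization.Away f)
      (Away.mk (stdGrading n k) hd m F hF) * algebraMap _ _ (f ^ m) = algebraMap _ _ F := by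
    rw [HomogeneousLocalization.algebraMap_apply, Away.val_mk, Localization.mk_eq_mk']
    exact IsLocalization.mk'_spec (Localization.Away f) F (⟨f ^ m, m, rfl⟩ : Submonoid.powers f)
  have h2 := congr(IsLocalization.Away.lift (S := Localization.Away f) f
    (g := (aeval ξ : MvPolynomial (Fin (n + 1)) k →ₐ[k] K).toRingHom) hf.isUnit $h1)
  rw [map_mul, IsLocalization.Away.lift_eq, IsLocalization.Away.lift_eq] at h2
  refine Eq.trans ?_ h2
  congr 1
  exact (map_pow (aeval ξ) f m).symm

lemma coordHom_comp_awayMap (ξ : Fin (n + 1) → K) {f g x : MvPolynomial (Fin (n + 1)) k}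
    (hf : aeval ξ f ≠ 0) (hx0 : aeval ξ x ≠ 0) {d e : ℕ} (hd : f ∈ stdGrading n k d)
    (he : g ∈ stdGrading n k e) (hx : x = f * g) :
    (coordHom ξ x hx0).comp (awayMap (stdGrading n k) he hx) = coordHom ξ f hf := by
  ext z
  obtain ⟨m, F, hF, rfl⟩ := Away.mk_surjective _ hd z
  have hg : aeval ξ g ≠ 0 := fun h ↦ hx0 (by rw [hx, map_mul, h, mul_zero])
  rw [RingHom.comp_apply, awayMap_mk, coordHom_mk, coordHom_mk, hx, map_mul, map_mul, map_pow,
    mul_pow, mul_div_mul_right _ _ (pow_ne_zero _ hg)]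

lemma X_mem_stdGrading (i : Fin (n + 1)) : (X i : MvPolynomial (Fin (n + 1)) k) ∈
    stdGrading n k 1 := isHomogeneous_X _ _

lemma aeval_X_ne_zero {ξ : Fin (n + 1) → K} {j : Fin (n + 1)} (hj : ξ j ≠ 0) :
    aeval ξ (X j : MvPolynomial (Fin (n + 1)) k) ≠ 0 := by rwa [aeval_X]

/-- The standard chart of projective space. -/
def chartι (k : Type u) [Field k] (j : Fin (n + 1)) :
    Spec (.of (Away (stdGrading n k) (X j))) ⟶ PSpace n k :=
  Proj.awayι (stdGrading n k) (X j) (X_mem_stdGrading j) one_pos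

variable (k) in
/-- The point of projective space with the homogeneous coordinates `ξ`, using `ξ j ≠ 0`. -/
def projPoint (ξ : Fin (n + 1) → K) (j : Fin (n + 1)) (hj : ξ j ≠ 0) :
    Spec (.of K) ⟶ PSpace n k :=
  Spec.map (CommRingCat.ofHom (coordHom ξ (X j) (aeval_X_ne_zero hj))) ≫ chartι k j

/-- Both points factor through the chart where `X i * X j` is invertible. -/
lemma projPoint_eq (ξ : Fin (n + 1) → K) {i j : Fin (n + 1)} (hi : ξ i ≠ 0) (hj : ξ j ≠ 0) :
    projPoint k ξ i hi = projPoint k ξ j hj := by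
  have hij : aeval ξ (X i * X j : MvPolynomial (Fin (n + 1)) k) ≠ 0 := by
    rw [map_mul, aeval_X, aeval_X]; exact mul_ne_zero hi hj
  have h1 := Proj.SpecMap_awayMap_awayι (stdGrading n k) (X_mem_stdGrading (k := k) i) one_pos
    (X_mem_stdGrading j) (rfl : X i * X j = X i * X j)
  have h2 := Proj.SpecMap_awayMap_awayι (stdGrading n k) (X_mem_stdGrading (k := k) j) one_pos
    (X_mem_stdGrading i) (mul_comm (X i) (X j))
  have h3 : _ ≫ chartι k i = _ ≫ chartι k j := h1.trans h2.symm
  rw [projPoint, projPoint, ← coordHom_comp_awayMap ξ (aeval_X_ne_zero hi) hij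
    (X_mem_stdGrading i) (X_mem_stdGrading j) rfl, ← coordHom_comp_awayMap ξ (aeval_X_ne_zero hj) hij
    (X_mem_stdGrading j) (X_mem_stdGrading i) (mul_comm _ _), CommRingCat.ofHom_comp,
    CommRingCat.ofHom_comp, Spec.map_comp, Spec.map_comp, Category.assoc, Category.assoc, h3]

lemma C_mem_stdGrading (a : k) : (C a : MvPolynomial (Fin (n + 1)) k) ∈
    stdGrading n k (0 • 1) := isHomogeneous_C _ a

/-- The constants, as homogeneous fractions. -/
def constAway (k : Type u) [Field k] (j : Fin (n + 1)) : k →+* Away (stdGrading n k) (X j) :=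
  (fromZeroRingHom (stdGrading n k) (.powers (X j))).comp (algebraMap k (stdGrading n k 0))

lemma val_constAway (j : Fin (n + 1)) (a : k) :
    (constAway k j a).val = algebraMap (MvPolynomial (Fin (n + 1)) k)
      (Localization.Away (X j)) (C a) := by
  simp only [constAway, RingHom.comp_apply]
  exact Localization.mk_one_eq_algebraMap _

lemma constAway_apply (j : Fin (n + 1)) (a : k) : constAway k j a =
    Away.mk (stdGrading n k) (X_mem_stdGrading j) 0 (C a) (C_mem_stdGrading a) := by
  apply val_injective
  rw [Away.val_mk, val_constAway, ← Localization.mk_one_eq_algebraMap]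
  congr 1

lemma coordHom_constAway (ξ : Fin (n + 1) → K) (j : Fin (n + 1)) (hj : ξ j ≠ 0) (a : k) :
    coordHom ξ (X j) (aeval_X_ne_zero hj) (constAway k j a) = algebraMap k K a := by
  rw [constAway_apply, coordHom_mk]
  simp

lemma chartι_toSpec (j : Fin (n + 1)) : chartι k j ≫ PSpace.toSpec n k =
    Spec.map (CommRingCat.ofHom (constAway k j)) := by
  have h := Proj.awayι_toSpecZero (stdGrading n k) (X j) (X_mem_stdGrading j) one_pos
  rw [constAway, CommRingCat.ofHom_comp, Spec.map_comp, ← h]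
  rfl

lemma projPoint_toSpec (ξ : Fin (n + 1) → K) (j : Fin (n + 1)) (hj : ξ j ≠ 0) :
    projPoint k ξ j hj ≫ PSpace.toSpec n k =
      Spec.map (CommRingCat.ofHom (algebraMap k K)) := by
  rw [projPoint, Category.assoc, chartι_toSpec, ← Spec.map_comp]
  congr 1
  ext a
  exact coordHom_constAway ξ j hj a

variable (k) in
/-- The coordinate `x i / x j`. -/
def coordAway (j i : Fin (n + 1)) : Away (stdGrading n k) (X j) :=
  Away.mk (stdGrading n k) (X_mem_stdGrading j) 1 (X i) (X_mem_stdGrading i)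

lemma coordHom_coordAway (ξ : Fin (n + 1) → K) (j i : Fin (n + 1)) (hj : ξ j ≠ 0) :
    coordHom ξ (X j) (aeval_X_ne_zero hj) (coordAway k j i) = ξ i / ξ j := by
  rw [coordAway, coordHom_mk]
  simp

lemma _root_.MvPolynomial.IsHomogeneous.eval₂_mul {σ R S : Type*} [Fintype σ] [CommSemiring R]
    [CommSemiring S] {F : MvPolynomial σ R} {m : ℕ} (hF : F.IsHomogeneous m) (f : R →+* S) (c : S)
    (y : σ → S) : eval₂ f (fun i ↦ c * y i) F = c ^ m * eval₂ f y F := by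
  rw [eval₂_eq', eval₂_eq', Finset.mul_sum]
  refine Finset.sum_congr rfl fun d hd ↦ ?_
  have h : ∑ i, d i = m := by
    rw [← Finsupp.degree_eq_sum, hF.degree_eq_sum_deg_support hd]
    rfl
  simp_rw [mul_pow, Finset.prod_mul_distrib, Finset.prod_pow_eq_pow_sum, h]
  ring

/-- By homogeneity, dividing `F` by the power of `X j` is the same as substituting the quotients of
coordinates. So the chart ring is generated by these quotients over the constants. -/
lemma eval₂_coordAway (j : Fin (n + 1)) (m : ℕ) (F) (hF : F ∈ stdGrading n k (m • 1)) :
    eval₂ (constAway k j) (coordAway k j) F =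
      Away.mk (stdGrading n k) (X_mem_stdGrading j) m F hF := by
  apply val_injective
  have h1 : F.IsHomogeneous m := by simpa using hF
  let u : Localization.Away (X j : MvPolynomial (Fin (n + 1)) k) :=
    Localization.mk 1 (⟨X j, 1, pow_one _⟩ : Submonoid.powers (X j))
  let φ := algebraMap (MvPolynomial (Fin (n + 1)) k) (Localization.Away (X j : MvPolynomial (Fin (n + 1)) k))
  have h2 (i : Fin (n + 1)) : (coordAway k j i).val = u * φ (X i) := by
    rw [coordAway, Away.val_mk, ← Localization.mk_one_eq_algebraMap, Localization.mk_mul]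
    simp
  have h3 : (algebraMap (Away (stdGrading n k) (X j))
      (Localization.Away (X j : MvPolynomial (Fin (n + 1)) k))).comp (constAway k j) = φ.comp C := RingHom.ext (val_constAway j)
  have h4 := hom_eval₂ F (constAway k j)
    (algebraMap (Away (stdGrading n k) (X j))
      (Localization.Away (X j : MvPolynomial (Fin (n + 1)) k))) (coordAway k j)
  rw [h3] at h4
  simp only [HomogeneousLocalization.algebraMap_apply, h2] at h4
  rw [h4, h1.eval₂_mul, Away.val_mk, ← hom_eval₂, eval₂_eta, Localization.mk_pow,
    ← Localization.mk_one_eq_algebraMap, Localization.mk_mul]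
  simp
  rfl

variable (k) in
/-- The standard affine open of projective space. -/
def chartOpen (j : Fin (n + 1)) : (PSpace n k).Opens := Proj.basicOpen (stdGrading n k) (X j)

lemma isAffineOpen_chartOpen (j : Fin (n + 1)) : IsAffineOpen (chartOpen k j) :=
  Proj.isAffineOpen_basicOpen (stdGrading n k) (X j) (X_mem_stdGrading j) one_pos

lemma exists_mem_chartOpen (x : PSpace n k) : ∃ j, x ∈ chartOpen k j := by
  have h : ⨆ j, chartOpen k j = (⊤ : (PSpace n k).Opens) := by
    refine Proj.iSup_basicOpen_eq_top' (stdGrading n k) X (fun i ↦ ⟨1, X_mem_stdGrading i⟩) ?_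
    rw [eq_top_iff]
    intro p _
    induction p using MvPolynomial.induction_on with
    | C a => exact Subalgebra.algebraMap_mem _ (⟨C a, isHomogeneous_C _ a⟩ : stdGrading n k 0)
    | add p q hp hq => exact add_mem (hp trivial) (hq trivial)
    | mul_X p i hp => exact mul_mem (hp trivial) (Algebra.subset_adjoin ⟨i, rfl⟩)
  exact TopologicalSpace.Opens.mem_iSup.mp (h ▸ TopologicalSpace.Opens.mem_top x)

variable (k) in
/-- The sections on a standard affine open are the homogeneous fractions. -/
def chartIso (j : Fin (n + 1)) :
    CommRingCat.of (Away (stdGrading n k) (X j)) ≅ Γ(PSpace n k, chartOpen k j) :=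
  Proj.basicOpenIsoAway (stdGrading n k) (X j) (X_mem_stdGrading j) one_pos

lemma SpecMap_chartIso_chartι (j : Fin (n + 1)) :
    Spec.map (chartIso k j).hom ≫ chartι k j = (isAffineOpen_chartOpen j).fromSpec := by
  have : IsAffine (chartOpen k j).toScheme := isAffineOpen_chartOpen j
  have h1 : (chartOpen k j).toSpecΓ ≫ Spec.map (chartIso k j).hom ≫ chartι k j =
      (chartOpen k j).ι := by
    have := Proj.basicOpenIsoSpec_inv_ι (stdGrading n k) (X j) (X_mem_stdGrading j) one_pos
    rw [Iso.inv_comp_eq] at this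
    rw [← Category.assoc]
    exact this.symm
  have h2 := (isAffineOpen_chartOpen (k := k) j).toSpecΓ_fromSpec
  have : IsIso (chartOpen k j).toSpecΓ := by
    rw [← (isAffineOpen_chartOpen (k := k) j).isoSpec_hom]
    infer_instance
  rw [← cancel_epi (chartOpen k j).toSpecΓ, h1, h2]

lemma chartι_eq (j : Fin (n + 1)) : chartι k j =
    Spec.map (chartIso k j).inv ≫ (isAffineOpen_chartOpen j).fromSpec := by
  rw [← SpecMap_chartIso_chartι, ← Spec.map_comp_assoc, Iso.hom_inv_id, Spec.map_id,
    Category.id_comp]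

lemma projPoint_eq_fromSpec (ξ : Fin (n + 1) → K) (j : Fin (n + 1)) (hj : ξ j ≠ 0) :
    projPoint k ξ j hj = Spec.map ((chartIso k j).inv ≫
      CommRingCat.ofHom (coordHom ξ (X j) (aeval_X_ne_zero hj))) ≫
      (isAffineOpen_chartOpen j).fromSpec := by
  rw [Spec.map_comp, Category.assoc, ← chartι_eq]
  rfl

lemma top_le_preimage_projPoint (ξ : Fin (n + 1) → K) {j : Fin (n + 1)} (hj : ξ j ≠ 0) :
    ⊤ ≤ projPoint k ξ j hj ⁻¹ᵁ chartOpen k j := by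
  rw [projPoint_eq_fromSpec]
  exact top_le_preimage_SpecMap_fromSpec _ _

lemma ev_projPoint (ξ : Fin (n + 1) → K) {j : Fin (n + 1)} (hj : ξ j ≠ 0)
    (h : ⊤ ≤ projPoint k ξ j hj ⁻¹ᵁ chartOpen k j) (a) :
    ev (projPoint k ξ j hj) (chartOpen k j) h ((chartIso k j).hom a) =
      coordHom ξ (X j) (aeval_X_ne_zero hj) a := by
  have h1 := projPoint_eq_fromSpec (k := k) ξ j hj
  generalize projPoint k ξ j hj = p at *
  subst h1
  rw [ev_SpecMap_fromSpec, ← CommRingCat.comp_apply, Iso.hom_inv_id_assoc]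
  rfl

lemma basicOpen_coordAway (j i : Fin (n + 1)) :
    (PSpace n k).basicOpen ((chartIso k j).hom (coordAway k j i)) =
      chartOpen k j ⊓ chartOpen k i := by
  have hj := isAffineOpen_chartOpen (k := k) j
  have h1 := Proj.awayι_preimage_basicOpen (stdGrading n k) (X_mem_stdGrading (k := k) j) one_pos
    (X_mem_stdGrading i) one_pos
  have h2 : Away.isLocalizationElem (X_mem_stdGrading j) (X_mem_stdGrading (k := k) i) =
      coordAway k j i := by
    apply val_injective
    rw [Away.isLocalizationElem, Away.val_mk, coordAway, Away.val_mk]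
    simp
  rw [h2] at h1
  have h3 : chartι k j ⁻¹ᵁ chartOpen k i = PrimeSpectrum.basicOpen (coordAway k j i) := h1
  have h4 : hj.fromSpec ⁻¹ᵁ chartOpen k i =
      hj.fromSpec ⁻¹ᵁ (PSpace n k).basicOpen ((chartIso k j).hom (coordAway k j i)) := by
    rw [hj.fromSpec_preimage_basicOpen, ← SpecMap_chartIso_chartι, Scheme.Hom.comp_preimage, h3]
    rfl
  have h5 := congr(hj.fromSpec ''ᵁ $h4)
  rw [Scheme.Hom.image_preimage_eq_opensRange_inf, Scheme.Hom.image_preimage_eq_opensRange_inf,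
    hj.opensRange_fromSpec, inf_eq_right.mpr ((PSpace n k).basicOpen_le _)] at h5
  exact h5.symm

/-- A `K`-point of projective space over `k` has homogeneous coordinates. -/
lemma exists_projPoint (p : Spec (.of K) ⟶ PSpace n k)
    (hp : p ≫ PSpace.toSpec n k = Spec.map (CommRingCat.ofHom (algebraMap k K))) :
    ∃ (ξ : Fin (n + 1) → K) (j : Fin (n + 1)) (hj : ξ j ≠ 0), p = projPoint k ξ j hj := by
  let z : Spec (.of K) := (⊥ : PrimeSpectrum K)
  obtain ⟨j, hj⟩ := exists_mem_chartOpen (p z)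
  have h : ⊤ ≤ p ⁻¹ᵁ chartOpen k j := by
    intro q _
    obtain rfl : z = q := Subsingleton.elim (α := PrimeSpectrum K) z q
    exact hj
  let t' : CommRingCat.of (Away (stdGrading n k) (X j)) ⟶ .of K :=
    (chartIso k j).hom ≫ evHom p _ h
  let t : Away (stdGrading n k) (X j) →+* K := t'.hom
  have hp' : p = Spec.map (CommRingCat.ofHom t) ≫ chartι k j := by
    have h1 : CommRingCat.ofHom t = (chartIso k j).hom ≫ evHom p _ h := rfl
    rw [h1, Spec.map_comp, Category.assoc, SpecMap_chartIso_chartι, SpecMap_ev_fromSpec]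
  have ht : t.comp (constAway k j) = algebraMap k K := by
    rw [hp', Category.assoc, chartι_toSpec, ← Spec.map_comp] at hp
    exact congr(($(Spec.map_injective hp)).hom)
  -- The coordinates are the values of `x i / x j`, hence normalized by `ξ j = 1`.
  let ξ (i : Fin (n + 1)) : K := t (coordAway k j i)
  have hξ : ξ j = 1 := by
    have : coordAway k j j = 1 := by
      apply val_injective
      rw [coordAway, Away.val_mk, val_one]
      simp only [pow_one]
      exact Localization.mk_self
        (⟨X j, 1, pow_one _⟩ : Submonoid.powers (X j : MvPolynomial (Fin (n + 1)) k))
    simp only [ξ, this, map_one]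
  have hj0 : ξ j ≠ 0 := hξ ▸ one_ne_zero
  refine ⟨ξ, j, hj0, ?_⟩
  rw [projPoint, hp']
  congr 3
  ext a
  obtain ⟨m, F, hF, rfl⟩ := Away.mk_surjective _ (X_mem_stdGrading (k := k) j) a
  rw [coordHom_mk, ← eval₂_coordAway, hom_eval₂, ht, aeval_X, hξ, one_pow, div_one]
  rfl

end Coordinates

/-! ### Atlases of closed subschemes of projective space -/

section Charts

variable {k : Type u} [Field k] {K : Type u} [Field K] [Algebra k K] {X : Scheme.{u}}

lemma ev_ne_zero_of_top_le_basicOpen (η : Spec (.of K) ⟶ X) {U : X.Opens} (hU : ⊤ ≤ η ⁻¹ᵁ U)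
    (a : Γ(X, U)) (h : ⊤ ≤ η ⁻¹ᵁ X.basicOpen a) : ev η U hU a ≠ 0 := by
  have h1 : IsUnit (X.presheaf.map (homOfLE (X.basicOpen_le a)).op a) :=
    RingedSpace.isUnit_res_basicOpen _ a
  have h2 := (h1.map (ev η _ h)).ne_zero
  rwa [ev_map η _ h hU] at h2

variable (k) in
/-- The homogeneous coordinates `ξ` at the `K`-point `η` give an atlas of `X` by the spectra of the
algebras generated by the quotients of the coordinates. -/
structure Charts (η : Spec (.of K) ⟶ X) {ι : Type*} (ξ : ι → K) where
  /-- the affine opens of the atlas -/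
  U : ι → X.affineOpens
  ne_zero (i : ι) : ξ i ≠ 0
  top_le (i : ι) : ⊤ ≤ η ⁻¹ᵁ (U i).1
  exists_mem (x : X) : ∃ i, x ∈ (U i).1
  exists_iff (i : ι) (s : K) : (∃ a, ev η (U i).1 (top_le i) a = s) ↔
    s ∈ Algebra.adjoin k (Set.range fun j ↦ ξ j / ξ i)
  -- This says that the points of chart `i` where `ξ j / ξ i` is invertible lie in chart `j`.
  mem_of_mem (i j : ι) (x : X) (hx : x ∈ (U i).1) (h : ξ i / ξ j ∈ regularAt η x) : x ∈ (U j).1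

/-- A change of the index set of an atlas. -/
def Charts.reindex {η : Spec (.of K) ⟶ X} {ι ι' : Type*} {ξ : ι → K} (c : Charts k η ξ)
    (e : ι' ≃ ι) : Charts k η (ξ ∘ e) where
  U i := c.U (e i)
  ne_zero i := c.ne_zero _
  top_le i := c.top_le _
  exists_mem x := (c.exists_mem x).elim fun i hi ↦ ⟨e.symm i, by rwa [e.apply_symm_apply]⟩
  exists_iff i s := by
    have : (Set.range fun j ↦ (ξ ∘ e) j / (ξ ∘ e) i) = Set.range fun j ↦ ξ j / ξ (e i) :=
      e.surjective.range_comp fun j ↦ ξ j / ξ (e i)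
    rw [this]
    exact c.exists_iff (e i) s
  mem_of_mem i j := c.mem_of_mem (e i) (e j)

/-- Vanishing coordinates contribute only zero, so the nonzero ones already generate the values. -/
lemma range_coordHom {n : ℕ} (ξ : Fin (n + 1) → K) (i : Fin (n + 1)) (hi : ξ i ≠ 0) (s : K) :
    (∃ a, coordHom ξ (MvPolynomial.X i : MvPolynomial (Fin (n + 1)) k) (aeval_X_ne_zero hi) a = s) ↔
      s ∈ Algebra.adjoin k (Set.range fun j : {j // ξ j ≠ 0} ↦ ξ j / ξ i) := by
  constructor
  · rintro ⟨a, rfl⟩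
    obtain ⟨m, F, hF, rfl⟩ := HomogeneousLocalization.Away.mk_surjective _
      (X_mem_stdGrading (k := k) i) a
    rw [← eval₂_coordAway, MvPolynomial.hom_eval₂]
    have : (coordHom ξ (MvPolynomial.X i : MvPolynomial (Fin (n + 1)) k)
        (aeval_X_ne_zero hi)).comp (constAway k i) = algebraMap k K :=
      RingHom.ext (coordHom_constAway ξ i hi)
    rw [this]
    refine MvPolynomial.eval₂_mem (p := F) (fun r _ ↦ Subalgebra.algebraMap_mem _ _)
      fun j ↦ ?_
    rw [coordHom_coordAway ξ i j hi]
    by_cases hj : ξ j = 0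
    · rw [hj, zero_div]; exact zero_mem _
    · exact Algebra.subset_adjoin ⟨⟨j, hj⟩, rfl⟩
  · intro hs
    change s ∈ (coordHom ξ (MvPolynomial.X i : MvPolynomial (Fin (n + 1)) k)
      (aeval_X_ne_zero hi)).range
    induction hs using Algebra.adjoin_induction with
    | mem x hx =>
      obtain ⟨j, rfl⟩ := hx
      exact ⟨_, coordHom_coordAway ξ i j hi⟩
    | algebraMap r => exact ⟨_, coordHom_constAway ξ i hi r⟩
    | add x y _ _ hx hy => exact add_mem hx hy
    | mul x y _ _ hx hy => exact mul_mem hx hy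

/-- The atlas of a closed subscheme of projective space. -/
lemma nonempty_charts {n : ℕ} (i : X ⟶ PSpace n k) [IsClosedImmersion i] [IsReduced X]
    (η : Spec (.of K) ⟶ X) [IsDominant η] (ξ : Fin (n + 1) → K) {j₀ : Fin (n + 1)}
    (hj₀ : ξ j₀ ≠ 0) (hi : η ≫ i = projPoint k ξ j₀ hj₀) :
    Nonempty (Charts k η fun j : {j // ξ j ≠ 0} ↦ ξ j) := by
  have h1 (j) (hj : ξ j ≠ 0) : η ≫ i = projPoint k ξ j hj := hi.trans (projPoint_eq ξ _ _)
  have h2 (j) (hj : ξ j ≠ 0) : ⊤ ≤ (η ≫ i) ⁻¹ᵁ chartOpen k j := by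
    rw [h1 j hj]; exact top_le_preimage_projPoint ξ hj
  have h2' (j) (hj : ξ j ≠ 0) : ⊤ ≤ η ⁻¹ᵁ (i ⁻¹ᵁ chartOpen k j) := h2 j hj
  have h3 (j) (hj : ξ j ≠ 0) (a) : ev η (i ⁻¹ᵁ chartOpen k j) (h2' j hj)
      (i.app _ ((chartIso k j).hom a)) =
        coordHom ξ (MvPolynomial.X j) (aeval_X_ne_zero hj) a := by
    rw [← ev_projPoint ξ hj (top_le_preimage_projPoint ξ hj), ← Scheme.Hom.appLE_eq_app,
      ev_appLE η i le_rfl (h2' j hj) (h2 j hj)]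
    generalize_proofs p1 p2 at *
    have h4 := h1 j hj
    generalize η ≫ i = q at *
    subst h4
    rfl
  refine ⟨⟨fun j ↦ ⟨i ⁻¹ᵁ chartOpen k j, (isAffineOpen_chartOpen j.1).preimage i⟩, fun j ↦ j.2,
    fun j ↦ h2' j.1 j.2, fun x ↦ ?_, fun j s ↦ ?_, fun j l x hx h ↦ ?_⟩⟩
  · obtain ⟨j, hj⟩ := exists_mem_chartOpen (i x)
    -- A chart that meets `X` contains `η` by density, so the corresponding coordinate of `η` cannot
    -- vanish.
    refine ⟨⟨j, fun h0 ↦ ?_⟩, hj⟩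
    have h4 : ⊤ ≤ η ⁻¹ᵁ (i ⁻¹ᵁ chartOpen k j) := top_le_preimage_of_mem η (x := x) hj
    have h5 : ⊤ ≤ (η ≫ i) ⁻¹ᵁ (PSpace n k).basicOpen ((chartIso k j₀).hom (coordAway k j₀ j)) := by
      rw [basicOpen_coordAway]
      exact fun q hq ↦ ⟨h2 j₀ hj₀ hq, h4 hq⟩
    have h6 := ev_ne_zero_of_top_le_basicOpen (η ≫ i) (h2 j₀ hj₀) _ h5
    rw [← ev_appLE η i le_rfl (h2' j₀ hj₀) (h2 j₀ hj₀), Scheme.Hom.appLE_eq_app, h3 _ hj₀,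
      coordHom_coordAway ξ _ _ hj₀, h0, zero_div] at h6
    exact h6 rfl
  · rw [← range_coordHom ξ j.1 j.2]
    constructor
    · rintro ⟨a, rfl⟩
      obtain ⟨b, rfl⟩ := i.app_surjective _ (isAffineOpen_chartOpen (k := k) j.1) a
      obtain ⟨c, rfl⟩ := (ConcreteCategory.bijective_of_isIso (chartIso k j.1).hom).surjective b
      exact ⟨c, (h3 j.1 j.2 c).symm⟩
    · rintro ⟨a, ha⟩
      rw [← ha]
      exact ⟨_, h3 j.1 j.2 a⟩
  · let u := i.app _ ((chartIso k j.1).hom (coordAway k j.1 l.1))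
    have h4 : ev η _ (h2' j.1 j.2) u = ξ l / ξ j := (h3 j.1 j.2 _).trans (coordHom_coordAway ξ j.1 l.1 j.2)
    have h5 : x ∈ X.basicOpen u := by
      rw [mem_basicOpen_iff η (h2' j.1 j.2) u hx, h4, inv_div]
      exact ⟨div_ne_zero l.2 j.2, h⟩
    rw [← Scheme.preimage_basicOpen, basicOpen_coordAway] at h5
    exact h5.2

/-- The kernel of the map to the image is zero: its zero locus and the image have the same ideal in
`Y`. Reducedness then passes from the source to the image. -/
lemma isReduced_image {X Y : Scheme.{u}} (f : X ⟶ Y) [QuasiCompact f] [IsReduced X] :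
    IsReduced f.image := by
  have h1 : (f.toImage.ker.subschemeι ≫ f.imageι).ker = f.imageι.ker := by
    rw [Scheme.IdealSheafData.ker_subschemeι, Scheme.Hom.ker_comp,
      Scheme.IdealSheafData.ker_subschemeι, ← Scheme.Hom.ker_comp, f.toImage_imageι]
  have h2 : IsIso f.toImage.ker.subschemeι :=
    IsClosedImmersion.isIso_of_ker_eq (f.toImage.ker.subschemeι ≫ f.imageι) f.imageι _ rfl h1
  have h3 : IsSchemeTheoreticallyDominant f.toImage :=
    ⟨(Scheme.isIso_subschemeι_iff_eq_bot _).mp h2⟩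
  exact IsSchemeTheoreticallyDominant.isReduced f.toImage

lemma isIntegral_of_isDominant {Y : Scheme.{u}} (η : Y ⟶ X) [IsDominant η] [IrreducibleSpace Y]
    [IsReduced X] : IsIntegral X := by
  have h1 : IsIrreducible (Set.range η) := by
    rw [← Set.image_univ]
    exact (IrreducibleSpace.isIrreducible_univ Y).image η η.continuous.continuousOn
  have h2 := h1.closure
  rw [η.denseRange.closure_eq] at h2
  have : IrreducibleSpace X := (irreducibleSpace_def X).mpr h2
  exact isIntegral_of_irreducibleSpace_of_isReduced X

variable (k) in
/-- The closure of the point of projective space with given nonzero homogeneous coordinates. -/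
lemma exists_charts {ι : Type*} [Finite ι] [Nonempty ι] (ζ : ι → K) (hζ : ∀ i, ζ i ≠ 0) :
    ∃ (n : ℕ) (X : Scheme.{u}) (i : X ⟶ PSpace n k) (η : Spec (.of K) ⟶ X),
      IsClosedImmersion i ∧ IsIntegral X ∧ IsDominant η ∧
      η ≫ i ≫ PSpace.toSpec n k = Spec.map (CommRingCat.ofHom (algebraMap k K)) ∧
      Nonempty (Charts k η ζ) := by
  obtain ⟨n, ⟨e⟩⟩ := Finite.exists_equiv_fin ι
  obtain ⟨n, rfl⟩ : ∃ m, n = m + 1 := Nat.exists_eq_succ_of_ne_zero fun h ↦ by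
    subst h
    exact (e (Classical.arbitrary ι)).elim0
  let ξ : Fin (n + 1) → K := ζ ∘ e.symm
  have hξ (j) : ξ j ≠ 0 := hζ _
  let p := projPoint k ξ 0 (hξ 0)
  have h1 : IsReduced p.image := isReduced_image p
  have h2 : IsDominant p.toImage := inferInstance
  have h3 : p.toImage ≫ p.imageι = projPoint k ξ 0 (hξ 0) := p.toImage_imageι
  refine ⟨n, p.image, p.imageι, p.toImage, inferInstance, isIntegral_of_isDominant p.toImage, h2,
    ?_, ?_⟩
  · rw [← Category.assoc, h3, projPoint_toSpec]
  · obtain ⟨c⟩ := nonempty_charts p.imageι p.toImage ξ (hξ 0) h3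
    let e' : ι ≃ {j // ξ j ≠ 0} := e.trans (Equiv.subtypeUnivEquiv hξ).symm
    have : (fun j : {j // ξ j ≠ 0} ↦ ξ j) ∘ e' = ζ := by
      ext j
      simp [e', ξ]
    exact ⟨this ▸ c.reindex e'⟩

end Charts

/-! ### Morphisms determined by regularity of coordinate quotients -/

section Morphisms

variable {k : Type u} [Field k] {K : Type u} [Field K] [Algebra k K] {X T : Scheme.{u}}

lemma exists_glued_hom (V : T → T.Opens) (hV : ∀ t, t ∈ V t) (g : ∀ t, (V t).toScheme ⟶ X)
    (hg : ∀ s t, pullback.fst (V s).ι (V t).ι ≫ g s = pullback.snd (V s).ι (V t).ι ≫ g t) :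
    ∃ b : T ⟶ X, ∀ t, (V t).ι ≫ b = g t := by
  have h : TopologicalSpace.IsOpenCover V :=
    top_le_iff.mp fun t _ ↦ TopologicalSpace.Opens.mem_iSup.mpr ⟨t, hV t⟩
  let 𝒰 := T.openCoverOfIsOpenCover V h
  exact ⟨𝒰.glueMorphisms g hg, fun t ↦ 𝒰.ι_glueMorphisms g hg t⟩

/-- Morphisms from opens of a reduced scheme to a separated scheme glue when they agree at a
dominant `K`-point. -/
lemma exists_hom_of_locally [IsReduced T] [X.IsSeparated] (τ : Spec (.of K) ⟶ T) [IsDominant τ]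
    (p : Spec (.of K) ⟶ X)
    (H : ∀ t, ∃ (V : T.Opens) (_ : t ∈ V) (g : V.toScheme ⟶ X) (σ : Spec (.of K) ⟶ V.toScheme),
      σ ≫ V.ι = τ ∧ σ ≫ g = p) :
    ∃ b : T ⟶ X, τ ≫ b = p := by
  choose V hV g σ hσ hg using H
  obtain ⟨b, hb⟩ := exists_glued_hom V hV g fun s t ↦ by
    let ρ : Spec (.of K) ⟶ pullback (V s).ι (V t).ι :=
      pullback.lift (σ s) (σ t) ((hσ s).trans (hσ t).symm)
    have h1 : ρ ≫ pullback.fst (V s).ι (V t).ι ≫ (V s).ι = τ := by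
      rw [pullback.lift_fst_assoc, hσ]
    have : IsDominant (ρ ≫ pullback.fst (V s).ι (V t).ι ≫ (V s).ι) := h1 ▸ inferInstance
    have : IsDominant ρ := IsDominant.of_comp_of_isOpenImmersion ρ
      (pullback.fst (V s).ι (V t).ι ≫ (V s).ι)
    have : IsReduced (pullback (V s).ι (V t).ι) :=
      isReduced_of_isOpenImmersion (pullback.fst (V s).ι (V t).ι ≫ (V s).ι)
    -- The overlap is reduced, the target is separated, and the two morphisms agree at a dominant
    -- point of the overlap.
    refine ext_of_isDominant ρ ?_
    rw [pullback.lift_fst_assoc, pullback.lift_snd_assoc, hg, hg]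
  obtain ⟨t, -⟩ := exists_mem_of_top_le τ (U := ⊤) le_rfl
  exact ⟨b, by rw [← hσ t, Category.assoc, hb, hg]⟩

variable {η : Spec (.of K) ⟶ X} {ι : Type*} {ξ : ι → K}

lemma Charts.exists_ev_eq_div (c : Charts k η ξ) (i j : ι) :
    ∃ a, ev η (c.U i).1 (c.top_le i) a = ξ j / ξ i :=
  (c.exists_iff i _).mpr (Algebra.subset_adjoin ⟨j, rfl⟩)

lemma Charts.div_mem_regularAt (c : Charts k η ξ) {i : ι} {x : X} (hx : x ∈ (c.U i).1) (j : ι) :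
    ξ j / ξ i ∈ regularAt η x := by
  obtain ⟨a, ha⟩ := c.exists_ev_eq_div i j
  rw [← ha]
  exact ev_mem_regularAt η _ hx a

lemma Charts.algebraMap_mem_regularAt (c : Charts k η ξ) (x : X) (r : k) :
    algebraMap k K r ∈ regularAt η x := by
  obtain ⟨i, hx⟩ := c.exists_mem x
  obtain ⟨a, ha⟩ := (c.exists_iff i _).mpr (Subalgebra.algebraMap_mem _ r)
  rw [← ha]
  exact ev_mem_regularAt η _ hx a

/-- If `b t` lies in chart `j`, then `ξ i / ξ j` is a function there, and regularity of its inverse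
at `t` means that it does not vanish at `b t`. -/
lemma Charts.mem_iff [IsReduced T] {τ : Spec (.of K) ⟶ T} [IsDominant τ] (b : T ⟶ X)
    (hb : τ ≫ b = η) [IsDominant η] [IsReduced X] (c : Charts k η ξ) (i : ι) (t : T) :
    b t ∈ (c.U i).1 ↔ ∀ j, ξ j / ξ i ∈ regularAt τ t := by
  subst hb
  refine ⟨fun h j ↦ regularAt_comp_le τ b t (c.div_mem_regularAt h j), fun h ↦ ?_⟩
  obtain ⟨j, hj⟩ := c.exists_mem (b t)
  refine c.mem_of_mem j i (b t) hj ?_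
  obtain ⟨a, ha⟩ := c.exists_ev_eq_div j i
  have h0 := c.ne_zero
  have h1 : ⊤ ≤ τ ⁻¹ᵁ (b ⁻¹ᵁ (c.U j).1) := c.top_le j
  have h2 : ev τ _ h1 (b.app _ a) = ξ i / ξ j := by
    rw [← ha, ← Scheme.Hom.appLE_eq_app, ev_appLE τ b le_rfl h1 (c.top_le j)]
  have h3 : t ∈ T.basicOpen (b.app _ a) := by
    rw [mem_basicOpen_iff τ h1 _ hj, h2, inv_div]
    exact ⟨div_ne_zero (h0 i) (h0 j), h j⟩
  rw [← Scheme.preimage_basicOpen] at h3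
  have h4 := (mem_basicOpen_iff (τ ≫ b) (c.top_le j) a hj).mp h3
  rw [ha, inv_div] at h4
  exact h4.2

/-- A morphism to a scheme with an atlas is given by the regularity of the quotients of
coordinates. -/
lemma Charts.exists_hom [Finite ι] [IsReduced T] {τ : Spec (.of K) ⟶ T} [IsDominant τ]
    [X.IsSeparated] (c : Charts k η ξ) (hk : ∀ t r, algebraMap k K r ∈ regularAt τ t)
    (H : ∀ t, ∃ i, ∀ j, ξ j / ξ i ∈ regularAt τ t) : ∃ b : T ⟶ X, τ ≫ b = η := by
  refine exists_hom_of_locally τ η fun t ↦ ?_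
  obtain ⟨i, hi⟩ := H t
  choose V hV hη a ha using hi
  let V₀ : T.Opens := ⟨⋂ j, (V j).1, isOpen_iInter_of_finite fun j ↦ (V j).isOpen⟩
  have htV₀ : t ∈ V₀ := Set.mem_iInter.mpr hV
  obtain ⟨_, ⟨(W : T.Opens), hW, rfl⟩, htW, hWV⟩ :=
    T.isBasis_affineOpens.exists_subset_of_mem_open htV₀ V₀.isOpen
  replace hW : IsAffineOpen W := hW
  have hU : IsAffineOpen (c.U i).1 := (c.U i).2
  have hWη : ⊤ ≤ τ ⁻¹ᵁ W := top_le_preimage_of_mem τ htW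
  -- Values on chart `i` are polynomials in the quotients `ξ j / ξ i`, all regular on `W`.
  -- Finiteness of `ι` is what makes the common neighbourhood open.
  have h1 (s : Γ(X, (c.U i).1)) : ∃ s' : Γ(T, W), ev τ W hWη s' = ev η _ (c.top_le i) s := by
    refine exists_ev_eq τ hWη _ fun y hy ↦ ?_
    have hs := (c.exists_iff i _).mp ⟨s, rfl⟩
    generalize ev η (c.U i).1 (c.top_le i) s = z at hs
    induction hs using Algebra.adjoin_induction with
    | mem x hx =>
      obtain ⟨j, rfl⟩ := hx
      exact ⟨V j, Set.mem_iInter.mp (hWV hy) j, hη j, a j, ha j⟩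
    | algebraMap r => exact hk y r
    | add x y _ _ hx hy => exact add_mem hx hy
    | mul x y _ _ hx hy => exact mul_mem hx hy
  choose f hf using h1
  let φ : Γ(X, (c.U i).1) ⟶ Γ(T, W) := CommRingCat.ofHom
    { toFun := f
      map_one' := ev_injective τ hWη (by simp only [hf, map_one])
      map_zero' := ev_injective τ hWη (by simp only [hf, map_zero])
      map_mul' x y := ev_injective τ hWη (by simp only [hf, map_mul])
      map_add' x y := ev_injective τ hWη (by simp only [hf, map_add]) }
  have h2 : φ ≫ evHom τ W hWη = evHom η _ (c.top_le i) := by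
    ext s
    exact hf s
  let σ : Spec (.of K) ⟶ W.toScheme := IsOpenImmersion.lift W.ι τ (by
    rintro _ ⟨q, rfl⟩
    simpa using hWη (TopologicalSpace.Opens.mem_top q))
  have hσ : σ ≫ W.ι = τ := IsOpenImmersion.lift_fac _ _ _
  have h3 : σ ≫ W.toSpecΓ = Spec.map (evHom τ W hWη) := by
    rw [← cancel_mono hW.fromSpec, Category.assoc, hW.toSpecΓ_fromSpec, hσ,
      SpecMap_ev_fromSpec τ hW hWη]
  refine ⟨W, htW, W.toSpecΓ ≫ Spec.map φ ≫ hU.fromSpec, σ, hσ, ?_⟩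
  rw [reassoc_of% h3, ← Spec.map_comp_assoc, h2, SpecMap_ev_fromSpec]

end Morphisms

/-! ### Homogeneous generators of ideal sheaves -/

section Denominators

variable {k : Type u} [Field k] {K : Type u} [Field K] [Algebra k K] {X : Scheme.{u}}
  {η : Spec (.of K) ⟶ X} {ι : Type*} {ξ : ι → K}

lemma Charts.isNoetherianRing [Finite ι] [IsDominant η] [IsReduced X] (c : Charts k η ξ) (i : ι) :
    IsNoetherianRing Γ(X, (c.U i).1) := by
  let A := Algebra.adjoin k (Set.range fun j ↦ ξ j / ξ i)
  have : IsNoetherianRing A := isNoetherianRing_of_fg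
    ⟨(Set.finite_range fun j ↦ ξ j / ξ i).toFinset, by simp [A]⟩
  let f : Γ(X, (c.U i).1) →+* A := (ev η _ (c.top_le i)).codRestrict A
    fun a ↦ (c.exists_iff i _).mp ⟨a, rfl⟩
  have hf : Function.Bijective f := by
    refine ⟨fun a b h ↦ ev_injective η (c.top_le i) congr($h.1), fun s ↦ ?_⟩
    obtain ⟨a, ha⟩ := (c.exists_iff i _).mpr s.2
    exact ⟨a, Subtype.ext ha⟩
  exact isNoetherianRing_of_ringEquiv A (RingEquiv.ofBijective f hf).symm

/-- Multiplication by a power of a quotient of coordinates extends a section of an ideal sheaf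
from one chart to another. -/
lemma Charts.exists_pow_mul [IsDominant η] [IsReduced X] (c : Charts k η ξ) (I : X.IdealSheafData)
    (i j : ι) {b : Γ(X, (c.U j).1)} (hb : b ∈ I.ideal (c.U j)) :
    ∃ n₀, ∀ n ≥ n₀, ∃ a ∈ I.ideal (c.U i), ev η _ (c.top_le i) a =
      (ξ j / ξ i) ^ n * ev η _ (c.top_le j) b := by
  obtain ⟨u, hu⟩ := c.exists_ev_eq_div i j
  have h1 : X.basicOpen u ≤ (c.U j).1 := fun x hx ↦ by
    have hxi := X.basicOpen_le u hx
    rw [mem_basicOpen_iff η (c.top_le i) u hxi, hu, inv_div] at hx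
    exact c.mem_of_mem i j x hxi hx.2
  have h2 : ⊤ ≤ η ⁻¹ᵁ X.basicOpen u := by
    obtain ⟨x, hx⟩ := exists_mem_of_top_le η (U := (c.U i).1 ⊓ (c.U j).1)
      fun q hq ↦ ⟨c.top_le i hq, c.top_le j hq⟩
    refine top_le_preimage_of_mem η (x := x) ?_
    rw [mem_basicOpen_iff η (c.top_le i) u hx.1, hu, inv_div]
    exact ⟨div_ne_zero (c.ne_zero j) (c.ne_zero i), c.div_mem_regularAt hx.2 i⟩
  have h3 : X.presheaf.map (homOfLE h1).op b ∈ I.ideal (X.affineBasicOpen u) := by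
    rw [← I.map_ideal (U := X.affineBasicOpen u) (V := c.U j) h1]
    exact Ideal.mem_map_of_mem _ hb
  -- The basic open of `u` lies in both charts. The ideal there is extended from chart `j` and is
  -- also a localization of the ideal on chart `i`.
  rw [← I.map_ideal_basicOpen] at h3
  have := (c.U i).2.isLocalization_basicOpen u
  obtain ⟨⟨⟨a, ha⟩, ⟨_, m, rfl⟩⟩, e⟩ :=
    (IsLocalization.mem_map_algebraMap_iff (.powers u) _).mp h3
  have h4 := congr(ev η _ h2 $e)
  rw [map_mul] at h4
  simp only [RingHom.algebraMap_toAlgebra] at h4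
  erw [ev_map η _ h2 (c.top_le i), ev_map η _ h2 (c.top_le i), ev_map η _ h2 (c.top_le j)] at h4
  rw [map_pow, hu] at h4
  refine ⟨m, fun n hn ↦ ⟨u ^ (n - m) * a, Ideal.mul_mem_left _ _ ha, ?_⟩⟩
  rw [map_mul, map_pow, hu, ← h4, mul_left_comm, ← pow_add, Nat.sub_add_cancel hn, mul_comm]

/-- An ideal sheaf is generated by finitely many homogeneous elements of the same degree. -/
lemma Charts.exists_generators [Finite ι] [IsDominant η] [IsReduced X] (c : Charts k η ξ)
    (I : X.IdealSheafData) (hI : ∃ i, I.ideal (c.U i) ≠ ⊥) :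
    ∃ (Λ : Type) (_ : Finite Λ) (_ : Nonempty Λ) (φ : Λ → K) (d : ℕ)
      (a : ∀ i, Λ → Γ(X, (c.U i).1)), (∀ l, φ l ≠ 0) ∧
      (∀ i l, ev η _ (c.top_le i) (a i l) = φ l / ξ i ^ d) ∧
      ∀ i, I.ideal (c.U i) = Ideal.span (Set.range (a i)) := by
  have := Fintype.ofFinite ι
  have h1 (i : ι) : (I.ideal (c.U i)).FG := by
    have := c.isNoetherianRing i
    exact IsNoetherian.noetherian _
  choose s hs using h1
  have h2 (i j : ι) : ∃ n₀, ∀ n ≥ n₀, ∀ b ∈ s j, ∃ a ∈ I.ideal (c.U i), ev η _ (c.top_le i) a =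
      (ξ j / ξ i) ^ n * ev η _ (c.top_le j) b := by
    have (b : s j) := c.exists_pow_mul I i j (b := b.1) (hs j ▸ Submodule.subset_span b.2)
    choose n₀ hn₀ using this
    exact ⟨Finset.univ.sup n₀, fun n hn b hb ↦ hn₀ ⟨b, hb⟩ n
      ((Finset.le_sup (Finset.mem_univ (⟨b, hb⟩ : s j))).trans hn)⟩
  choose n₀ hn₀ using h2
  -- One exponent serves all pairs of charts; it is the common degree of the generators.
  let d := Finset.univ.sup fun p : ι × ι ↦ n₀ p.1 p.2
  have hd (i j : ι) : n₀ i j ≤ d :=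
    Finset.le_sup (f := fun p : ι × ι ↦ n₀ p.1 p.2) (Finset.mem_univ (i, j))
  -- Generators of value zero are discarded, since the `φ l` become nonzero homogeneous coordinates
  -- of the blow-up.
  let Λ' := Σ j : ι, {b : s j // ev η _ (c.top_le j) b.1 ≠ 0}
  have hΛ' : Finite Λ' := inferInstance
  obtain ⟨N, ⟨e⟩⟩ := Finite.exists_equiv_fin Λ'
  let φ (l : Fin N) : K := ξ (e.symm l).1 ^ d * ev η _ (c.top_le _) (e.symm l).2.1.1
  have h3 (i : ι) (l : Fin N) : ∃ a ∈ I.ideal (c.U i), ev η _ (c.top_le i) a = φ l / ξ i ^ d := by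
    obtain ⟨a, ha, ha'⟩ := hn₀ i (e.symm l).1 d (hd _ _) _ (e.symm l).2.1.2
    exact ⟨a, ha, by rw [ha', div_pow]; simp only [φ]; ring⟩
  choose a ha ha' using h3
  have h4 (i : ι) : I.ideal (c.U i) = Ideal.span (Set.range (a i)) := by
    apply le_antisymm
    · rw [← hs i, Ideal.span_le]
      intro b hb
      by_cases h0 : ev η _ (c.top_le i) b = 0
      · rw [ev_injective η (c.top_le i) (h0.trans (map_zero _).symm)]
        exact zero_mem _
      · let l := e ⟨i, ⟨b, hb⟩, h0⟩
        refine Ideal.subset_span ⟨l, ev_injective η (c.top_le i) ?_⟩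
        rw [ha']
        have h5 : e.symm l = ⟨i, ⟨b, hb⟩, h0⟩ := e.symm_apply_apply _
        simp only [φ]
        rw [h5]
        rw [mul_div_cancel_left₀ _ (pow_ne_zero _ (c.ne_zero i))]
    · rw [Ideal.span_le]
      rintro _ ⟨l, rfl⟩
      exact ha i l
  refine ⟨Fin N, inferInstance, ?_, φ, d, a, fun l ↦ ?_, ha', h4⟩
  · obtain ⟨i, hi⟩ := hI
    by_contra hN
    rw [not_nonempty_iff] at hN
    rw [h4, Set.range_eq_empty, Ideal.span_empty] at hi
    exact hi rfl
  · exact mul_ne_zero (pow_ne_zero _ (c.ne_zero _)) (e.symm l).2.2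

end Denominators

/-! ### The universal property of affine blow-up algebras -/

section RingExtension

variable {A B R Λ : Type*} [CommRing A] [CommRing B] [CommRing R]

/-- If `B` is generated over `A` by the quotients `a m / a₀`, a ring homomorphism `α` from `A` such
that `α a₀` is a non-zero-divisor dividing all `α (a m)` extends to `B`. -/
lemma exists_ringHom_extension {i : A →+* B} (hi : Function.Injective i) (α : A →+* R) {a₀ : A}
    (h₀ : α a₀ ∈ nonZeroDivisors R) (a : Λ → A) (β : Λ → B) (hβ : ∀ m, β m * i a₀ = i (a m))
    (hdvd : ∀ m, α a₀ ∣ α (a m)) (hgen : Subring.closure (Set.range i ∪ Set.range β) = ⊤) :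
    ∃ h : B →+* R, h.comp i = α := by
  let P (b : B) (r : R) : Prop := ∃ (N : ℕ) (x : A), i a₀ ^ N * b = i x ∧ α a₀ ^ N * r = α x
  have hP (b : B) (r r' : R) (h : P b r) (h' : P b r') : r = r' := by
    obtain ⟨N, x, hx, hx'⟩ := h
    obtain ⟨N', y, hy, hy'⟩ := h'
    have h1 : a₀ ^ N' * x = a₀ ^ N * y := hi (by
      rw [map_mul, map_mul, map_pow, map_pow, ← hx, ← hy]; ring)
    have h2 := congr(α $h1)
    rw [map_mul, map_mul, map_pow, map_pow, ← hx', ← hy'] at h2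
    have h3 := pow_mem h₀ (N + N')
    refine (mul_cancel_left_mem_nonZeroDivisors h3).mp ?_
    rw [pow_add]
    linear_combination h2
  have hi' (x : A) : P (i x) (α x) := ⟨0, x, by simp, by simp⟩
  have hadd {b b' : B} {r r' : R} (h : P b r) (h' : P b' r') : P (b + b') (r + r') := by
    obtain ⟨N, x, hx, hx'⟩ := h
    obtain ⟨N', y, hy, hy'⟩ := h'
    refine ⟨N + N', a₀ ^ N' * x + a₀ ^ N * y, ?_, ?_⟩
    · rw [map_add, map_mul, map_mul, map_pow, map_pow, ← hx, ← hy]; ring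
    · rw [map_add, map_mul, map_mul, map_pow, map_pow, ← hx', ← hy']; ring
  have hmul {b b' : B} {r r' : R} (h : P b r) (h' : P b' r') : P (b * b') (r * r') := by
    obtain ⟨N, x, hx, hx'⟩ := h
    obtain ⟨N', y, hy, hy'⟩ := h'
    refine ⟨N + N', x * y, ?_, ?_⟩
    · rw [map_mul, ← hx, ← hy]; ring
    · rw [map_mul, ← hx', ← hy']; ring
  have hex (b : B) : ∃ r, P b r := by
    have hb : b ∈ Subring.closure (Set.range i ∪ Set.range β) := hgen ▸ Subring.mem_top b
    induction hb using Subring.closure_induction with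
    | mem b hb =>
      rcases hb with ⟨x, rfl⟩ | ⟨m, rfl⟩
      · exact ⟨_, hi' x⟩
      · obtain ⟨r, hr⟩ := hdvd m
        exact ⟨r, 1, a m, by rw [← hβ]; ring, by rw [hr, pow_one]⟩
    | zero => exact ⟨α 0, by simpa using hi' 0⟩
    | one => exact ⟨α 1, by simpa using hi' 1⟩
    | add b b' _ _ h h' => exact ⟨_, hadd h.choose_spec h'.choose_spec⟩
    | neg b _ h =>
      obtain ⟨r, N, x, hx, hx'⟩ := h
      exact ⟨-r, N, -x, by rw [map_neg, ← hx]; ring, by rw [map_neg, ← hx']; ring⟩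
    | mul b b' _ _ h h' => exact ⟨_, hmul h.choose_spec h'.choose_spec⟩
  choose f hf using hex
  refine ⟨{ toFun := f
            map_one' := hP 1 _ _ (hf 1) (by simpa using hi' 1)
            map_zero' := hP 0 _ _ (hf 0) (by simpa using hi' 0)
            map_add' := fun b b' ↦ hP _ _ _ (hf _) (hadd (hf b) (hf b'))
            map_mul' := fun b b' ↦ hP _ _ _ (hf _) (hmul (hf b) (hf b')) }, ?_⟩
  ext x
  exact hP _ _ _ (hf (i x)) (hi' x)

/-- Two extensions agree on `β m` after multiplication by the image of `a₀`, a non-zero-divisor that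
can be cancelled. -/
lemma ringHom_extension_unique {i : A →+* B} {a₀ : A} (a : Λ → A) (β : Λ → B)
    (hβ : ∀ m, β m * i a₀ = i (a m))
    (hgen : Subring.closure (Set.range i ∪ Set.range β) = ⊤) {h h' : B →+* R}
    (hh : h.comp i = h'.comp i) (h₀ : h (i a₀) ∈ nonZeroDivisors R) : h = h' := by
  have h1 (x : A) : h (i x) = h' (i x) := congr($hh x)
  refine RingHom.ext fun b ↦ ?_
  have hb : b ∈ Subring.closure (Set.range i ∪ Set.range β) := hgen ▸ Subring.mem_top b
  refine RingHom.eqOn_set_closure (f := h) (g := h') ?_ hb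
  rintro _ (⟨x, rfl⟩ | ⟨m, rfl⟩)
  · exact h1 x
  · refine (mul_cancel_right_mem_nonZeroDivisors h₀).mp ?_
    rw [← map_mul, hβ, h1, ← hβ, map_mul, h1]

end RingExtension

/-! ### Local generators of invertible inverse image ideals -/

section Shrinking

variable {T P : Scheme.{u}}

lemma map_mem_nonZeroDivisors_of_bijective {R S : Type*} [CommRing R] [CommRing S] (f : R →+* S)
    (hf : Function.Bijective f) {x : R} (hx : x ∈ nonZeroDivisors R) :
    f x ∈ nonZeroDivisors S := by
  refine mem_nonZeroDivisors_iff_right.mpr fun z hz ↦ ?_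
  obtain ⟨y, rfl⟩ := hf.2 z
  rw [← map_mul] at hz
  rw [(mem_nonZeroDivisors_iff_right.mp hx) y (hf.1 (hz.trans (map_zero f).symm)), map_zero]

/-- Shrinking to a basic open of `W` is a localization, under which non-zero-divisors stay
non-zero-divisors. -/
lemma exists_affineOpens_nonZeroDivisors (o : P ⟶ T) [IsOpenImmersion o] (W : T.affineOpens)
    {θ : Γ(T, W.1)} (hθ : θ ∈ nonZeroDivisors Γ(T, W.1)) {p : P} (hp : o p ∈ W.1) {V₀ : P.Opens}
    (hV₀ : p ∈ V₀) : ∃ (V : P.affineOpens) (e : V.1 ≤ o ⁻¹ᵁ W.1), p ∈ V.1 ∧ V.1 ≤ V₀ ∧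
      o.appLE W.1 V.1 e θ ∈ nonZeroDivisors Γ(P, V.1) := by
  obtain ⟨s, hs, hps⟩ := W.2.exists_basicOpen_le (V := o ''ᵁ V₀) ⟨o p, p, hV₀, rfl⟩ hp
  have hs' : T.basicOpen s ≤ o.opensRange := hs.trans (by
    rintro _ ⟨q, _, rfl⟩
    exact ⟨q, rfl⟩)
  have hV : IsAffineOpen (o ⁻¹ᵁ T.basicOpen s) := by
    rw [← Scheme.Hom.isAffineOpen_iff_of_isOpenImmersion o,
      Scheme.Hom.image_preimage_eq_opensRange_inf, inf_eq_right.mpr hs']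
    exact W.2.basicOpen s
  have e : o ⁻¹ᵁ T.basicOpen s ≤ o ⁻¹ᵁ W.1 := fun q hq ↦ T.basicOpen_le s hq
  refine ⟨⟨_, hV⟩, e, hps, fun q hq ↦ ?_, ?_⟩
  · obtain ⟨q', hq', h⟩ := hs hq
    exact o.isOpenEmbedding.injective h ▸ hq'
  · have h1 : o.appLE W.1 _ e = T.presheaf.map (homOfLE (T.basicOpen_le s)).op ≫
        o.app (T.basicOpen s) := by
      rw [← Scheme.Hom.appLE_eq_app, Scheme.Hom.map_appLE]
    have := W.2.isLocalization_basicOpen s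
    have h2 : T.presheaf.map (homOfLE (T.basicOpen_le s)).op θ ∈
        nonZeroDivisors Γ(T, T.basicOpen s) :=
      IsLocalization.map_nonZeroDivisors_le (.powers s) Γ(T, T.basicOpen s) ⟨θ, hθ, rfl⟩
    have := o.isIso_app _ hs'
    rw [h1]
    exact map_mem_nonZeroDivisors_of_bijective (o.app (T.basicOpen s)).hom
      (ConcreteCategory.bijective_of_isIso _) h2

lemma IsEffectiveCartier.comap {I : T.IdealSheafData} (hI : IsEffectiveCartier I) (o : P ⟶ T)
    [IsOpenImmersion o] : IsEffectiveCartier (I.comap o) := by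
  intro p
  obtain ⟨W, hp, θ, hθ, hW⟩ := hI (o p)
  obtain ⟨V, e, hpV, -, hV⟩ :=
    exists_affineOpens_nonZeroDivisors o W hθ hp (V₀ := ⊤) (by trivial)
  refine ⟨V, hpV, _, hV, ?_⟩
  rw [comap_ideal I o W V e, hW, Ideal.map_span, Set.image_singleton]

/-- If the inverse image of an ideal sheaf is an effective Cartier divisor, it is locally generated
by one of given generators. -/
lemma IsEffectiveCartier.exists_generator {X : Scheme.{u}} {I : X.IdealSheafData} {f : T ⟶ X}
    (hI : IsEffectiveCartier (I.comap f)) (U : X.affineOpens) {Λ : Type*} {a : Λ → Γ(X, U.1)}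
    (ha : I.ideal U = Ideal.span (Set.range a)) {t : T} (ht : f t ∈ U.1) {V₀ : T.Opens}
    (hV₀ : t ∈ V₀) : ∃ (l : Λ) (W : T.affineOpens) (e : W.1 ≤ f ⁻¹ᵁ U.1), t ∈ W.1 ∧ W.1 ≤ V₀ ∧
      f.appLE U.1 W.1 e (a l) ∈ nonZeroDivisors Γ(T, W.1) ∧
      ∀ m, f.appLE U.1 W.1 e (a l) ∣ f.appLE U.1 W.1 e (a m) := by
  obtain ⟨W₀, htW₀, θ₀, hθ₀, hW₀⟩ := hI t
  obtain ⟨W, e, htW, hW, hθ⟩ := exists_affineOpens_nonZeroDivisors (𝟙 T) W₀ hθ₀ htW₀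
    (V₀ := V₀ ⊓ f ⁻¹ᵁ U.1) ⟨hV₀, ht⟩
  have e₁ : W.1 ≤ f ⁻¹ᵁ U.1 := hW.trans inf_le_right
  let θ : Γ(T, W.1) := (𝟙 T : T ⟶ T).appLE W₀.1 W.1 e θ₀
  have h1 : (I.comap f).ideal W = Ideal.span {θ} := by
    have := comap_ideal (I.comap f) (𝟙 T) W₀ W e
    rw [Scheme.IdealSheafData.comap_id, hW₀, Ideal.map_span, Set.image_singleton] at this
    exact this
  have h2 : (I.comap f).ideal W = Ideal.span (Set.range fun m ↦ f.appLE U.1 W.1 e₁ (a m)) := by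
    rw [comap_ideal I f U W e₁, ha, Ideal.map_span, ← Set.range_comp]
    rfl
  have h3 (m : Λ) : ∃ r, r * θ = f.appLE U.1 W.1 e₁ (a m) := by
    rw [← Ideal.mem_span_singleton', ← h1, h2]
    exact Ideal.subset_span ⟨m, rfl⟩
  choose r hr using h3
  -- The `r m * θ` generate the same ideal as `θ`, so cancelling `θ` shows that the `r m` generate
  -- the unit ideal. Near `t` some `r l` is invertible, and there `a l` generates.
  have h4 : Ideal.span (Set.range r) = ⊤ := by
    have h5 : θ ∈ Ideal.span {θ} * Ideal.span (Set.range r) := by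
      rw [Ideal.span_mul_span', Set.singleton_mul, ← Set.range_comp]
      have : Set.range ((fun x ↦ θ * x) ∘ r) = Set.range fun m ↦ f.appLE U.1 W.1 e₁ (a m) := by
        congr 1
        ext m
        simp only [Function.comp_apply]
        rw [mul_comm, hr]
      rw [this, ← h2, h1]
      exact Ideal.mem_span_singleton_self θ
    obtain ⟨z, hz, hz'⟩ := Ideal.mem_span_singleton_mul.mp h5
    have : z = 1 := (mul_cancel_left_mem_nonZeroDivisors hθ).mp (hz'.trans (mul_one _).symm)
    rwa [Ideal.eq_top_iff_one, ← this]
  have h5 := W.2.iSup_basicOpen_eq_self_iff.mpr h4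
  have h6 : t ∈ ⨆ g : Set.range r, T.basicOpen g.1 := h5.ge htW
  obtain ⟨⟨_, l, rfl⟩, hl⟩ := TopologicalSpace.Opens.mem_iSup.mp h6
  obtain ⟨V, e₂, htV, hV, hθV⟩ := exists_affineOpens_nonZeroDivisors (𝟙 T) W hθ htW
    (V₀ := T.basicOpen (r l)) hl
  have e₂' : V.1 ≤ W.1 := e₂
  have h7 (m) : f.appLE U.1 V.1 (e₂'.trans e₁) (a m) =
      T.presheaf.map (homOfLE e₂').op (r m) * (𝟙 T : T ⟶ T).appLE W.1 V.1 e₂ θ := by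
    have h8 : (𝟙 T : T ⟶ T).appLE W.1 V.1 e₂ = T.presheaf.map (homOfLE e₂').op := by
      simp only [Scheme.Hom.appLE, Scheme.Hom.id_app]
      exact Category.id_comp _
    rw [h8, ← map_mul, hr, ← CommRingCat.comp_apply, Scheme.Hom.appLE_map]
  have h8 : IsUnit (T.presheaf.map (homOfLE e₂').op (r l)) := by
    have h9 : IsUnit (T.presheaf.map (homOfLE (T.basicOpen_le (r l))).op (r l)) :=
      RingedSpace.isUnit_res_basicOpen _ _
    have h10 := h9.map (T.presheaf.map (homOfLE hV).op).hom
    rw [← CommRingCat.comp_apply, ← Functor.map_comp] at h10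
    exact h10
  refine ⟨l, V, e₂'.trans e₁, htV, e₂'.trans (hW.trans inf_le_left), ?_, fun m ↦ ?_⟩
  · rw [h7]
    exact mul_mem h8.mem_nonZeroDivisors hθV
  · rw [h7, h7]
    exact mul_dvd_mul h8.dvd dvd_rfl

end Shrinking

/-! ### Equality and factorization of morphisms, checked locally -/

section Locality

variable {T X : Scheme.{u}}

lemma hom_ext_of_locally {g g' : T ⟶ X}
    (H : ∀ t, ∃ V : T.Opens, t ∈ V ∧ V.ι ≫ g = V.ι ≫ g') : g = g' := by
  choose V hV hg using H
  have h : TopologicalSpace.IsOpenCover V :=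
    top_le_iff.mp fun t _ ↦ TopologicalSpace.Opens.mem_iSup.mpr ⟨t, hV t⟩
  exact (T.openCoverOfIsOpenCover V h).hom_ext _ _ hg

lemma ι_comp_eq_toSpecΓ (g : T ⟶ X) {W : T.Opens} (hW : IsAffineOpen W) {U : X.Opens}
    (hU : IsAffineOpen U) (e : W ≤ g ⁻¹ᵁ U) :
    W.ι ≫ g = W.toSpecΓ ≫ Spec.map (g.appLE U W e) ≫ hU.fromSpec := by
  rw [hU.SpecMap_appLE_fromSpec g hW e, hW.toSpecΓ_fromSpec_assoc]

lemma exists_ι_comp_of_factorization {X' : Scheme.{u}} (b : X' ⟶ X) (f : T ⟶ X) {W : T.Opens}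
    (hW : IsAffineOpen W) {U : X.Opens} (hU : IsAffineOpen U) {U' : X'.Opens}
    (hU' : IsAffineOpen U') (e : W ≤ f ⁻¹ᵁ U) (e' : U' ≤ b ⁻¹ᵁ U) (h : Γ(X', U') ⟶ Γ(T, W))
    (hh : b.appLE U U' e' ≫ h = f.appLE U W e) : ∃ g : W.toScheme ⟶ X', g ≫ b = W.ι ≫ f := by
  refine ⟨W.toSpecΓ ≫ Spec.map h ≫ hU'.fromSpec, ?_⟩
  rw [ι_comp_eq_toSpecΓ f hW hU e, ← hh, Spec.map_comp, Category.assoc, Category.assoc,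
    Category.assoc, hU.SpecMap_appLE_fromSpec b hU' e']

end Locality

/-! ### The blow-up through an atlas with product coordinates -/

section BlowUpAtlas

variable {k : Type u} [Field k] {K : Type u} [Field K] [Algebra k K] {X X' T : Scheme.{u}}
  {b : X' ⟶ X} {I : X.IdealSheafData} {η : Spec (.of K) ⟶ X'} {ι Λ : Type*} {ξ : ι → K}
  {φ : Λ → K}

variable (k b I η ξ φ) in
/-- Homogeneous coordinates `ξ` on `X`, homogeneous generators `φ` of the ideal sheaf `I`, and an
atlas of `X'` with coordinates the products of the `ξ i` and the `φ l`. -/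
structure BlowUpAtlas where
  chart : Charts k (η ≫ b) ξ
  chart' : Charts k η fun p : ι × Λ ↦ ξ p.1 * φ p.2
  /-- the degree of the generators -/
  d : ℕ
  /-- the generators of the ideals -/
  a : ∀ i, Λ → Γ(X, (chart.U i).1)
  ne_zero (l : Λ) : φ l ≠ 0
  ev_a (i : ι) (l : Λ) : ev (η ≫ b) _ (chart.top_le i) (a i l) = φ l / ξ i ^ d
  ideal_eq (i : ι) : I.ideal (chart.U i) = Ideal.span (Set.range (a i))

namespace BlowUpAtlas

variable (B : BlowUpAtlas k b I η ξ φ)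

lemma div_eq (B : BlowUpAtlas k b I η ξ φ) (i : ι) (l m : Λ) : ξ i * φ l / (ξ i * φ m) = φ l / φ m :=
  mul_div_mul_left _ _ (B.chart.ne_zero i)

lemma div_eq' (B : BlowUpAtlas k b I η ξ φ)
    (i j : ι) (l : Λ) : ξ i * φ l / (ξ j * φ l) = ξ i / ξ j :=
  mul_div_mul_right _ _ (B.ne_zero l)

lemma exists_quotient (i : ι) (l m : Λ) :
    ∃ β, ev η (B.chart'.U (i, l)).1 (B.chart'.top_le (i, l)) β = φ m / φ l := by
  obtain ⟨β, hβ⟩ := B.chart'.exists_ev_eq_div (i, l) (i, m)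
  exact ⟨β, hβ.trans (B.div_eq i m l)⟩

/-- The section `φ m / φ l`. -/
def quotient (i : ι) (l m : Λ) : Γ(X', (B.chart'.U (i, l)).1) := (B.exists_quotient i l m).choose

lemma ev_quotient (i : ι) (l m : Λ) :
    ev η _ (B.chart'.top_le (i, l)) (B.quotient i l m) = φ m / φ l :=
  (B.exists_quotient i l m).choose_spec

lemma exists_generator (B : BlowUpAtlas k b I η ξ φ)
    {f : T ⟶ X} (hI : IsEffectiveCartier (I.comap f)) (t : T) :
    ∃ (i : ι) (l : Λ) (W : T.affineOpens) (e : W.1 ≤ f ⁻¹ᵁ (B.chart.U i).1), t ∈ W.1 ∧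
      f.appLE _ _ e (B.a i l) ∈ nonZeroDivisors Γ(T, W.1) ∧
      ∀ m, f.appLE _ _ e (B.a i l) ∣ f.appLE _ _ e (B.a i m) := by
  obtain ⟨i, hi⟩ := B.chart.exists_mem (f t)
  obtain ⟨l, W, e, htW, -, h⟩ := hI.exists_generator (B.chart.U i) (B.ideal_eq i) hi (V₀ := ⊤)
    (by trivial)
  exact ⟨i, l, W, e, htW, h⟩

variable [IsReduced X] [IsReduced X'] [IsDominant η] [IsDominant (η ≫ b)]

lemma le (i : ι) (l : Λ) : (B.chart'.U (i, l)).1 ≤ b ⁻¹ᵁ (B.chart.U i).1 := fun x hx ↦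
  (Charts.mem_iff b rfl B.chart i x).mpr fun j ↦ by
    rw [← B.div_eq' j i l]
    exact B.chart'.div_mem_regularAt hx (j, l)

/-- The ring homomorphism between the sections of charts. -/
def res (i : ι) (l : Λ) : Γ(X, (B.chart.U i).1) →+* Γ(X', (B.chart'.U (i, l)).1) :=
  (b.appLE _ _ (B.le i l)).hom

lemma ev_res (i : ι) (l : Λ) (s) : ev η _ (B.chart'.top_le (i, l)) (B.res i l s) =
    ev (η ≫ b) _ (B.chart.top_le i) s := ev_appLE η b (B.le i l) _ _ s

lemma res_injective (i : ι) (l : Λ) : Function.Injective (B.res i l) := fun s t h ↦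
  ev_injective (η ≫ b) (B.chart.top_le i) (by rw [← B.ev_res i l, h, B.ev_res])

lemma quotient_mul_res (i : ι) (l m : Λ) :
    B.quotient i l m * B.res i l (B.a i l) = B.res i l (B.a i m) := by
  apply ev_injective η (B.chart'.top_le (i, l))
  rw [map_mul, B.ev_quotient, B.ev_res, B.ev_res, B.ev_a, B.ev_a, div_mul_div_cancel₀ (B.ne_zero l)]

/-- A coordinate quotient on chart `(i, l)` splits as `ξ j / ξ i` times `φ m / φ l`: the first
factor comes from `X`, and the second is a quotient of generators. -/
lemma closure_eq_top (i : ι) (l : Λ) :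
    Subring.closure (Set.range (B.res i l) ∪ Set.range (B.quotient i l)) = ⊤ := by
  refine eq_top_iff.mpr fun z _ ↦ ?_
  have hres (s) : B.res i l s ∈ Subring.closure (Set.range (B.res i l) ∪
    Set.range (B.quotient i l)) := Subring.subset_closure (.inl ⟨s, rfl⟩)
  have hz := (B.chart'.exists_iff (i, l) _).mp ⟨z, rfl⟩
  suffices ∃ w ∈ Subring.closure (Set.range (B.res i l) ∪ Set.range (B.quotient i l)),
      ev η _ (B.chart'.top_le (i, l)) w = ev η _ (B.chart'.top_le (i, l)) z by
    obtain ⟨w, hw, h⟩ := this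
    exact ev_injective η _ h ▸ hw
  generalize ev η _ (B.chart'.top_le (i, l)) z = y at hz
  induction hz using Algebra.adjoin_induction with
  | mem x hx =>
    obtain ⟨⟨j, m⟩, rfl⟩ := hx
    obtain ⟨s, hs⟩ := B.chart.exists_ev_eq_div i j
    refine ⟨_, mul_mem (hres s) (Subring.subset_closure (.inr ⟨m, rfl⟩)), ?_⟩
    rw [map_mul, B.ev_res, B.ev_quotient, hs, div_mul_div_comm]
  | algebraMap r =>
    obtain ⟨s, hs⟩ := (B.chart.exists_iff i _).mpr (Subalgebra.algebraMap_mem _ r)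
    exact ⟨_, hres s, by rw [B.ev_res, hs]⟩
  | add x y _ _ hx hy =>
    obtain ⟨v, hv, rfl⟩ := hx
    obtain ⟨w, hw, rfl⟩ := hy
    exact ⟨_, add_mem hv hw, map_add _ _ _⟩
  | mul x y _ _ hx hy =>
    obtain ⟨v, hv, rfl⟩ := hx
    obtain ⟨w, hw, rfl⟩ := hy
    exact ⟨_, mul_mem hv hw, map_mul _ _ _⟩

/-- On chart `(i, l)` every `a i m` is a multiple of `a i l`, with factor `φ m / φ l`, and `a i l`
has nonzero value. -/
lemma isEffectiveCartier_comap (B : BlowUpAtlas k b I η ξ φ) :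
    IsEffectiveCartier (I.comap b) := by
  intro x
  obtain ⟨⟨i, l⟩, hx⟩ := B.chart'.exists_mem x
  refine ⟨B.chart'.U (i, l), hx, B.res i l (B.a i l), ?_, ?_⟩
  · refine mem_nonZeroDivisors_iff_right.mpr fun z hz ↦
      ev_injective η (B.chart'.top_le (i, l)) ?_
    have := congr(ev η _ (B.chart'.top_le (i, l)) $hz)
    rw [map_mul, map_zero, B.ev_res, B.ev_a] at this
    rw [map_zero]
    exact (mul_eq_zero.mp this).resolve_right
      (div_ne_zero (B.ne_zero l) (pow_ne_zero _ (B.chart.ne_zero i)))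
  · rw [comap_ideal I b _ _ (B.le i l), B.ideal_eq, Ideal.map_span]
    apply le_antisymm
    · rw [Ideal.span_le]
      rintro _ ⟨_, ⟨m, rfl⟩, rfl⟩
      exact Ideal.mem_span_singleton'.mpr ⟨_, B.quotient_mul_res i l m⟩
    · rw [Ideal.span_singleton_le_iff_mem]
      exact Ideal.subset_span ⟨_, ⟨l, rfl⟩, rfl⟩

/-- If the pullback of the ideal sheaf is generated by the pullback of `a i l` near a point, then
a lift maps this point to the chart `(i, l)`. -/
lemma mem_of_dvd (g : T ⟶ X') {f : T ⟶ X} (hg : g ≫ b = f) {i : ι} {l : Λ} (W : T.affineOpens)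
    (e : W.1 ≤ f ⁻¹ᵁ (B.chart.U i).1) (h₀ : f.appLE _ _ e (B.a i l) ∈ nonZeroDivisors Γ(T, W.1))
    (hdvd : ∀ m, f.appLE _ _ e (B.a i l) ∣ f.appLE _ _ e (B.a i m)) :
    W.1 ≤ g ⁻¹ᵁ (B.chart'.U (i, l)).1 := by
  intro t ht
  subst hg
  obtain ⟨⟨i', l'⟩, ht'⟩ := B.chart'.exists_mem (g t)
  -- The first index can be changed to `i`, since the image of `t` in `X` already lies in chart `i`.
  have h1 : g t ∈ (B.chart'.U (i, l')).1 := by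
    refine B.chart'.mem_of_mem _ (i, l') _ ht' ?_
    simp only
    rw [B.div_eq' i' i l']
    exact regularAt_comp_le η b _ (B.chart.div_mem_regularAt (e ht) i')
  obtain ⟨V, e₁, htV, hV, hθ⟩ := exists_affineOpens_nonZeroDivisors (𝟙 T) W h₀ ht
    (V₀ := g ⁻¹ᵁ (B.chart'.U (i, l')).1) h1
  let G := (g.appLE (B.chart'.U (i, l')).1 V.1 hV).hom
  have h2 (s) : G (B.res i l' s) = (𝟙 T : T ⟶ T).appLE W.1 V.1 e₁ ((g ≫ b).appLE _ _ e s) := by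
    simp only [G, res]
    have h3 := Scheme.Hom.appLE_comp_appLE g b _ _ _ (B.le i l') hV
    have h4 := Scheme.Hom.appLE_comp_appLE (𝟙 T) (g ≫ b) _ _ _ e e₁
    simp only [Category.id_comp] at h4
    exact congr($(h3.trans h4.symm) s)
  obtain ⟨s, hs⟩ := hdvd l'
  have h3 := congr(G $(B.quotient_mul_res i l' l))
  rw [map_mul, h2, h2, hs, map_mul] at h3
  -- The pullbacks of the generators `l` and `l'` divide each other. Cancelling the non-zero-divisor
  -- shows that `φ l / φ l'` pulls back to a unit, so the second index can be changed to `l`.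
  have h4 : G (B.quotient i l' l) * (𝟙 T : T ⟶ T).appLE W.1 V.1 e₁ s = 1 := by
    refine (mul_cancel_left_mem_nonZeroDivisors hθ).mp ?_
    rw [mul_one]
    exact Eq.trans (by ring) h3
  have h5 := Scheme.basicOpen_of_isUnit T (IsUnit.of_mul_eq_one _ h4)
  have h6 : t ∈ V.1 ⊓ g ⁻¹ᵁ X'.basicOpen (B.quotient i l' l) := by
    rw [← Scheme.basicOpen_appLE]
    exact h5.ge htV
  have h7 := (mem_basicOpen_iff η (B.chart'.top_le (i, l')) _ h1).mp h6.2
  rw [B.ev_quotient, inv_div, ← B.div_eq i l' l] at h7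
  exact B.chart'.mem_of_mem (i, l') (i, l) _ h1 h7.2

/-- Where the pulled-back ideal is generated by generator `l` over chart `i`, both lifts land in the
same chart `(i, l)`, and the affine uniqueness applies. -/
lemma lift_unique (B : BlowUpAtlas k b I η ξ φ)
    {f : T ⟶ X} (hI : IsEffectiveCartier (I.comap f)) {g g' : T ⟶ X'}
    (hg : g ≫ b = f) (hg' : g' ≫ b = f) : g = g' := by
  refine hom_ext_of_locally fun t ↦ ?_
  obtain ⟨i, l, W, e, ht, h₀, hdvd⟩ := B.exists_generator hI t
  have e₁ := B.mem_of_dvd g hg W e h₀ hdvd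
  have e₂ := B.mem_of_dvd g' hg' W e h₀ hdvd
  have h1 : b.appLE _ _ (B.le i l) ≫ g.appLE _ _ e₁ = f.appLE _ _ e := by
    rw [Scheme.Hom.appLE_comp_appLE]; simp only [hg]
  have h2 : b.appLE _ _ (B.le i l) ≫ g'.appLE _ _ e₂ = f.appLE _ _ e := by
    rw [Scheme.Hom.appLE_comp_appLE]; simp only [hg']
  have hU' : IsAffineOpen (B.chart'.U (i, l)).1 := (B.chart'.U (i, l)).2
  refine ⟨W.1, ht, ?_⟩
  rw [ι_comp_eq_toSpecΓ g W.2 hU' e₁, ι_comp_eq_toSpecΓ g' W.2 hU' e₂]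
  congr 3
  ext1
  refine ringHom_extension_unique (i := B.res i l) (B.a i) (B.quotient i l)
    (B.quotient_mul_res i l) (B.closure_eq_top i l)
    (congr_arg CommRingCat.Hom.hom (h1.trans h2.symm)) ?_
  have h3 : (g.appLE _ _ e₁).hom (B.res i l (B.a i l)) = f.appLE _ _ e (B.a i l) := congr($h1 _)
  rw [h3]
  exact h₀

/-- Lifts exist locally by extending ring homomorphisms. Uniqueness makes them agree on overlaps,
where the inverse image ideal is still Cartier. -/
lemma isBlowUp (B : BlowUpAtlas k b I η ξ φ) : IsBlowUp b I := by
  refine ⟨B.isEffectiveCartier_comap, fun T f hI ↦ ?_⟩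
  choose i l W e ht h₀ hdvd using B.exists_generator hI
  have H (t : T) : ∃ g : (W t).1.toScheme ⟶ X', g ≫ b = (W t).1.ι ≫ f := by
    obtain ⟨h, hh⟩ := exists_ringHom_extension (B.res_injective (i t) (l t))
      (f.appLE _ _ (e t)).hom (h₀ t) (B.a (i t)) (B.quotient (i t) (l t))
      (B.quotient_mul_res (i t) (l t)) (hdvd t) (B.closure_eq_top (i t) (l t))
    exact exists_ι_comp_of_factorization b f (W t).2 (B.chart.U (i t)).2
      (B.chart'.U (i t, l t)).2 (e t) (B.le (i t) (l t)) (CommRingCat.ofHom h)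
      (CommRingCat.hom_ext hh)
  choose g hg using H
  obtain ⟨G, hG⟩ := exists_glued_hom (fun t ↦ (W t).1) ht g fun s t ↦ by
    refine B.lift_unique (f := (pullback.fst (W s).1.ι (W t).1.ι ≫ (W s).1.ι) ≫ f) ?_ ?_ ?_
    · rw [Scheme.IdealSheafData.comap_comp]
      exact hI.comap _
    · rw [Category.assoc, hg, Category.assoc]
    · rw [Category.assoc, hg, pullback.condition, Category.assoc]
  refine ⟨G, hom_ext_of_locally fun t ↦ ⟨(W t).1, ht t, ?_⟩, fun G' hG' ↦ ?_⟩
  · rw [reassoc_of% hG t, hg]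
  · refine B.lift_unique hI hG' (hom_ext_of_locally fun t ↦ ⟨(W t).1, ht t, ?_⟩)
    rw [reassoc_of% hG t, hg]

end BlowUpAtlas

end BlowUpAtlas

/-! ### Blow-ups over opens where the ideal is invertible -/

section IsoOver

variable {X Y Z S : Scheme.{u}}

lemma IsIsoOver.of_isPullback {f : X ⟶ Y} {j : S ⟶ Y} {j' : S ⟶ X} [hj : IsOpenImmersion j]
    (h : IsPullback j' (𝟙 S) f j) : IsIsoOver f j j' :=
  ⟨MorphismProperty.of_isPullback (P := @IsOpenImmersion) h.flip hj, h⟩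

lemma IsIsoOver.comp {b₁ : Y ⟶ Z} {b₂ : X ⟶ Y} {j : S ⟶ Z} {j₁ : S ⟶ Y} {j₂ : S ⟶ X}
    (h₂ : IsIsoOver b₂ j₁ j₂) (h₁ : IsIsoOver b₁ j j₁) : IsIsoOver (b₂ ≫ b₁) j j₂ :=
  ⟨h₂.1, by simpa using h₂.2.paste_vert h₁.2⟩

lemma IsIsoOver.comp_eq {f : X ⟶ Y} {j : S ⟶ Y} {j' : S ⟶ X} (h : IsIsoOver f j j') :
    j' ≫ f = j := by simpa using h.2.w

/-- A blow-up is an isomorphism over an open on which the ideal sheaf is an effective Cartier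
divisor. -/
lemma IsBlowUp.exists_isIsoOver {b : X ⟶ Y} {I : Y.IdealSheafData} (hb : IsBlowUp b I)
    (j : S ⟶ Y) [IsOpenImmersion j] (hI : IsEffectiveCartier (I.comap j)) :
    ∃ j', IsIsoOver b j j' := by
  obtain ⟨j', hj', -⟩ := hb.existsUnique_lift S j hI
  -- Both sides lift one morphism to `Y` whose inverse image ideal is Cartier, so they coincide.
  -- Hence the preimage of `S` is `S` itself.
  have h1 : pullback.fst b j = pullback.snd b j ≫ j' := by
    have h2 : IsEffectiveCartier (I.comap (pullback.fst b j ≫ b)) := by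
      rw [Scheme.IdealSheafData.comap_comp]
      exact hb.isEffectiveCartier.comap _
    refine (hb.existsUnique_lift _ _ h2).unique rfl ?_
    rw [Category.assoc, hj', pullback.condition]
  have h2 (W : Scheme.{u}) (p : W ⟶ X) (q : W ⟶ S) (h : p ≫ b = q ≫ j) : q ≫ j' = p := by
    rw [← pullback.lift_fst p q h, h1, pullback.lift_snd_assoc]
  exact ⟨j', .of_isPullback ⟨⟨by simpa using hj'⟩, ⟨PullbackCone.IsLimit.mk _ (fun s ↦ s.snd)
    (fun s ↦ h2 _ _ _ s.condition) (fun s ↦ Category.comp_id _)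
    (fun s m _ hm ↦ (Category.comp_id m).symm.trans hm)⟩⟩⟩

end IsoOver

/-! ### Projective blow-ups -/

section Existence

variable {k : Type u} [Field k] {K : Type u} [Field K] [Algebra k K] {X S : Scheme.{u}} {n : ℕ}

lemma isSeparated_of_isClosedImmersion (i : X ⟶ PSpace n k) [IsClosedImmersion i] :
    X.IsSeparated := by
  have : (PSpace n k).IsSeparated :=
    inferInstanceAs (Proj (MvPolynomial.homogeneousSubmodule (Fin (n + 1)) k)).IsSeparated
  refine ⟨?_⟩
  rw [← terminal.comp_from i]
  infer_instance

/-- The blow-up of a projective scheme in a nonzero ideal sheaf is projective. -/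
lemma exists_isBlowUp (i : X ⟶ PSpace n k) [IsClosedImmersion i] [IsIntegral X]
    (η : Spec (.of K) ⟶ X) [IsDominant η]
    (hη : η ≫ i ≫ PSpace.toSpec n k = Spec.map (CommRingCat.ofHom (algebraMap k K)))
    (I : X.IdealSheafData) (hI : I ≠ ⊥) :
    ∃ (m : ℕ) (X' : Scheme.{u}) (i' : X' ⟶ PSpace m k) (b : X' ⟶ X) (η' : Spec (.of K) ⟶ X'),
      IsClosedImmersion i' ∧ IsIntegral X' ∧ IsDominant η' ∧
      b ≫ i ≫ PSpace.toSpec n k = i' ≫ PSpace.toSpec m k ∧ η' ≫ b = η ∧ IsBlowUp b I := by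
  obtain ⟨ξ, j₀, hj₀, hξ⟩ := exists_projPoint (η ≫ i) (by rw [Category.assoc, hη])
  obtain ⟨c⟩ := nonempty_charts i η ξ hj₀ hξ
  have hI' : ∃ j, I.ideal (c.U j) ≠ ⊥ := by
    by_contra! H
    refine hI (Scheme.IdealSheafData.ext_of_iSup_eq_top c.U ?_ H)
    exact top_le_iff.mp fun x _ ↦ TopologicalSpace.Opens.mem_iSup.mpr (c.exists_mem x)
  obtain ⟨Λ, _, _, φ, d, a, hφ, ha, hIa⟩ := c.exists_generators I hI'
  have : Nonempty {j // ξ j ≠ 0} := ⟨⟨j₀, hj₀⟩⟩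
  -- The products `ξ i * φ l` combine the coordinates of `X` with those of the blow-up, as in the
  -- Segre embedding.
  obtain ⟨m, X', i', η', hi', hX', hη', h', ⟨c'⟩⟩ := exists_charts k
    (fun p : {j // ξ j ≠ 0} × Λ ↦ ξ p.1 * φ p.2) fun p ↦ mul_ne_zero p.1.2 (hφ p.2)
  have : X.IsSeparated := isSeparated_of_isClosedImmersion i
  obtain ⟨b, hb⟩ := c.exists_hom (τ := η') c'.algebraMap_mem_regularAt fun t ↦ by
    obtain ⟨⟨j, l⟩, ht⟩ := c'.exists_mem t
    refine ⟨j, fun j' ↦ ?_⟩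
    have := c'.div_mem_regularAt ht (j', l)
    rwa [mul_div_mul_right _ _ (hφ l)] at this
  subst hb
  let B : BlowUpAtlas k b I η' (fun j : {j // ξ j ≠ 0} ↦ ξ j) φ :=
    ⟨c, c', d, a, hφ, ha, hIa⟩
  refine ⟨m, X', i', b, η', hi', hX', hη', ext_of_isDominant η' ?_, rfl, B.isBlowUp⟩
  rw [h', ← hη, Category.assoc]

/-- The blow-up of a projective scheme in the closure of an effective Cartier divisor on an open. -/
lemma exists_isBlowUp_map (i : X ⟶ PSpace n k) [IsClosedImmersion i] [IsIntegral X]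
    (j : S ⟶ X) [IsOpenImmersion j] [QuasiCompact j] (η : Spec (.of K) ⟶ S)
    [IsDominant (η ≫ j)]
    (hη : η ≫ j ≫ i ≫ PSpace.toSpec n k = Spec.map (CommRingCat.ofHom (algebraMap k K)))
    {J : S.IdealSheafData} (hJ : IsEffectiveCartier J) :
    ∃ (m : ℕ) (X' : Scheme.{u}) (i' : X' ⟶ PSpace m k) (b : X' ⟶ X) (j' : S ⟶ X'),
      IsClosedImmersion i' ∧ IsIntegral X' ∧ IsDominant (η ≫ j') ∧
      b ≫ i ≫ PSpace.toSpec n k = i' ≫ PSpace.toSpec m k ∧ IsBlowUp b (J.map j) ∧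
      IsIsoOver b j j' := by
  have hJ' : IsEffectiveCartier ((J.map j).comap j) := by rwa [comap_map_of_isOpenImmersion]
  have hJ₀ : J.map j ≠ ⊥ := by
    intro h0
    obtain ⟨x, -⟩ := exists_mem_of_top_le η (U := ⊤) le_rfl
    obtain ⟨_, ⟨U, hU, rfl⟩, hxU, -⟩ := X.isBasis_affineOpens.exists_subset_of_mem_open
      (show j x ∈ (⊤ : X.Opens) by trivial) isOpen_univ
    -- The zero ideal is generated by the single element `0`, which would pull back to a
    -- non-zero-divisor in a nontrivial ring.
    obtain ⟨_, W, _, hxW, -, h1, -⟩ := hJ'.exists_generator ⟨U, hU⟩ (Λ := Unit) (a := 0)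
      (by rw [h0]; simp) hxU (V₀ := ⊤) (by trivial)
    have hd : IsDominant η := .of_comp_of_isOpenImmersion η j
    have : Nontrivial Γ(S, W.1) := (ev η _ (top_le_preimage_of_mem η hxW)).domain_nontrivial
    exact nonZeroDivisors.ne_zero h1 (map_zero _)
  obtain ⟨m, X', i', b, η', hi', hX', hη', h', hb, hB⟩ :=
    exists_isBlowUp i (η ≫ j) (by rw [Category.assoc, hη]) (J.map j) hJ₀
  obtain ⟨j', hj'⟩ := hB.exists_isIsoOver j hJ'
  refine ⟨m, X', i', b, j', hi', hX', ?_, h', hB, hj'⟩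
  have h1 := hj'.2.lift_fst η' η hb
  have h2 := hj'.2.lift_snd η' η hb
  rw [Category.comp_id] at h2
  rwa [← h2, h1]

end Existence

/-! ### Clearing the denominators of a Cartier divisor -/

section CommonDenominators

variable {k : Type u} [Field k] {K : Type u} [Field K] [Algebra k K] {X S : Scheme.{u}}

lemma IsCartierDatum.mul {η : Spec (.of K) ⟶ X} {c c' : X → K} (h : IsCartierDatum η c)
    (h' : IsCartierDatum η c') : IsCartierDatum η fun x ↦ c x * c' x := by
  intro x
  obtain ⟨U, hU, g, hg⟩ := h x
  obtain ⟨V, hV, g', hg'⟩ := h' x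
  exact ⟨U ⊓ V, ⟨hU, hV⟩, g * g', fun y hy ↦
    UnitAt.mul (hg y hy.1) (hg' y hy.2)⟩

lemma IsCartierDatum.div {η : Spec (.of K) ⟶ X} {c c' : X → K} (h : IsCartierDatum η c)
    (h' : IsCartierDatum η c') : IsCartierDatum η fun x ↦ c x / c' x := by
  intro x
  obtain ⟨U, hU, g, hg⟩ := h x
  obtain ⟨V, hV, g', hg'⟩ := h' x
  exact ⟨U ⊓ V, ⟨hU, hV⟩, g / g', fun y hy ↦
    UnitAt.div (hg y hy.1) (hg' y hy.2)⟩

/-- Rational functions are quotients of homogeneous elements of the same degree. -/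
lemma Charts.exists_eq_div [IsReduced X] {η : Spec (.of K) ⟶ X} [IsDominant η] {ι : Type*}
    [Finite ι] [Nonempty ι] {ξ : ι → K} (c : Charts k η ξ)
    (hK : ∀ (U : X.affineOpens) (h : ⊤ ≤ η ⁻¹ᵁ U.1) (s : K),
      ∃ p q, ev η U.1 h q ≠ 0 ∧ s = ev η U.1 h p / ev η U.1 h q) (s : K) :
    ∃ (d : ℕ) (P Q : K), Q ≠ 0 ∧ s = P / Q ∧ ∀ i, ∀ x ∈ (c.U i).1,
      P / ξ i ^ d ∈ regularAt η x ∧ Q / ξ i ^ d ∈ regularAt η x := by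
  have := Fintype.ofFinite ι
  let i₀ := Classical.arbitrary ι
  obtain ⟨p, q, hq, rfl⟩ := hK (c.U i₀) (c.top_le i₀) s
  -- With the unit ideal the membership condition is empty, and only the extension from chart to
  -- chart is used.
  have h1 (b : Γ(X, (c.U i₀).1)) (i : ι) := c.exists_pow_mul ⊤ i i₀ (b := b) trivial
  choose n hn using h1
  let N (b) := Finset.univ.sup (n b)
  have hN (b i) : n b i ≤ N b := Finset.le_sup (Finset.mem_univ i)
  have key (b) (hb : N b ≤ N p + N q) (i : ι) (x : X) (hx : x ∈ (c.U i).1) :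
      ξ i₀ ^ (N p + N q) * ev η _ (c.top_le i₀) b / ξ i ^ (N p + N q) ∈ regularAt η x := by
    obtain ⟨a, -, ha⟩ := hn b i _ ((hN b i).trans hb)
    have := ev_mem_regularAt η (c.top_le i) hx a
    rwa [ha, div_pow, div_mul_eq_mul_div] at this
  refine ⟨N p + N q, _, _, mul_ne_zero (pow_ne_zero (N p + N q) (c.ne_zero i₀)) hq,
    (mul_div_mul_left _ _ (pow_ne_zero _ (c.ne_zero i₀))).symm, fun i x hx ↦
    ⟨key p (Nat.le_add_right _ _) i x hx, key q (Nat.le_add_left _ _) i x hx⟩⟩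

/-- A Cartier divisor on a quasi-projective scheme is the difference of two effective ones. -/
lemma Charts.exists_isCartierDatum [IsReduced X] [CompactSpace S] {σ : Spec (.of K) ⟶ S}
    (j : S ⟶ X) [IsOpenImmersion j] [IsDominant (σ ≫ j)] {ι : Type*}
    [Finite ι] [Nonempty ι] {ξ : ι → K} (c : Charts k (σ ≫ j) ξ)
    (hK : ∀ (U : X.affineOpens) (h : ⊤ ≤ (σ ≫ j) ⁻¹ᵁ U.1) (s : K),
      ∃ p q, ev (σ ≫ j) U.1 h q ≠ 0 ∧ s = ev (σ ≫ j) U.1 h p / ev (σ ≫ j) U.1 h q)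
    {m : S → K} (hm : IsCartierDatum σ m) :
    ∃ l : S → K, IsCartierDatum σ l ∧ (∀ x, l x ∈ regularAt σ x) ∧
      ∀ x, m x * l x ∈ regularAt σ x := by
  -- Here `γ` acts as a form of degree `d` that clears the denominators of `m`. Its regularity is
  -- required on all of `S`, so that multiplying two such forms keeps what each has achieved.
  have H : ∃ (d : ℕ) (γ : K), γ ≠ 0 ∧ ∀ x i, j x ∈ (c.U i).1 →
      γ / ξ i ^ d ∈ regularAt σ x ∧ (x ∈ Set.univ → m x * (γ / ξ i ^ d) ∈ regularAt σ x) := by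
    refine CompactSpace.isCompact_univ.induction_on (p := fun s ↦ ∃ (d : ℕ) (γ : K), γ ≠ 0 ∧
      ∀ x i, j x ∈ (c.U i).1 → γ / ξ i ^ d ∈ regularAt σ x ∧
        (x ∈ s → m x * (γ / ξ i ^ d) ∈ regularAt σ x)) ?_ ?_ ?_ ?_
    · exact ⟨0, 1, one_ne_zero, fun x i _ ↦ ⟨by simp, fun h ↦ h.elim⟩⟩
    · rintro s t hst ⟨d, γ, hγ, h⟩
      exact ⟨d, γ, hγ, fun x i hx ↦ ⟨(h x i hx).1, fun hs ↦ (h x i hx).2 (hst hs)⟩⟩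
    · rintro s t ⟨d, γ, hγ, h⟩ ⟨d', γ', hγ', h'⟩
      refine ⟨d + d', γ * γ', mul_ne_zero hγ hγ', fun x i hx ↦ ?_⟩
      obtain ⟨h1, h2⟩ := h x i hx
      obtain ⟨h1', h2'⟩ := h' x i hx
      rw [pow_add, ← div_mul_div_comm]
      refine ⟨mul_mem h1 h1', ?_⟩
      rintro (hs | ht)
      · rw [← mul_assoc]
        exact mul_mem (h2 hs) h1'
      · rw [mul_left_comm]
        exact mul_mem h1 (h2' ht)
    · intro x _
      obtain ⟨V, hxV, g, hg⟩ := hm x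
      -- The denominator `Q` of the local generator works on `V`, because `m y * (Q / ξ i ^ d)` is
      -- `m y / g` times `P / ξ i ^ d`.
      obtain ⟨d, P, Q, hQ, rfl, h⟩ := c.exists_eq_div hK g
      refine ⟨V, mem_nhdsWithin_of_mem_nhds (V.isOpen.mem_nhds hxV), d, Q, hQ, fun y i hy ↦ ?_⟩
      rw [← regularAt_comp σ j y]
      refine ⟨(h i _ hy).2, fun hyV ↦ ?_⟩
      obtain ⟨h0, -, -, h1⟩ := hg y hyV
      rw [← regularAt_comp σ j y] at h1
      have hP : P ≠ 0 := left_ne_zero_of_mul (div_eq_mul_inv P Q ▸ h0)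
      have h2 := mul_mem h1 (h i _ hy).1
      convert h2 using 1
      field_simp
  obtain ⟨d, γ, hγ, h⟩ := H
  choose i hi using fun x ↦ c.exists_mem (j x)
  -- A change of chart multiplies `l` by the `d`-th power of a coordinate quotient, a unit on the
  -- overlap, so any choice of chart at each point is allowed.
  refine ⟨fun x ↦ γ / ξ (i x) ^ d, fun x ↦ ⟨j ⁻¹ᵁ (c.U (i x)).1, hi x, γ / ξ (i x) ^ d,
    fun y hy ↦ ?_⟩, fun x ↦ (h x _ (hi x)).1, fun x ↦ (h x _ (hi x)).2 trivial⟩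
  have h0 (l : ι) : ξ l ^ d ≠ 0 := pow_ne_zero _ (c.ne_zero l)
  refine ⟨div_ne_zero hγ (h0 _), div_ne_zero hγ (h0 _), ?_, ?_⟩
  · rw [div_div_div_cancel_left' _ _ hγ, ← div_pow, ← regularAt_comp σ j y]
    exact pow_mem (c.div_mem_regularAt hy _) _
  · rw [div_div_div_cancel_left' _ _ hγ, ← div_pow, ← regularAt_comp σ j y]
    exact pow_mem (c.div_mem_regularAt (hi y) _) _

end CommonDenominators

/-! ### Finiteness and separatedness of projective space -/

section ProjectiveSpace

variable {k : Type u} [Field k] {n : ℕ}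

lemma algebraMap_homogeneousSubmodule_zero_surjective : Function.Surjective
    (algebraMap k (MvPolynomial.homogeneousSubmodule (Fin (n + 1)) k 0)) := by
  rintro ⟨p, hp⟩
  have hp' : p.IsHomogeneous 0 := hp
  have h1 := MvPolynomial.totalDegree_eq_zero_iff_eq_C.mp
    (Nat.le_zero.mp hp'.totalDegree_le)
  exact ⟨_, Subtype.ext h1.symm⟩

instance : IsScalarTower k (MvPolynomial.homogeneousSubmodule (Fin (n + 1)) k 0)
    (MvPolynomial (Fin (n + 1)) k) :=
  .of_algebraMap_eq (R := k) (S := MvPolynomial.homogeneousSubmodule (Fin (n + 1)) k 0)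
    (A := MvPolynomial (Fin (n + 1)) k) fun _ ↦ rfl

instance : Algebra.FiniteType (MvPolynomial.homogeneousSubmodule (Fin (n + 1)) k 0)
    (MvPolynomial (Fin (n + 1)) k) :=
  .of_restrictScalars_finiteType k _ _

instance : IsSeparated (PSpace.toSpec n k) :=
  MorphismProperty.comp_mem @IsSeparated
    (Proj.toSpecZero (MvPolynomial.homogeneousSubmodule (Fin (n + 1)) k)) _
    inferInstance inferInstance

instance : QuasiCompact (PSpace.toSpec n k) :=
  MorphismProperty.comp_mem @QuasiCompact
    (Proj.toSpecZero (MvPolynomial.homogeneousSubmodule (Fin (n + 1)) k)) _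
    inferInstance inferInstance

instance : LocallyOfFiniteType (PSpace.toSpec n k) :=
  MorphismProperty.comp_mem @LocallyOfFiniteType
    (Proj.toSpecZero (MvPolynomial.homogeneousSubmodule (Fin (n + 1)) k)) _ inferInstance
    ((HasRingHomProperty.Spec_iff (P := @LocallyOfFiniteType)).mpr
      (.of_surjective _ algebraMap_homogeneousSubmodule_zero_surjective))

lemma isVariety_of_isClosedImmersion {X : Scheme.{u}} [IsReduced X] (i : X ⟶ PSpace n k)
    [IsClosedImmersion i] : IsVariety (i ≫ PSpace.toSpec n k) :=
  ⟨inferInstance, inferInstance, inferInstance, inferInstance⟩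

end ProjectiveSpace

/-! ### Birationality from an isomorphism over a dense open -/

section Birational

variable {X Y S : Scheme.{u}}

lemma IsIsoOver.isBirationalMorphism {f : X ⟶ Y} {j : S ⟶ Y} {j' : S ⟶ X} [hj : IsOpenImmersion j]
    [IsDominant j] [IsDominant j'] (h : IsIsoOver f j j') : IsBirationalMorphism f := by
  have hj' := h.1
  refine ⟨⟨j'.opensRange, j'.denseRange, j.opensRange, j.denseRange,
    j'.isoOpensRange.symm ≪≫ j.isoOpensRange⟩, ?_⟩
  rw [← cancel_epi j'.isoOpensRange.hom]
  simp [h.comp_eq]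

end Birational

/-! ### The function field as a dominant point -/

section GenericPoint

/-- The generic point of an integral scheme. -/
lemma exists_isDominant_exists_eq_div (X : Scheme.{u}) [IsIntegral X] :
    ∃ (K : Type u) (_ : Field K) (η : Spec (.of K) ⟶ X), IsDominant η ∧
      ∀ (U : X.affineOpens) (h : ⊤ ≤ η ⁻¹ᵁ U.1) (s : K),
        ∃ p q, ev η U.1 h q ≠ 0 ∧ s = ev η U.1 h p / ev η U.1 h q := by
  obtain ⟨x₀⟩ : Nonempty X := inferInstance
  obtain ⟨_, ⟨U₀, hU₀, rfl⟩, hx₀, -⟩ := X.isBasis_affineOpens.exists_subset_of_mem_open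
    (show x₀ ∈ (⊤ : X.Opens) by trivial) isOpen_univ
  have : Nonempty U₀ := ⟨⟨x₀, hx₀⟩⟩
  let A := Γ(X, U₀)
  let K := FractionRing A
  let φ : Γ(X, U₀) ⟶ .of K := CommRingCat.ofHom (algebraMap A K)
  have h1 : IsDominant (Spec.map φ) := ⟨by
    refine (PrimeSpectrum.denseRange_comap_iff_ker_le_nilRadical (algebraMap A K)).mpr ?_
    rw [(RingHom.injective_iff_ker_eq_bot _).mp (IsFractionRing.injective A K)]
    exact bot_le⟩
  have h2 : IsDominant hU₀.fromSpec := ⟨by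
    rw [DenseRange, hU₀.range_fromSpec]
    exact U₀.isOpen.dense ⟨x₀, hx₀⟩⟩
  let η := Spec.map φ ≫ hU₀.fromSpec
  have hη : IsDominant η := inferInstance
  refine ⟨K, inferInstance, η, hη, fun U h s ↦ ?_⟩
  have h₀ : ⊤ ≤ η ⁻¹ᵁ U₀ := top_le_preimage_SpecMap_fromSpec hU₀ φ
  obtain ⟨x, hx⟩ := exists_mem_of_top_le η (U := U.1 ⊓ U₀) fun q hq ↦ ⟨h hq, h₀ hq⟩
  obtain ⟨f, hf, hxf⟩ := U.2.exists_basicOpen_le (V := U₀) ⟨x, hx.2⟩ hx.1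
  have hf₀ := ev_ne_zero_of_top_le_basicOpen η h f (top_le_preimage_of_mem η hxf)
  -- The field is built from the single affine open `U₀`. Numerators and denominators are moved to
  -- `U` by a power of `f`, whose basic open lies in `U₀`.
  have h3 (a : A) : ∃ (N : ℕ) (a' : Γ(X, U.1)), ev η U.1 h a' = ev η U.1 h f ^ N * algebraMap A K a :=
    exists_pow_mul_ev η U.2 h f _ fun y hy ↦ by
      have : ev η U₀ h₀ a = algebraMap A K a := ev_SpecMap_fromSpec hU₀ φ h₀ a
      rw [← this]
      exact ev_mem_regularAt η h₀ (hf hy) a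
  obtain ⟨a, b, hb, rfl⟩ := IsFractionRing.div_surjective (A := A) s
  have hb₀ : algebraMap A K b ≠ 0 :=
    (map_ne_zero_iff _ (IsFractionRing.injective A K)).mpr (nonZeroDivisors.ne_zero hb)
  obtain ⟨N, a', ha'⟩ := h3 a
  obtain ⟨N', b', hb'⟩ := h3 b
  refine ⟨a' * f ^ N', b' * f ^ N, ?_, ?_⟩
  · rw [map_mul, map_pow, hb']
    exact mul_ne_zero (mul_ne_zero (pow_ne_zero _ hf₀) hb₀) (pow_ne_zero _ hf₀)
  · rw [map_mul, map_mul, map_pow, map_pow, ha', hb']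
    rw [div_eq_div_iff hb₀ (mul_ne_zero (mul_ne_zero (pow_ne_zero _ hf₀) hb₀)
      (pow_ne_zero _ hf₀))]
    ring

end GenericPoint

/-! ### Writing a line bundle as a difference of divisors and extending it -/

section Extension

variable {k : Type u} [Field k] {K : Type u} [Field K] [Algebra k K] {n : ℕ} {X S : Scheme.{u}}

/-- A line bundle on a quasi-projective scheme is `O(C - E)` for effective Cartier divisors. -/
lemma IsLineBundle.exists_isODifference (i : X ⟶ PSpace n k) [IsClosedImmersion i] [IsIntegral X]
    (j : S ⟶ X) [IsOpenImmersion j] [CompactSpace S] (σ : Spec (.of K) ⟶ S) [IsDominant (σ ≫ j)]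
    (hσ : σ ≫ j ≫ i ≫ PSpace.toSpec n k = Spec.map (CommRingCat.ofHom (algebraMap k K)))
    (hK : ∀ (U : X.affineOpens) (h : ⊤ ≤ (σ ≫ j) ⁻¹ᵁ U.1) (s : K),
      ∃ p q, ev (σ ≫ j) U.1 h q ≠ 0 ∧ s = ev (σ ≫ j) U.1 h p / ev (σ ≫ j) U.1 h q)
    {M : S.Modules} (hM : IsLineBundle M) :
    ∃ (v : Valued σ M.val) (m l : S → K) (C E : S.IdealSheafData), v.Presents m ∧
      IsLocalEquation σ C l ∧ IsLocalEquation σ E (fun x ↦ m x * l x) ∧ IsODifference M C E := by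
  have : IsDominant σ := .of_comp_of_isOpenImmersion σ j
  have : IsReduced S := isReduced_of_isOpenImmersion j
  obtain ⟨v, m, hm, hv⟩ := hM.exists_presents (η := σ)
  obtain ⟨ξ, j₀, hj₀, hξ⟩ := exists_projPoint ((σ ≫ j) ≫ i) (by
    rw [Category.assoc, Category.assoc, hσ])
  obtain ⟨c⟩ := nonempty_charts i (σ ≫ j) ξ hj₀ hξ
  have : Nonempty {j // ξ j ≠ 0} := ⟨⟨j₀, hj₀⟩⟩
  obtain ⟨l, hl, hreg, hreg'⟩ := c.exists_isCartierDatum j hK hm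
  obtain ⟨C, hC⟩ := exists_isLocalEquation_of_isCartierDatum hl hreg
  obtain ⟨E, hE⟩ := exists_isLocalEquation_of_isCartierDatum (hm.mul hl) hreg'
  exact ⟨v, m, l, C, E, hv, hC, hE, hv.nonempty_tensor_iso (idealValued_presents C l hC)
    (idealValued_presents E _ hE) hm hl (hE.unitEquiv hE)⟩

/-- Pulled back to `S`, the inverse image ideal becomes `J` by functoriality, and two families of
local equations of one ideal agree up to units. -/
lemma IsLocalEquation.comap_of_comp_eq {Y Z : Scheme.{u}} {f : Y ⟶ Z} {j : S ⟶ Z} {j' : S ⟶ Y}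
    (hj' : j' ≫ f = j) {σ : Spec (.of K) ⟶ S} [IsDominant σ] [IsDominant (σ ≫ j')]
    {I : Z.IdealSheafData} {J : S.IdealSheafData} (hJ : I.comap j = J) {c : Y → K} {l : S → K}
    (hc : IsLocalEquation (σ ≫ j') (I.comap f) c) [IsReduced S] (hl : IsLocalEquation σ J l) :
    UnitEquiv σ (c ∘ j') l := by
  have h := hc.comap j'
  rw [← Scheme.IdealSheafData.comap_comp, hj', hJ] at h
  exact h.unitEquiv hl

/-- The line bundle `O(C - E)` on an open extends when `C` and `E` do. -/
lemma exists_isLineBundle_nonempty_iso {Y : Scheme.{u}} [IsReduced Y] (j' : S ⟶ Y)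
    [IsOpenImmersion j'] (σ : Spec (.of K) ⟶ S) [IsDominant σ] [IsDominant (σ ≫ j')]
    {M : S.Modules} {v : Valued σ M.val} {m l : S → K} (hv : v.Presents m) {c e : Y → K}
    (hc : IsCartierDatum (σ ≫ j') c) (he : IsCartierDatum (σ ≫ j') e)
    (hcl : UnitEquiv σ (c ∘ j') l) (hel : UnitEquiv σ (e ∘ j') fun x ↦ m x * l x) :
    ∃ M' : Y.Modules, IsLineBundle M' ∧
      Nonempty ((Scheme.Modules.pullback j').obj M' ≅ M) := by
  -- On `S` the quotient `e / c` becomes `m * l / l = m` up to units, so the extension has the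
  -- required restriction.
  obtain ⟨M', v', hv'⟩ := exists_presents (σ ≫ j') fun x ↦ e x / c x
  refine ⟨M', hv'.isLineBundle (he.div hc), ?_⟩
  have h1 : UnitEquiv σ ((fun x ↦ e x / c x) ∘ j') m := fun x ↦ by
    have h2 := UnitAt.div (η := σ) (x := x) (hel x) (hcl x)
    rwa [mul_div_cancel_right₀ _ (hcl x).2.1] at h2
  obtain ⟨φ⟩ := ((hv'.restrict j').congr h1).nonempty_iso hv
  exact ⟨((Scheme.Modules.restrictFunctorIsoPullback j').app M').symm ≪≫ φ⟩

end Extension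

end

end BlowUpExt

/-! ### The two blow-ups and the extended line bundle -/

open BlowUpExt in
theorem mainTheorem3 {k : Type u} [Field k] {n : ℕ} {S : Scheme.{u}}
    (i : S ⟶ PSpace n k) (hi : IsImmersion i)
    (hS : IsVariety (i ≫ PSpace.toSpec n k)) (hirr : IrreducibleSpace S)
    (M : S.Modules) (hM : IsLineBundle M) :
    ∃ (S' : Scheme.{u}) (γ : S' ⟶ i.image) (j' : S ⟶ S') (M' : S'.Modules),
      IsVariety (γ ≫ i.imageι ≫ PSpace.toSpec n k) ∧
      IsProjective (γ ≫ i.imageι ≫ PSpace.toSpec n k) ∧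
      IrreducibleSpace S' ∧
      IsBirationalMorphism γ ∧
      IsIsoOver γ i.toImage j' ∧
      IsLineBundle M' ∧
      Nonempty ((Scheme.Modules.pullback j').obj M' ≅ M) ∧
      ∃ (C E : S.IdealSheafData) (Cbar : i.image.IdealSheafData)
        (S₁ : Scheme.{u}) (b₁ : S₁ ⟶ i.image) (j₁ : S ⟶ S₁)
        (Ebar : S₁.IdealSheafData) (b₂ : S' ⟶ S₁),
        IsEffectiveCartier C ∧ IsEffectiveCartier E ∧ IsODifference M C E ∧
        Cbar.comap i.toImage = C ∧ IsBlowUp b₁ Cbar ∧ IsIsoOver b₁ i.toImage j₁ ∧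
        Ebar.comap j₁ = E ∧ IsBlowUp b₂ Ebar ∧ IsIsoOver b₂ j₁ j' ∧
        γ = b₂ ≫ b₁ := by
  have := hS.isReduced
  have := hS.quasiCompact
  have : CompactSpace S := QuasiCompact.compactSpace_of_compactSpace (i ≫ PSpace.toSpec n k)
  have : QuasiCompact i := .of_comp i (PSpace.toSpec n k)
  have : IsReduced i.image := isReduced_image i
  have : IsIntegral i.image := isIntegral_of_isDominant i.toImage
  obtain ⟨K, _, η, hη, hK⟩ := exists_isDominant_exists_eq_div i.image
  -- The generic point of the closure lies in the nonempty open `S`, so one `K`-point serves for `S`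
  -- and for both blow-ups.
  obtain ⟨σ, rfl⟩ : ∃ σ : Spec (.of K) ⟶ S, σ ≫ i.toImage = η := by
    obtain ⟨x⟩ : Nonempty S := inferInstance
    refine ⟨IsOpenImmersion.lift i.toImage η ?_, IsOpenImmersion.lift_fac _ _ _⟩
    rintro _ ⟨q, rfl⟩
    exact top_le_preimage_of_mem η (U := i.toImage.opensRange) ⟨x, rfl⟩
      (TopologicalSpace.Opens.mem_top q)
  have : IsDominant σ := .of_comp_of_isOpenImmersion σ i.toImage
  -- The field `K` gets its `k`-algebra structure from the structure morphism at the point, so that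
  -- the point has homogeneous coordinates over `k`.
  let _ : Algebra k K :=
    (Spec.preimage (σ ≫ i.toImage ≫ i.imageι ≫ PSpace.toSpec n k)).hom.toAlgebra
  have hk : σ ≫ i.toImage ≫ i.imageι ≫ PSpace.toSpec n k =
    Spec.map (CommRingCat.ofHom (algebraMap k K)) := (Spec.map_preimage _).symm
  obtain ⟨v, m, l, C, E, hv, hC, hE, hCE⟩ :=
    hM.exists_isODifference i.imageι i.toImage σ hk hK
  obtain ⟨n₁, S₁, i₁, b₁, j₁, _, _, _, h₁, hb₁, hj₁⟩ :=
    exists_isBlowUp_map i.imageι i.toImage σ hk hC.isEffectiveCartier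
  have := hj₁.1
  have := isSeparated_of_isClosedImmersion i₁
  obtain ⟨n₂, S', i₂, b₂, j', _, _, _, h₂, hb₂, hj'⟩ :=
    exists_isBlowUp_map i₁ j₁ σ (by rw [← h₁, reassoc_of% hj₁.comp_eq, hk]) hE.isEffectiveCartier
  have := hj'.1
  have hj := hj'.comp hj₁
  have hγ : (b₂ ≫ b₁) ≫ i.imageι ≫ PSpace.toSpec n k = i₂ ≫ PSpace.toSpec n₂ k := by
    rw [Category.assoc, h₁, h₂]
  have : IsDominant j' := .of_comp σ j'
  have hσ₁ : σ ≫ j₁ = (σ ≫ j') ≫ b₂ := by rw [Category.assoc, hj'.comp_eq]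
  have hd₁ : IsDominant ((σ ≫ j') ≫ b₂) := hσ₁ ▸ inferInstance
  -- The inverse image of the first ideal is invertible on `S₁`. Its equations are pulled back to
  -- `S'`, where they are compared with those of the second.
  obtain ⟨c₁, hc₁⟩ := exists_isLocalEquation (η := (σ ≫ j') ≫ b₂) hb₁.isEffectiveCartier
  have hc := hc₁.comap b₂
  rw [← Scheme.IdealSheafData.comap_comp] at hc
  obtain ⟨e, he⟩ := exists_isLocalEquation (η := σ ≫ j') hb₂.isEffectiveCartier
  have hCj := comap_map_of_isOpenImmersion C i.toImage
  have hEj := comap_map_of_isOpenImmersion E j₁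
  obtain ⟨M', hM', hM''⟩ := exists_isLineBundle_nonempty_iso j' σ hv hc.isCartierDatum
    he.isCartierDatum (hc.comap_of_comp_eq hj.comp_eq hCj hC)
    (he.comap_of_comp_eq hj'.comp_eq hEj hE)
  exact ⟨S', b₂ ≫ b₁, j', M', hγ ▸ isVariety_of_isClosedImmersion i₂, hγ ▸ ⟨n₂, i₂, ‹_›, rfl⟩,
    inferInstance, hj.isBirationalMorphism, hj, hM', hM'', C, E, C.map i.toImage, S₁, b₁, j₁,
    E.map j₁, b₂, hC.isEffectiveCartier, hE.isEffectiveCartier, hCE, hCj, hb₁, hj₁, hEj, hb₂, hj',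
    rfl⟩
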